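/- Let $d\in\mathbb N_0$, $r\in\mathbb N$, $\varepsilon>0$, $L=\varepsilon r$, $\varepsilon_N=2^{-N}\varepsilon$, $r_N=2^Nr$, and for $N\in\mathbb N_0$ let $\Lambda_N=\varepsilon_N\{-r_N,\dots,r_N-1\}^d$ and $\Gamma_N=\frac{\pi}{L}\{-r_N,\dots,r_N-1\}^d\subset\frac{\pi}{L}\mathbb Z^d$. For a complex Hilbert space $\mathfrak h$ let $\mathcal W(\mathfrak h)$ be its Weyl algebra, the $C^*$-algebra generated by unitaries $W(\xi)$, $\xi\in\mathfrak h$, with $W(\xi)W(\eta)=e^{-\frac i2\operatorname{Im}\langle\xi,\eta\rangle}W(\xi+\eta)$. *Lattice.* Let $\mathfrak h_{N,L}=\ell^2(\Lambda_N)$, $\mathcal W_{N,L}=\mathcal W(\mathfrak h_{N,L})$ with Weyl operators $W_N(\xi)$. Write $\xi=\varepsilon_N^{(d+1)/2}q+i\varepsilon_N^{(d-1)/2}p$ with $q,p$ real-valued, and for a function $f$ on $\Lambda_N$ put $\hat f(k)=\varepsilon_N^{d/2}\sum_{x\in\Lambda_N}f(x)e^{-ik\cdot x}$, $k\in\Gamma_N$.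 Identify the pair $(q,p)$ with the complex function $q+ip$. The momentum-cutoff scaling map $R^N_{N+1}:\mathfrak h_{N,L}\to\mathfrak h_{N+1,L}$ sends $(q,p)$ to the pair $(q',p')$ of real functions on $\Lambda_{N+1}$ with $(q'+ip')^{\wedge}=2^{d/2}(q+ip)^{\wedge}$ on $\Gamma_N$ and $(q'+ip')^{\wedge}=0$ on $\Gamma_{N+1}\setminus\Gamma_N$. Let $m>0$ and $\mu_N>\sqrt{2d}$ with $\lim_{N\to\infty}\varepsilon_N^{-2}(\mu_N^2-2d)=m^2$, and let $$\gamma_{\mu_N}(k)^2=\varepsilon_N^{-2}(\mu_N^2-2d)+2\varepsilon_N^{-2}\sum_{j=1}^d(1-\cos(\varepsilon_Nk_j)),\qquad k\in\Gamma_N .$$ *Continuum.* Let $\gamma_m(k)=(k^2+m^2)^{1/2}$ and let $\mathfrak h_L$ be the completion of $C^\infty(\mathbb T_L^d,\mathbb C)$, $\mathbb T_L^d=[-L,L)^d$, with respect to the scalar product given, for $\xi=q_\xi+ip_\xi$, $\eta=q_\eta+ip_\eta$ and $\hat g(k)=\int_{[-L,L)^d}g(x)e^{-ik\cdot x}dx$,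 by $$\langle\xi,\eta\rangle_L=\frac1{(2L)^d}\sum_{k\in\frac\pi L\mathbb Z^d}\overline{\bigl(\gamma_m^{-1/2}\hat q_\xi+i\gamma_m^{1/2}\hat p_\xi\bigr)(k)}\,\bigl(\gamma_m^{-1/2}\hat q_\eta+i\gamma_m^{1/2}\hat p_\eta\bigr)(k),$$ with complex structure $q+ip\mapsto-\gamma_mp+i\gamma_m^{-1}q$. Let $\mathcal W_L=\mathcal W(\mathfrak h_L)$ with Weyl operators $W_{\mathrm{ct}}(\zeta)$. For $\xi\in\mathfrak h_{N,L}$ let $\iota^{(N)}_L(\xi)\in\mathfrak h_L$ be the trigonometric polynomial whose Fourier coefficients are $\varepsilon_N^{d/2}(q+ip)^{\wedge}(k)$ for $k\in\Gamma_N$ and $0$ for $k\in\frac\pi L\mathbb Z^d\setminus\Gamma_N$. **Theorem.** There are unital $*$-homomorphisms $\alpha^N_{N+1}:\mathcal W_{N,L}\to\mathcal W_{N+1,L}$ with $\alpha^N_{N+1}(W_N(\xi))=W_{N+1}(R^N_{N+1}\xi)$; let $\alpha^N_{N'}$ ($N\le N'$) be their compositions, and $\mathcal W_{\infty,L}$ the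 $C^*$-inductive limit, with canonical maps $\alpha^N_\infty$. There are states $\omega_{\mu_N}$ on $\mathcal W_{N,L}$ and $\omega_L$ on $\mathcal W_L$ with $$\omega_{\mu_N}(W_N(\xi))=\exp\Bigl(-\tfrac14(2r_N)^{-d}\sum_{k\in\Gamma_N}\bigl(\gamma_{\mu_N}(k)^{-1}|\hat q(k)|^2+\gamma_{\mu_N}(k)|\hat p(k)|^2\bigr)\Bigr),\qquad \omega_L(W_{\mathrm{ct}}(\zeta))=e^{-\frac14\|\zeta\|_L^2}.$$ For these: 1. For every $N$ the renormalized vacua $\omega^{(N)}_{L,M}=\omega_{\mu_{N+M}}\circ\alpha^N_{N+M}$ converge, as $M\to\infty$, in the weak* topology to a state $\omega^{(N)}_{L,\infty}$ on $\mathcal W_{N,L}$. These limits are projectively consistent, $\omega^{(N')}_{L,\infty}\circ\alpha^N_{N'}=\omega^{(N)}_{L,\infty}$ for $N\le N'$, and there is a state $\omega^{(\infty)}_{L,\infty}$ on $\mathcal W_{\infty,L}$, the scaling limit, with $\omega^{(\infty)}_{L,\infty}\circ\alpha^N_\infty=\omega^{(N)}_{L,\infty}$ for all $N$. 2. There is an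 injective unital $*$-homomorphism $\Phi_L:\mathcal W_{\infty,L}\to\mathcal W_L$ with $\Phi_L(\alpha^N_\infty(W_N(\xi)))=W_{\mathrm{ct}}(\iota^{(N)}_L(\xi))$ for all $N$ and $\xi\in\mathfrak h_{N,L}$. Its range is the $C^*$-subalgebra of $\mathcal W_L$ generated by the Weyl operators $W_{\mathrm{ct}}(\zeta)$ with $\zeta$ of finite support in momentum space, and $\omega^{(\infty)}_{L,\infty}=\omega_L\circ\Phi_L$. 3. There is a unitary $U$ from the GNS space of $(\mathcal W_{\infty,L},\omega^{(\infty)}_{L,\infty})$ onto the whole GNS space of $(\mathcal W_L,\omega_L)$ that maps the GNS vector to the GNS vector and satisfies $U\,\pi^{(\infty)}_{L,\infty}(a)=\pi_{\omega_L}(\Phi_L(a))\,U$ for all $a\in\mathcal W_{\infty,L}$. Thus the GNS representation of the scaling limit is unitarily equivalent to the free vacuum representation of mass $m$ restricted to the subalgebra generated by the Weyl operators with finite momentum support. -/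

import Mathlib

open Filter Topology MeasureTheory
open scoped ComplexConjugate ComplexOrder ENNReal

noncomputable section

namespace MomentumCutoff

/-! ## The Weyl algebra of a complex inner product space -/

section Weyl

variable (H : Type) [NormedAddCommGroup H] [InnerProductSpace ℂ H]

/-- The symplectic form `σ(ξ, η) = Im ⟪ξ, η⟫` (the inner product is linear in `η`). -/
def symp {H : Type} [NormedAddCommGroup H] [InnerProductSpace ℂ H] (ξ η : H) : ℝ :=
  (inner ℂ ξ η).im

/-- The Hilbert space `ℓ²(H)` over the discrete set `H`. -/
abbrev EllTwo (X : Type) : Type := lp (fun _ : X => ℂ) 2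

variable {H}

/-- The phase `e^{-i σ(ξ, η) / 2}`. -/
def phase (ξ η : H) : ℂ := Complex.exp (-(Complex.I / 2) * (symp ξ η : ℂ))

theorem norm_phase (ξ η : H) : ‖phase ξ η‖ = 1 := by
  have : -(Complex.I / 2) * (symp ξ η : ℂ) = ((-(symp ξ η / 2) : ℝ) : ℂ) * Complex.I := by
    push_cast; ring
  rw [phase, this, Complex.norm_exp_ofReal_mul_I]

theorem weylFun_memℓp (ξ : H) (f : EllTwo H) :
    Memℓp (fun η : H => phase ξ η * f (η - ξ)) 2 := by
  have h := (lp.memℓp f).summable (by norm_num)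
  refine memℓp_gen ?_
  have h' := (Equiv.subRight ξ).summable_iff.mpr h
  refine h'.congr fun η => ?_
  simp [norm_phase]

/-- The unitary `W(ξ)` on `ℓ²(H)`, `(W(ξ) f)(η) = e^{-i σ(ξ, η) / 2} f(η - ξ)`. -/
def weylOp (ξ : H) : EllTwo H →L[ℂ] EllTwo H :=
  LinearIsometry.toContinuousLinearMap
    { toFun := fun f => ⟨fun η => phase ξ η * f (η - ξ), weylFun_memℓp ξ f⟩
      map_add' := fun f g => by
        ext η
        exact mul_add (phase ξ η) (f (η - ξ)) (g (η - ξ))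
      map_smul' := fun c f => by
        ext η
        simp [mul_left_comm]
      norm_map' := fun f => by
        have hp : 0 < (2 : ℝ≥0∞).toReal := by norm_num
        rw [lp.norm_eq_tsum_rpow hp, lp.norm_eq_tsum_rpow hp]
        congr 1
        rw [← (Equiv.subRight ξ).tsum_eq (fun η => ‖f η‖ ^ (2 : ℝ≥0∞).toReal)]
        refine tsum_congr fun η => ?_
        simp [norm_phase] }

theorem weylOp_apply (ξ : H) (f : EllTwo H) (η : H) :
    weylOp ξ f η = phase ξ η * f (η - ξ) := rfl

variable (H)

/-- The C*-algebra of operators on `ℓ²(H)` generated by the unitaries `W(ξ)`, `ξ ∈ H`. -/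
def weylSubalgebra : StarSubalgebra ℂ (EllTwo H →L[ℂ] EllTwo H) :=
  (StarAlgebra.adjoin ℂ (Set.range (weylOp (H := H)))).topologicalClosure

theorem isClosed_weylSubalgebra :
    IsClosed (weylSubalgebra H : Set (EllTwo H →L[ℂ] EllTwo H)) :=
  StarSubalgebra.isClosed_topologicalClosure _

/-- The Weyl algebra `𝒲(H)`: the C*-algebra generated by the unitaries `W(ξ)`, `ξ ∈ H`. -/
def WeylAlgebra : Type := ↥(weylSubalgebra H)

instance : NormedRing (WeylAlgebra H) := inferInstanceAs (NormedRing ↥(weylSubalgebra H))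

instance : StarRing (WeylAlgebra H) := inferInstanceAs (StarRing ↥(weylSubalgebra H))

instance : NormedAlgebra ℂ (WeylAlgebra H) :=
  inferInstanceAs (NormedAlgebra ℂ ↥(weylSubalgebra H))

instance : StarModule ℂ (WeylAlgebra H) := inferInstanceAs (StarModule ℂ ↥(weylSubalgebra H))

instance : CStarRing (WeylAlgebra H) := inferInstanceAs (CStarRing ↥(weylSubalgebra H))

instance : CompleteSpace (WeylAlgebra H) :=
  (isClosed_weylSubalgebra H).completeSpace_coe

instance : CStarAlgebra (WeylAlgebra H) where

/-- The order of the C*-algebra `𝒲(H)`: `a ≤ b` iff `b - a` is selfadjoint with nonnegative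
spectrum. -/
instance : PartialOrder (WeylAlgebra H) := CStarAlgebra.spectralOrder _

instance : StarOrderedRing (WeylAlgebra H) := CStarAlgebra.spectralOrderedRing _

variable {H}

/-- The Weyl operators `W(ξ) ∈ 𝒲(H)`. -/
def weyl (ξ : H) : WeylAlgebra H :=
  ⟨weylOp ξ, StarSubalgebra.le_topologicalClosure _
    (StarAlgebra.subset_adjoin ℂ _ (Set.mem_range_self ξ))⟩

/-- The canonical commutation relations. -/
theorem weyl_mul (ξ η : H) :
    weyl ξ * weyl η = Complex.exp (-(Complex.I / 2) * (symp ξ η : ℂ)) • weyl (ξ + η) := by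
  refine Subtype.ext ?_
  change weylOp ξ * weylOp η = Complex.exp (-(Complex.I / 2) * (symp ξ η : ℂ)) • weylOp (ξ + η)
  ext f ζ
  change phase ξ ζ * (phase η (ζ - ξ) * f (ζ - ξ - η))
    = Complex.exp (-(Complex.I / 2) * (symp ξ η : ℂ)) * (phase (ξ + η) ζ * f (ζ - (ξ + η)))
  have hs : symp ξ ζ + symp η (ζ - ξ) = symp ξ η + symp (ξ + η) ζ := by
    have h2 : (inner ℂ η ξ).im = -(inner ℂ ξ η).im := by
      rw [← inner_conj_symm (𝕜 := ℂ) η ξ, Complex.conj_im]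
    simp only [symp, inner_sub_right, inner_add_left, Complex.sub_im, Complex.add_im, h2]
    ring
  rw [sub_sub, ← mul_assoc, ← mul_assoc, phase, phase, phase, ← Complex.exp_add,
    ← Complex.exp_add]
  congr 2
  rw [← mul_add, ← mul_add]
  exact_mod_cast congrArg (fun t : ℝ => -(Complex.I / 2) * (t : ℂ)) hs

theorem weyl_zero : weyl (0 : H) = 1 := by
  refine Subtype.ext ?_
  change weylOp (0 : H) = 1
  ext f ζ
  change phase 0 ζ * f (ζ - 0) = f ζ
  simp [phase, symp]

end Weyl

/-! ## States and the GNS triple -/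

section States

/-- A state: a positive linear functional `ω` with `ω(1) = 1`. -/
structure State (A : Type) [CStarAlgebra A] [PartialOrder A] [StarOrderedRing A] where
  toPos : A →ₚ[ℂ] ℂ
  map_one : toPos 1 = 1

variable {A : Type} [CStarAlgebra A] [PartialOrder A] [StarOrderedRing A]

instance : CoeFun (State A) (fun _ => A → ℂ) := ⟨fun ω => ω.toPos⟩

/-- The GNS Hilbert space. -/
abbrev State.Space (ω : State A) : Type := ω.toPos.GNS

/-- The GNS representation. -/
def State.rep (ω : State A) : A →⋆ₐ[ℂ] (ω.Space →L[ℂ] ω.Space) := ω.toPos.gnsStarAlgHom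

/-- The cyclic GNS vector. -/
def State.vac (ω : State A) : ω.Space :=
  ((ω.toPos.toPreGNS 1 : ω.toPos.PreGNS) : ω.toPos.GNS)

end States

/-! ## Inductive limits of sequences of C*-algebras -/

section InductiveLimit

variable {A : ℕ → Type} [∀ n, CStarAlgebra (A n)] (α : ∀ n, A n →⋆ₐ[ℂ] A (n + 1))

/-- The composed map `α^N_{N'} : A N → A N'` for `N ≤ N'`. -/
def transition {N N' : ℕ} (h : N ≤ N') : A N →⋆ₐ[ℂ] A N' :=
  Nat.leRecOn (C := fun k => A N →⋆ₐ[ℂ] A k) h (fun {k} φ => (α k).comp φ) (StarAlgHom.id ℂ (A N))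

theorem transition_succ {N N' : ℕ} (h : N ≤ N') (a : A N) :
    transition α (Nat.le_succ_of_le h) a = α N' (transition α h a) := by
  have : transition α (Nat.le_succ_of_le h) = (α N').comp (transition α h) :=
    Nat.leRecOn_succ (C := fun k => A N →⋆ₐ[ℂ] A k) h (StarAlgHom.id ℂ (A N))
  rw [this]; rfl

/-- The *-algebra of sequences `(a_n)` with `a_n ∈ A n` and `a_{n+1} = α_n(a_n)` for all large
`n`. -/
def coherentSubalgebra : StarSubalgebra ℂ (Π n, A n) where
  carrier := {a | ∀ᶠ n in atTop, a (n + 1) = α n (a n)}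
  mul_mem' := fun {a b} ha hb => by
    filter_upwards [ha, hb] with n h1 h2
    simp [h1, h2]
  add_mem' := fun {a b} ha hb => by
    filter_upwards [ha, hb] with n h1 h2
    simp [h1, h2]
  algebraMap_mem' := fun c => Eventually.of_forall fun n => by
    simp [Pi.algebraMap_apply, AlgHomClass.commutes]
  star_mem' := fun {a} ha => by
    filter_upwards [ha] with n h1
    simp [h1, map_star]

/-- Coherent sequences, as a type that does not carry the product topology. -/
def Coherent : Type := ↥(coherentSubalgebra α)

instance : Ring (Coherent α) := inferInstanceAs (Ring ↥(coherentSubalgebra α))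

instance : StarRing (Coherent α) := inferInstanceAs (StarRing ↥(coherentSubalgebra α))

instance : Algebra ℂ (Coherent α) := inferInstanceAs (Algebra ℂ ↥(coherentSubalgebra α))

instance : StarModule ℂ (Coherent α) := inferInstanceAs (StarModule ℂ ↥(coherentSubalgebra α))

variable {α} in
/-- The `n`-th entry of a coherent sequence. -/
def Coherent.entry (a : Coherent α) (n : ℕ) : A n := a.1 n

theorem coherent_tendsto (a : Coherent α) :
    ∃ l : ℝ, Tendsto (fun n => ‖a.entry n‖) atTop (𝓝 l) := by
  obtain ⟨n₀, hn₀⟩ := eventually_atTop.mp a.2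
  have hanti : Antitone (fun n => ‖a.entry (n + n₀)‖) := by
    refine antitone_nat_of_succ_le fun n => ?_
    have : a.entry (n + n₀ + 1) = α (n + n₀) (a.entry (n + n₀)) :=
      hn₀ (n + n₀) (Nat.le_add_left _ _)
    rw [show n + 1 + n₀ = n + n₀ + 1 by omega, this]
    exact NonUnitalStarAlgHom.norm_apply_le (α (n + n₀)) _
  have hbdd : BddBelow (Set.range (fun n => ‖a.entry (n + n₀)‖)) :=
    ⟨0, by rintro _ ⟨n, rfl⟩; exact norm_nonneg _⟩
  exact ⟨_, (tendsto_add_atTop_iff_nat n₀).mp (tendsto_atTop_ciInf hanti hbdd)⟩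

/-- The seminorm `lim_n ‖a_n‖` on coherent sequences. -/
def limNorm (a : Coherent α) : ℝ := (coherent_tendsto α a).choose

theorem limNorm_tendsto (a : Coherent α) :
    Tendsto (fun n => ‖a.entry n‖) atTop (𝓝 (limNorm α a)) :=
  (coherent_tendsto α a).choose_spec

instance : Norm (Coherent α) := ⟨limNorm α⟩


instance : SeminormedRing (Coherent α) :=
  { (inferInstance : Ring (Coherent α)),
    SeminormedAddCommGroup.ofCore (𝕜 := ℂ) (E := Coherent α)
      { norm_nonneg := fun a => ge_of_tendsto' (limNorm_tendsto α a) fun _ => norm_nonneg _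
        norm_smul := fun c a => by
          refine tendsto_nhds_unique (limNorm_tendsto α (c • a)) ?_
          refine ((limNorm_tendsto α a).const_mul ‖c‖).congr fun n => ?_
          exact (norm_smul c (a.entry n)).symm
        norm_triangle := fun a b =>
          le_of_tendsto_of_tendsto' (limNorm_tendsto α (a + b))
            ((limNorm_tendsto α a).add (limNorm_tendsto α b)) fun n =>
              norm_add_le (a.entry n) (b.entry n) } with
    norm_mul_le := fun a b =>
      le_of_tendsto_of_tendsto' (limNorm_tendsto α (a * b))
        ((limNorm_tendsto α a).mul (limNorm_tendsto α b)) fun n =>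
          norm_mul_le (a.entry n) (b.entry n) }

instance : NormedAlgebra ℂ (Coherent α) where
  norm_smul_le c a := by
    refine le_of_tendsto_of_tendsto' (limNorm_tendsto α (c • a))
      ((limNorm_tendsto α a).const_mul ‖c‖) fun n => ?_
    exact norm_smul_le c (a.entry n)

theorem coherent_norm_star (a : Coherent α) : ‖star a‖ = ‖a‖ :=
  tendsto_nhds_unique (limNorm_tendsto α (star a))
    ((limNorm_tendsto α a).congr fun n => (norm_star (a.entry n)).symm)

theorem coherent_norm_star_mul (a : Coherent α) : ‖a‖ * ‖a‖ = ‖star a * a‖ :=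
  tendsto_nhds_unique ((limNorm_tendsto α a).mul (limNorm_tendsto α a))
    ((limNorm_tendsto α (star a * a)).congr fun n =>
      CStarRing.norm_star_mul_self (x := a.entry n))

instance : NormedStarGroup (Coherent α) := ⟨fun a => (coherent_norm_star α a).le⟩

/-- The C*-inductive limit of `A 0 → A 1 → ⋯`: the (Hausdorff) completion of the *-algebra of
coherent sequences with respect to the C*-seminorm `lim_n ‖a_n‖`. -/
def IndLim : Type := UniformSpace.Completion (Coherent α)

namespace IndLim

instance : NormedRing (IndLim α) := inferInstanceAs (NormedRing (UniformSpace.Completion _))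

instance : CompleteSpace (IndLim α) :=
  inferInstanceAs (CompleteSpace (UniformSpace.Completion (Coherent α)))

instance : NormedAlgebra ℂ (IndLim α) :=
  { (inferInstanceAs (Algebra ℂ (UniformSpace.Completion (Coherent α))) :
      Algebra ℂ (IndLim α)) with
    norm_smul_le := fun c x =>
      norm_smul_le (α := ℂ) (β := UniformSpace.Completion (Coherent α)) c x }

/-- The class of a coherent sequence in the inductive limit. -/
def mk (a : Coherent α) : IndLim α := (a : UniformSpace.Completion (Coherent α))

variable {α}

theorem isometry_star_coherent : Isometry (star : Coherent α → Coherent α) :=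
  AddMonoidHomClass.isometry_of_norm (starAddEquiv : Coherent α ≃+ Coherent α)
    fun a => coherent_norm_star α a

theorem uniformContinuous_star_coherent :
    UniformContinuous (star : Coherent α → Coherent α) :=
  isometry_star_coherent.uniformContinuous

instance : Star (IndLim α) :=
  ⟨fun x => UniformSpace.Completion.map (star : Coherent α → Coherent α) x⟩

instance : ContinuousStar (IndLim α) :=
  ⟨UniformSpace.Completion.continuous_map⟩

theorem continuous_mk : Continuous (mk α) :=
  UniformSpace.Completion.continuous_coe (Coherent α)

theorem mk_star (a : Coherent α) : star (mk α a) = mk α (star a) :=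
  UniformSpace.Completion.map_coe uniformContinuous_star_coherent a

theorem mk_mul (a b : Coherent α) : mk α (a * b) = mk α a * mk α b :=
  UniformSpace.Completion.coe_mul a b

theorem mk_add (a b : Coherent α) : mk α (a + b) = mk α a + mk α b :=
  UniformSpace.Completion.coe_add a b

theorem mk_one : mk α 1 = 1 := rfl

theorem mk_zero : mk α 0 = 0 := rfl

theorem mk_smul (c : ℂ) (a : Coherent α) : mk α (c • a) = c • mk α a :=
  UniformSpace.Completion.coe_smul c a

theorem norm_mk (a : Coherent α) : ‖mk α a‖ = limNorm α a :=
  UniformSpace.Completion.norm_coe a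

theorem denseRange_mk : DenseRange (mk α) :=
  UniformSpace.Completion.denseRange_coe (α := Coherent α)

theorem ind {p : IndLim α → Prop} (x : IndLim α) (hp : IsClosed {x | p x})
    (h : ∀ a, p (mk α a)) : p x :=
  UniformSpace.Completion.induction_on (α := Coherent α) x hp h

theorem ind₂ {p : IndLim α → IndLim α → Prop} (x y : IndLim α)
    (hp : IsClosed {z : IndLim α × IndLim α | p z.1 z.2})
    (h : ∀ a b, p (mk α a) (mk α b)) : p x y :=
  UniformSpace.Completion.induction_on₂ (α := Coherent α) (β := Coherent α) x y hp h

instance : StarRing (IndLim α) where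
  star_involutive x := by
    refine ind (p := fun x => star (star x) = x) x
      (isClosed_eq (by fun_prop) (by fun_prop)) fun a => ?_
    rw [mk_star, mk_star, star_star]
  star_mul x y := by
    refine ind₂ (p := fun x y => star (x * y) = star y * star x) x y
      (isClosed_eq (by fun_prop) (by fun_prop)) fun a b => ?_
    rw [← mk_mul, mk_star, mk_star, mk_star, ← mk_mul, star_mul]
  star_add x y := by
    refine ind₂ (p := fun x y => star (x + y) = star x + star y) x y
      (isClosed_eq (by fun_prop) (by fun_prop)) fun a b => ?_
    rw [← mk_add, mk_star, mk_star, mk_star, ← mk_add, star_add]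

instance : StarModule ℂ (IndLim α) where
  star_smul c x := by
    have h1 : Continuous fun y : IndLim α => star (c • y) :=
      continuous_star.comp (uniformContinuous_const_smul c).continuous
    have h2 : Continuous fun y : IndLim α => star c • star y :=
      (uniformContinuous_const_smul (star c)).continuous.comp continuous_star
    refine ind (p := fun x => star (c • x) = star c • star x) x (isClosed_eq h1 h2) fun a => ?_
    rw [← mk_smul, mk_star, mk_star, ← mk_smul, star_smul]

instance : CStarRing (IndLim α) where
  norm_mul_self_le x := by
    refine ind (p := fun x => ‖x‖ * ‖x‖ ≤ ‖star x * x‖) x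
      (isClosed_le (by fun_prop) (by fun_prop)) fun a => ?_
    rw [mk_star, ← mk_mul, norm_mk, norm_mk]
    exact (coherent_norm_star_mul α a).le

instance : CStarAlgebra (IndLim α) where

/-- The order of the C*-algebra `IndLim α`. -/
instance : PartialOrder (IndLim α) := CStarAlgebra.spectralOrder _

instance : StarOrderedRing (IndLim α) := CStarAlgebra.spectralOrderedRing _

/-- The coherent sequence of `a ∈ A N`: zero before `N`, and `α^N_n(a)` from `N` on. -/
def seqOf (N : ℕ) (a : A N) : Coherent α :=
  ⟨fun n => if h : N ≤ n then transition α h a else 0, by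
    refine eventually_atTop.mpr ⟨N, fun n hn => ?_⟩
    simp only [hn, Nat.le_succ_of_le hn, dif_pos]
    exact transition_succ α hn a⟩

theorem entry_seqOf {N n : ℕ} (h : N ≤ n) (a : A N) :
    (seqOf (α := α) N a).entry n = transition α h a := dif_pos h

theorem mk_eq_of_eventually {a b : Coherent α} (h : ∀ᶠ n in atTop, a.entry n = b.entry n) :
    mk α a = mk α b := by
  have h0 : limNorm α (a + (-1 : ℂ) • b) = 0 := by
    refine tendsto_nhds_unique (limNorm_tendsto α _) (tendsto_const_nhds.congr' ?_)
    filter_upwards [h] with n hn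
    have : (a + (-1 : ℂ) • b).entry n = a.entry n + (-1 : ℂ) • b.entry n := rfl
    rw [this, hn]; simp
  rw [← norm_mk, norm_eq_zero, mk_add, mk_smul] at h0
  rw [← sub_eq_zero, sub_eq_add_neg]
  simpa using h0

/-- The canonical *-homomorphism `α^N_∞ : A N → IndLim α`. -/
def of (α : ∀ n, A n →⋆ₐ[ℂ] A (n + 1)) (N : ℕ) : A N →⋆ₐ[ℂ] IndLim α where
  toFun a := mk α (seqOf N a)
  map_one' := by
    rw [← mk_one]
    refine mk_eq_of_eventually (eventually_atTop.mpr ⟨N, fun n hn => ?_⟩)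
    rw [entry_seqOf hn, map_one]; rfl
  map_mul' a b := by
    rw [← mk_mul]
    refine mk_eq_of_eventually (eventually_atTop.mpr ⟨N, fun n hn => ?_⟩)
    have : (seqOf (α := α) N a * seqOf N b).entry n
      = (seqOf (α := α) N a).entry n * (seqOf (α := α) N b).entry n := rfl
    rw [this, entry_seqOf hn, entry_seqOf hn, entry_seqOf hn, map_mul]
  map_zero' := by
    rw [← mk_zero]
    refine mk_eq_of_eventually (eventually_atTop.mpr ⟨N, fun n hn => ?_⟩)
    rw [entry_seqOf hn, map_zero]; rfl
  map_add' a b := by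
    rw [← mk_add]
    refine mk_eq_of_eventually (eventually_atTop.mpr ⟨N, fun n hn => ?_⟩)
    have : (seqOf (α := α) N a + seqOf N b).entry n
      = (seqOf (α := α) N a).entry n + (seqOf (α := α) N b).entry n := rfl
    rw [this, entry_seqOf hn, entry_seqOf hn, entry_seqOf hn, map_add]
  commutes' c := by
    rw [Algebra.algebraMap_eq_smul_one, Algebra.algebraMap_eq_smul_one, ← mk_one, ← mk_smul]
    refine mk_eq_of_eventually (eventually_atTop.mpr ⟨N, fun n hn => ?_⟩)
    rw [entry_seqOf hn, map_smul, map_one]; rfl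
  map_star' a := by
    rw [mk_star]
    refine mk_eq_of_eventually (eventually_atTop.mpr ⟨N, fun n hn => ?_⟩)
    have : (star (seqOf (α := α) N a)).entry n = star ((seqOf (α := α) N a).entry n) := rfl
    rw [this, entry_seqOf hn, entry_seqOf hn, map_star]

end IndLim

end InductiveLimit

/-! ## Lattice scalar fields on the torus `[-L, L)^d`, `L = ε r` -/

section Lattice

/-- The lattice spacing `ε_N = 2^{-N} ε`. -/
def spacing (ε : ℝ) (N : ℕ) : ℝ := ε / 2 ^ N

/-- `r_N = 2^N r`. -/
def radius (r N : ℕ) : ℕ := 2 ^ N * r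

/-- The half side length `L = ε r = ε_N r_N`. -/
def halfSide (ε : ℝ) (r : ℕ) : ℝ := ε * r

/-- The index set `{-r_N, …, r_N - 1}^d`; the lattice is `Λ_N = ε_N • Idx` and the dual lattice is
`Γ_N = (π / L) • Idx`. -/
abbrev Idx (d r N : ℕ) : Type := Fin d → ↥(Finset.Ico (-(radius r N : ℤ)) (radius r N : ℤ))

/-- The inclusion of the index set in `ℤ^d`; it induces `Γ_N ⊂ Γ_{N+1} ⊂ (π / L) ℤ^d`. -/
def Idx.toInt {d r N : ℕ} (k : Idx d r N) : Fin d → ℤ := fun j => (k j : ℤ)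

/-- The momentum `(π / L) n`. -/
def momentum {d : ℕ} (L : ℝ) (n : Fin d → ℤ) : Fin d → ℝ := fun j => Real.pi / L * (n j : ℝ)

/-- The lattice point `ε_N x`. -/
def site {d r N : ℕ} (ε : ℝ) (x : Idx d r N) : Fin d → ℝ :=
  fun j => spacing ε N * (x.toInt j : ℝ)

/-- The plane wave `e^{i k · x}`. -/
def wave {d : ℕ} (k x : Fin d → ℝ) : ℂ := Complex.exp (Complex.I * ((∑ j, k j * x j : ℝ) : ℂ))

/-- The lattice one-particle space `𝔥_{N,L} = ℓ²(Λ_N)`. -/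
abbrev LatSpace (d r N : ℕ) : Type := EuclideanSpace ℂ (Idx d r N)

/-- The Weyl algebra `𝒲_{N,L} = 𝒲(𝔥_{N,L})`. -/
abbrev LatAlg (d r N : ℕ) : Type := WeylAlgebra (LatSpace d r N)

variable {d r N : ℕ}

/-- The real field `q` in `ξ = ε_N^{(d+1)/2} q + i ε_N^{(d-1)/2} p`. -/
def qField (ε : ℝ) (ξ : LatSpace d r N) (x : Idx d r N) : ℝ :=
  spacing ε N ^ (-(((d : ℝ) + 1) / 2)) * (ξ x).re

/-- The real field `p` in `ξ = ε_N^{(d+1)/2} q + i ε_N^{(d-1)/2} p`. -/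
def pField (ε : ℝ) (ξ : LatSpace d r N) (x : Idx d r N) : ℝ :=
  spacing ε N ^ (-(((d : ℝ) - 1) / 2)) * (ξ x).im

/-- The vector `ε_N^{(d+1)/2} Re f + i ε_N^{(d-1)/2} Im f`, whose pair of fields `(q, p)` is
`f = q + i p`. -/
def ofField (ε : ℝ) (f : Idx d r N → ℂ) : LatSpace d r N :=
  WithLp.toLp 2 fun x =>
    ((spacing ε N ^ (((d : ℝ) + 1) / 2) * (f x).re : ℝ) : ℂ)
      + Complex.I * ((spacing ε N ^ (((d : ℝ) - 1) / 2) * (f x).im : ℝ) : ℂ)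

/-- The normalized lattice Fourier transform `f̂(k) = ε_N^{d/2} ∑_{x ∈ Λ_N} f(x) e^{-i k·x}`,
`k ∈ Γ_N`. -/
def latFourier (ε : ℝ) (f : Idx d r N → ℂ) (k : Idx d r N) : ℂ :=
  ((spacing ε N ^ ((d : ℝ) / 2) : ℝ) : ℂ)
    * ∑ x, f x * wave (-momentum (halfSide ε r) k.toInt) (site ε x)

/-- The inverse of `latFourier`,
`f(x) = ε_N^{-d/2} (2 r_N)^{-d} ∑_{k ∈ Γ_N} f̂(k) e^{i k·x}`. -/
def latFourierInv (ε : ℝ) (g : Idx d r N → ℂ) (x : Idx d r N) : ℂ :=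
  ((spacing ε N ^ (-((d : ℝ) / 2)) : ℝ) : ℂ) * ((2 * (radius r N : ℂ)) ^ d)⁻¹
    * ∑ k, g k * wave (momentum (halfSide ε r) k.toInt) (site ε x)

/-- The transform `q̂ + i p̂` on `Γ_N` of the pair `(q, p)` of fields of `ξ`. -/
def hatField (ε : ℝ) (ξ : LatSpace d r N) : Idx d r N → ℂ :=
  latFourier ε fun x => (qField ε ξ x : ℂ) + Complex.I * (pField ε ξ x : ℂ)

/-- The momentum-cutoff scaling map `R^N_{N+1}`: multiply the transform on `Γ_N` by `2^{d/2}` and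
extend it by zero to `Γ_{N+1}`. -/
def momScale (ε : ℝ) (ξ : LatSpace d r N) : LatSpace d r (N + 1) :=
  ofField ε (latFourierInv ε fun k' : Idx d r (N + 1) =>
    (((2 : ℝ) ^ ((d : ℝ) / 2) : ℝ) : ℂ)
      * Function.extend (Idx.toInt (d := d) (r := r) (N := N)) (hatField ε ξ) 0 k'.toInt)

/-- The lattice dispersion relation
`γ_μ(k)² = ε_N^{-2} (μ² - 2d) + 2 ε_N^{-2} ∑_j (1 - cos(ε_N k_j))`. -/
def latDispersion (ε μ : ℝ) (k : Idx d r N) : ℝ :=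
  Real.sqrt ((spacing ε N ^ 2)⁻¹ * (μ ^ 2 - 2 * d)
    + 2 * (spacing ε N ^ 2)⁻¹
      * ∑ j, (1 - Real.cos (spacing ε N * momentum (halfSide ε r) k.toInt j)))

/-- The squared norm `(2 r_N)^{-d} ∑_{k ∈ Γ_N} |g(k)|²` on functions on `Γ_N`. -/
def dualNormSq (g : Idx d r N → ℂ) : ℝ := ((2 * (radius r N : ℝ)) ^ d)⁻¹ * ∑ k, ‖g k‖ ^ 2

/-- The value `exp(-¼ (‖γ_μ^{-1/2} q̂‖² + ‖γ_μ^{1/2} p̂‖²))` of the free lattice vacuum of parameter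
`μ` on `W(ξ)`. -/
def latVacuumValue (ε μ : ℝ) (ξ : LatSpace d r N) : ℝ :=
  Real.exp (-(1 / 4) *
    (dualNormSq (fun k => ((latDispersion ε μ k ^ (-(1 / 2) : ℝ) : ℝ) : ℂ)
        * latFourier ε (fun x => (qField ε ξ x : ℂ)) k)
      + dualNormSq (fun k => ((latDispersion ε μ k ^ (1 / 2 : ℝ) : ℝ) : ℂ)
        * latFourier ε (fun x => (pField ε ξ x : ℂ)) k)))

end Lattice

/-! ## The continuum free field of mass `m` on the torus `[-L, L)^d` -/

section Continuum

variable {d : ℕ}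

/-- Smooth functions on the torus, as smooth `2L`-periodic functions on `ℝ^d`. -/
structure IsSmoothOnTorus (L : ℝ) (f : (Fin d → ℝ) → ℂ) : Prop where
  smooth : ContDiff ℝ (⊤ : ℕ∞) f
  periodic : ∀ (x : Fin d → ℝ) (n : Fin d → ℤ), f (fun j => x j + 2 * L * (n j : ℝ)) = f x

/-- The Fourier coefficient `∫_{[-L, L)^d} g(x) e^{-i k·x} dx`. -/
def torusFourier (L : ℝ) (g : (Fin d → ℝ) → ℂ) (k : Fin d → ℝ) : ℂ :=
  ∫ x in Set.pi Set.univ (fun _ : Fin d => Set.Ico (-L) L), g x * wave (-k) x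

/-- The continuum dispersion relation `γ_m(k) = (k² + m²)^{1/2}`. -/
def dispersion (m : ℝ) (k : Fin d → ℝ) : ℝ := Real.sqrt ((∑ j, k j ^ 2) + m ^ 2)

/-- For `f = q + i p`, the family
`(2L)^{-d/2} (γ_m(k)^{-1/2} q̂(k) + i γ_m(k)^{1/2} p̂(k))`, `k = (π / L) n`; the scalar product of
`𝔥_L` is the `ℓ²` scalar product of these families. -/
def oneParticleCoeff (L m : ℝ) (f : (Fin d → ℝ) → ℂ) (n : Fin d → ℤ) : ℂ :=
  (((2 * L) ^ (-((d : ℝ) / 2)) : ℝ) : ℂ) *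
    (((dispersion m (momentum L n) ^ (-(1 / 2) : ℝ) : ℝ) : ℂ)
        * torusFourier L (fun x => ((f x).re : ℂ)) (momentum L n)
      + Complex.I * ((dispersion m (momentum L n) ^ (1 / 2 : ℝ) : ℝ) : ℂ)
        * torusFourier L (fun x => ((f x).im : ℂ)) (momentum L n))

/-- The completion of the smooth functions on the torus with respect to the one-particle scalar
product of mass `m`, realized as a closed complex subspace of `ℓ²(ℤ^d)` through
`oneParticleCoeff`. (The image of the smooth functions is stable under multiplication by `i`, which
acts by `q + i p ↦ -γ_m p + i γ_m^{-1} q`.) -/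
def contSubmodule (d : ℕ) (L m : ℝ) : Submodule ℂ (EllTwo (Fin d → ℤ)) :=
  (Submodule.span ℂ {ψ : EllTwo (Fin d → ℤ) |
    ∃ f : (Fin d → ℝ) → ℂ, IsSmoothOnTorus L f ∧ ∀ n, ψ n = oneParticleCoeff L m f n}
    ).topologicalClosure

/-- The continuum one-particle Hilbert space `𝔥_L`. -/
def ContSpace (d : ℕ) (L m : ℝ) : Type := ↥(contSubmodule d L m)

instance (d : ℕ) (L m : ℝ) : NormedAddCommGroup (ContSpace d L m) :=
  inferInstanceAs (NormedAddCommGroup ↥(contSubmodule d L m))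

instance (d : ℕ) (L m : ℝ) : InnerProductSpace ℂ (ContSpace d L m) :=
  inferInstanceAs (InnerProductSpace ℂ ↥(contSubmodule d L m))

/-- The family of coefficients of `ζ ∈ 𝔥_L`, that is `oneParticleCoeff` extended to the
completion. -/
def ContSpace.coeff {L m : ℝ} (ζ : ContSpace d L m) (n : Fin d → ℤ) : ℂ := ζ.1 n

/-- The continuum Weyl algebra `𝒲_L = 𝒲(𝔥_L)`. -/
abbrev ContAlg (d : ℕ) (L m : ℝ) : Type := WeylAlgebra (ContSpace d L m)

/-- `ζ ∈ 𝔥_L` is the class of the function `f` on the torus. -/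
def IsClassOf {L m : ℝ} (ζ : ContSpace d L m) (f : (Fin d → ℝ) → ℂ) : Prop :=
  ∀ n, ζ.coeff n = oneParticleCoeff L m f n

/-- The C*-subalgebra of `𝒲_L` generated by the Weyl operators `W(ζ)` with finite support in
momentum space. -/
def finiteMomentumAlg (d : ℕ) (L m : ℝ) : StarSubalgebra ℂ (ContAlg d L m) :=
  (StarAlgebra.adjoin ℂ {a : ContAlg d L m | ∃ ζ : ContSpace d L m,
    (Function.support ζ.coeff).Finite ∧ a = weyl ζ}).topologicalClosure

/-- The trigonometric polynomial `ι_L^{(N)}(ξ) = Q + i P` on the torus whose Fourier coefficients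
are `ε_N^{d/2} (q̂ + i p̂)(k)` for `k ∈ Γ_N` and `0` for the other `k ∈ (π / L) ℤ^d`. -/
def toTorus {r N : ℕ} (ε : ℝ) (ξ : LatSpace d r N) (y : Fin d → ℝ) : ℂ :=
  (((2 * halfSide ε r) ^ d : ℝ) : ℂ)⁻¹ *
    ∑ k : Idx d r N, ((spacing ε N ^ ((d : ℝ) / 2) : ℝ) : ℂ) * hatField ε ξ k
      * wave (momentum (halfSide ε r) k.toInt) y

end Continuum

end MomentumCutoff

end

open Filter Topology MeasureTheory
open scoped ComplexConjugate ComplexOrder ENNReal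

noncomputable section

namespace MomentumCutoff

/-! ## Amplification of operators on `ℓ²` -/

section Amplification

/-! In momentum space every map is diagonal up to the pairing of k with -k. In the normalization of
`modeCoeff` the symplectic form of each lattice is the sum of Im(conj F · G) over Γ_N, and the
factor 2^{d/2} of the scaling map cancels the change of (2 r_N)^{-d/2}. Scaling therefore just
regards a function on Γ_N as one on Γ_{N+1} (`modeCoeff_momScale`). A vacuum with dispersion γ is
the Fock state W(ξ) ↦ e^{-‖ξ‖²/4} pulled back by the Bogoliubov map q + ip ↦ γ^{-1/2} q + i γ^{1/2}
p, which is symplectic because its two weights are reciprocal (`sum_im_conj_bog`).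

A field of level N carried to level N + M keeps its finitely many modes, so its vacuum value depends
only on γ_{μ_{N+M}} at these modes. There γ_{μ_{N+M}} → γ_m pointwise (`tendsto_latDispersionAt`),
and the limit is the value of ω_L on the embedded field. Contractivity of states and density of the
span of Weyl operators extend this to all of 𝒲_{N,L} (`tendsto_latVacuum_transition`).

Two facts about Weyl algebras are needed. A symplectic additive map induces an injective, hence
isometric, *-homomorphism, because ℓ²(K) splits over the cosets of the image into twisted copies of
ℓ²(H) (`weylAmp_weylOp`). The Fock functional is positive by the Schur product theorem, and it is
bounded for the norm of B(ℓ²(H)) because abelian groups have polynomial growth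
(`norm_le_norm_weylSum`).

The embeddings of the 𝒲_{N,L} in 𝒲_L are compatible and isometric, so they define Φ on the inductive
limit. Since the Bogoliubov map is invertible on finitely supported families, Φ reaches every Weyl
operator of finite momentum support (`range_limMap`). Such vectors are dense in 𝔥_L and ζ ↦ W(ζ)Ω is
norm continuous, so the orbit of Ω under the range of Φ is dense, and the isometry of GNS spaces is
onto (`dense_vec_limMap`). -/

theorem EllTwo.hasSum_norm_sq {X : Type} (f : EllTwo X) :
    HasSum (fun x => ‖f x‖ ^ 2) (‖f‖ ^ 2) := by
  have h := lp.hasSum_norm (p := 2) (by norm_num) f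
  simpa using h

theorem EllTwo.memℓp_of_summable {X : Type} {f : X → ℂ} (h : Summable fun x => ‖f x‖ ^ 2) :
    Memℓp f 2 := by
  refine memℓp_gen ?_
  simpa using h

variable {X Y I : Type} (e : Y ≃ I × X) (u : I → X → ℂ)

theorem summable_slice (hu : ∀ i x, ‖u i x‖ = 1) (i : I) (g : EllTwo Y) :
    Summable fun x => ‖conj (u i x) * g (e.symm (i, x))‖ ^ 2 := by
  have h := (EllTwo.hasSum_norm_sq g).summable
  have h' := h.comp_injective (i := fun x => e.symm (i, x)) fun x y hxy => by simpa using hxy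
  refine h'.congr fun x => ?_
  simp [hu]

variable (hu : ∀ i x, ‖u i x‖ = 1)

/-- The component `x ↦ \bar u(i, x) g(i, x)` of `g ∈ ℓ²(I × X)`. -/
def slice (i : I) : EllTwo Y →ₗ[ℂ] EllTwo X where
  toFun g := ⟨fun x => conj (u i x) * g (e.symm (i, x)),
    EllTwo.memℓp_of_summable (summable_slice e u hu i g)⟩
  map_add' f g := by
    ext x
    exact mul_add (conj (u i x)) (f (e.symm (i, x))) (g (e.symm (i, x)))
  map_smul' c f := by
    ext x
    simp [mul_left_comm]

theorem slice_apply (i : I) (g : EllTwo Y) (x : X) :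
    slice e u hu i g x = conj (u i x) * g (e.symm (i, x)) := rfl

theorem hasSum_norm_slice (g : EllTwo Y) :
    HasSum (fun i => ‖slice e u hu i g‖ ^ 2) (‖g‖ ^ 2) := by
  have h := EllTwo.hasSum_norm_sq g
  rw [← e.symm.hasSum_iff] at h
  refine h.prod_fiberwise fun i => ?_
  refine (EllTwo.hasSum_norm_sq (slice e u hu i g)).congr_fun fun x => ?_
  simp [slice_apply, hu]

theorem hasSum_inner_slice (g h : EllTwo Y) :
    HasSum (fun i => inner ℂ (slice e u hu i g) (slice e u hu i h)) (inner ℂ g h) := by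
  have H := lp.hasSum_inner (𝕜 := ℂ) g h
  rw [← e.symm.hasSum_iff] at H
  refine H.prod_fiberwise fun i => ?_
  refine (lp.hasSum_inner (𝕜 := ℂ) (slice e u hu i g) (slice e u hu i h)).congr_fun fun x => ?_
  have h1 : u i x * conj (u i x) = 1 := by
    rw [Complex.mul_conj, Complex.normSq_eq_norm_sq, hu]; simp
  simp only [slice_apply, RCLike.inner_apply, map_mul, Complex.conj_conj, Function.comp]
  linear_combination (-(h (e.symm (i, x)) * conj (g (e.symm (i, x))))) * h1

theorem slice_ext {g h : EllTwo Y} (H : ∀ i, slice e u hu i g = slice e u hu i h) : g = h := by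
  have h0 : ‖g - h‖ ^ 2 = 0 := (hasSum_norm_slice e u hu (g - h)).unique (by simp [H])
  rw [← sub_eq_zero, ← norm_eq_zero]
  simpa using h0

/-- Together with `hasSum_norm_slice` and `slice_ext`, this identifies ℓ²(Y) with the Hilbert sum of
copies of ℓ²(X) indexed by I. -/
theorem exists_slice_eq (A : I → EllTwo X) (hA : Summable fun i => ‖A i‖ ^ 2) :
    ∃ g : EllTwo Y, ∀ i, slice e u hu i g = A i := by
  have hs : Summable fun y => ‖u (e y).1 (e y).2 * A (e y).1 (e y).2‖ ^ 2 := by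
    rw [← e.symm.summable_iff]
    refine (summable_prod_of_nonneg fun _ => by
      simp only [Pi.zero_apply, Function.comp]; positivity).mpr ⟨fun i => ?_, ?_⟩
    · simpa [hu] using (EllTwo.hasSum_norm_sq (A i)).summable
    · simpa [hu, (EllTwo.hasSum_norm_sq _).tsum_eq] using hA
  refine ⟨⟨_, EllTwo.memℓp_of_summable hs⟩, fun i => ?_⟩
  ext x
  have h1 : conj (u i x) * u i x = 1 := by
    rw [mul_comm, Complex.mul_conj, Complex.normSq_eq_norm_sq, hu]; simp
  rw [slice_apply]
  change conj (u i x) * (u (e (e.symm (i, x))).1 (e (e.symm (i, x))).2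
    * A (e (e.symm (i, x))).1 (e (e.symm (i, x))).2) = _
  rw [Equiv.apply_symm_apply, ← mul_assoc, h1, one_mul]

theorem summable_norm_apply_slice (A : EllTwo X →L[ℂ] EllTwo X) (g : EllTwo Y) :
    Summable fun i => ‖A (slice e u hu i g)‖ ^ 2 := by
  refine Summable.of_nonneg_of_le (fun _ => by positivity) (fun i => ?_)
    ((hasSum_norm_slice e u hu g).summable.mul_left (‖A‖ ^ 2))
  rw [← mul_pow]
  exact pow_le_pow_left₀ (norm_nonneg _) (A.le_opNorm _) 2

theorem exists_amp (A : EllTwo X →L[ℂ] EllTwo X) :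
    ∃ B : EllTwo Y →L[ℂ] EllTwo Y, ∀ g i, slice e u hu i (B g) = A (slice e u hu i g) := by
  choose B hB using fun g => exists_slice_eq e u hu (fun i => A (slice e u hu i g))
    (summable_norm_apply_slice e u hu A g)
  let L : EllTwo Y →ₗ[ℂ] EllTwo Y :=
    { toFun := B
      map_add' := fun f g => slice_ext e u hu fun i => by simp [hB]
      map_smul' := fun c f => slice_ext e u hu fun i => by simp [hB] }
  refine ⟨L.mkContinuous ‖A‖ fun g => ?_, fun g i => hB g i⟩
  refine le_of_sq_le_sq ?_ (by positivity)
  rw [mul_pow]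
  refine hasSum_le (fun i => ?_) (hasSum_norm_slice e u hu (L g))
    ((hasSum_norm_slice e u hu g).mul_left (‖A‖ ^ 2))
  rw [← mul_pow, show slice e u hu i (L g) = _ from hB g i]
  exact pow_le_pow_left₀ (norm_nonneg _) (A.le_opNorm _) 2

/-- The operator `B` on `ℓ²(I × X)` that acts as `A` on every component. -/
def ampOp (A : EllTwo X →L[ℂ] EllTwo X) : EllTwo Y →L[ℂ] EllTwo Y :=
  (exists_amp e u hu A).choose

theorem slice_ampOp (A : EllTwo X →L[ℂ] EllTwo X) (g : EllTwo Y) (i : I) :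
    slice e u hu i (ampOp e u hu A g) = A (slice e u hu i g) :=
  (exists_amp e u hu A).choose_spec g i

theorem eq_ampOp {A : EllTwo X →L[ℂ] EllTwo X} {B : EllTwo Y →L[ℂ] EllTwo Y}
    (h : ∀ g i, slice e u hu i (B g) = A (slice e u hu i g)) : ampOp e u hu A = B := by
  refine ContinuousLinearMap.ext fun g => slice_ext e u hu fun i => ?_
  rw [h, slice_ampOp]

/-- The *-homomorphism `A ↦ 1 ⊗ A`. -/
def amp : (EllTwo X →L[ℂ] EllTwo X) →⋆ₐ[ℂ] (EllTwo Y →L[ℂ] EllTwo Y) where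
  toFun := ampOp e u hu
  map_one' := eq_ampOp e u hu fun g i => rfl
  map_mul' A B := eq_ampOp e u hu fun g i => by simp [slice_ampOp]
  map_zero' := eq_ampOp e u hu fun g i => by simp
  map_add' A B := eq_ampOp e u hu fun g i => by simp [slice_ampOp]
  commutes' c := eq_ampOp e u hu fun g i => by simp [Algebra.algebraMap_eq_smul_one]
  map_star' A := by
    refine (ContinuousLinearMap.eq_adjoint_iff _ _).mpr fun f g => ?_
    refine (hasSum_inner_slice e u hu _ _).unique ?_
    refine (hasSum_inner_slice e u hu _ _).congr_fun fun i => ?_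
    rw [slice_ampOp, slice_ampOp, ContinuousLinearMap.star_eq_adjoint,
      ContinuousLinearMap.adjoint_inner_left]

/-- A single slice already recovers A: place f in one slice and zero in all others. -/
theorem amp_injective [Nonempty I] : Function.Injective (amp e u hu) := by
  classical
  refine (injective_iff_map_eq_zero (amp e u hu)).mpr fun A hA => ?_
  obtain ⟨i⟩ := ‹Nonempty I›
  ext1 f
  obtain ⟨g, hg⟩ := exists_slice_eq e u hu (fun j => if j = i then f else 0)
    (summable_of_hasFiniteSupport ((Set.finite_singleton i).subset fun j hj => by
      by_contra h
      exact hj (by simp [show j ≠ i from h])))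
  have h := slice_ampOp e u hu A g i
  rw [hg, if_pos rfl, show ampOp e u hu A = 0 from hA] at h
  simpa using h.symm

end Amplification

/-! ## Symplectic maps induce injective homomorphisms of the Weyl algebras -/

section WeylMap

variable {H K : Type} [NormedAddCommGroup H] [InnerProductSpace ℂ H] [NormedAddCommGroup K]
  [InnerProductSpace ℂ K]

theorem symp_add_left (ξ η ζ : H) : symp (ξ + η) ζ = symp ξ ζ + symp η ζ := by
  simp [symp]

theorem symp_add_right (ξ η ζ : H) : symp ξ (η + ζ) = symp ξ η + symp ξ ζ := by
  simp [symp]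

theorem symp_swap (ξ η : H) : symp ξ η = -symp η ξ := by
  rw [symp, symp, ← inner_conj_symm (𝕜 := ℂ) ξ η, Complex.conj_im]

theorem symp_self (ξ : H) : symp ξ ξ = 0 := by
  linarith [symp_swap ξ ξ]

/-- Testing against iξ gives ‖ξ‖². -/
theorem eq_zero_of_symp_eq_zero {ξ : H} (h : ∀ η, symp ξ η = 0) : ξ = 0 := by
  have := h (Complex.I • ξ)
  rw [symp, inner_smul_right, inner_self_eq_norm_sq_to_K] at this
  have h2 : (Complex.I * ((‖ξ‖ : ℝ) : ℂ) ^ 2).im = ‖ξ‖ ^ 2 := by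
    rw [← Complex.ofReal_pow, Complex.I_mul_im, Complex.ofReal_re]
  rw [← norm_eq_zero]
  exact pow_eq_zero_iff two_ne_zero |>.mp (h2.symm.trans this)

theorem phase_add_right (ξ η ζ : H) : phase ξ (η + ζ) = phase ξ η * phase ξ ζ := by
  rw [phase, phase, phase, ← Complex.exp_add, symp_add_right]
  push_cast; ring_nf

theorem phase_self (ξ : H) : phase ξ ξ = 1 := by
  simp [phase, symp_self]

theorem conj_phase (ξ η : H) : conj (phase ξ η) = phase η ξ := by
  rw [phase, phase, ← Complex.exp_conj, symp_swap ξ η]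
  congr 1
  simp only [map_mul, map_neg, map_div₀, Complex.conj_I, Complex.conj_ofReal, map_ofNat]
  push_cast
  ring

theorem phase_mul_phase_swap (ξ η : H) : phase ξ η * phase η ξ = 1 := by
  rw [← conj_phase ξ η, Complex.mul_conj, Complex.normSq_eq_norm_sq, norm_phase]; simp

variable (T : H →+ K)

/-- Nondegeneracy of the form suffices. No complex linearity of T is available, since Bogoliubov
maps mix F with its conjugate. -/
theorem symplectic_injective (hT : ∀ ξ η, symp (T ξ) (T η) = symp ξ η) : Function.Injective T := by
  refine (injective_iff_map_eq_zero T).mpr fun ξ hξ => eq_zero_of_symp_eq_zero fun η => ?_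
  rw [← hT, hξ]
  simp [symp]

theorem coset_bijective (hT : ∀ ξ η, symp (T ξ) (T η) = symp ξ η) :
    Function.Bijective fun p : (K ⧸ T.range) × H => p.1.out + T p.2 := by
  constructor
  · rintro ⟨κ, η⟩ ⟨κ', η'⟩ h
    have h1 : κ = κ' := by
      have := congrArg (QuotientAddGroup.mk (s := T.range)) h
      simpa using! this
    subst h1
    exact Prod.ext rfl (symplectic_injective T hT (add_left_cancel h))
  · intro ζ
    obtain ⟨⟨_, η, rfl⟩, h⟩ := QuotientAddGroup.mk_out_eq_add T.range ζ
    -- The representative chosen for the coset of ζ is ζ + T η, which explains the sign.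
    exact ⟨⟨ζ, -η⟩, by simp [h]⟩

variable (hT : ∀ ξ η, symp (T ξ) (T η) = symp ξ η)

/-- The decomposition of `K` into the cosets of `T(H)`. -/
def cosetEquiv : K ≃ (K ⧸ T.range) × H :=
  (Equiv.ofBijective _ (coset_bijective T hT)).symm

theorem cosetEquiv_symm (κ : K ⧸ T.range) (η : H) :
    (cosetEquiv T hT).symm (κ, η) = κ.out + T η := rfl

/-- The *-homomorphism of `B(ℓ²(H))` to `B(ℓ²(K))` that maps `W(ξ)` to `W(T ξ)`. -/
def weylAmp : (EllTwo H →L[ℂ] EllTwo H) →⋆ₐ[ℂ] (EllTwo K →L[ℂ] EllTwo K) :=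
  amp (cosetEquiv T hT) (fun κ η => phase (T η) κ.out) fun _ _ => norm_phase _ _

/-- At the point κ.out + T η the phase of W(T ξ) is that of W(ξ) at η times a factor depending on κ.
The twist phase(T η, κ.out) of the slices is chosen to cancel this factor, so W(T ξ) acts as W(ξ) on
every coset. -/
theorem weylAmp_weylOp (ξ : H) : weylAmp T hT (weylOp ξ) = weylOp (T ξ) := by
  refine eq_ampOp _ _ _ fun g κ => ?_
  ext η
  have hp : phase (T ξ) (T η) = phase ξ η := by rw [phase, phase, hT]
  rw [slice_apply, weylOp_apply, weylOp_apply, slice_apply, cosetEquiv_symm, cosetEquiv_symm,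
    show κ.out + T η - T ξ = κ.out + T (η - ξ) by rw [map_sub]; abel, conj_phase, conj_phase,
    phase_add_right, hp]
  have h1 : phase κ.out (T η) = phase κ.out (T (η - ξ)) * phase κ.out (T ξ) := by
    rw [← phase_add_right, ← map_add, sub_add_cancel]
  have h2 := phase_mul_phase_swap κ.out (T ξ)
  rw [h1]
  linear_combination (phase κ.out (T (η - ξ)) * phase ξ η * g (κ.out + T (η - ξ))) * h2

theorem weylAmp_mem {a : EllTwo H →L[ℂ] EllTwo H} (ha : a ∈ weylSubalgebra H) :
    weylAmp T hT a ∈ weylSubalgebra K := by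
  have hc : Continuous (weylAmp T hT) := map_continuous (weylAmp T hT)
  have h1 : weylSubalgebra H ≤ (weylSubalgebra K).comap (weylAmp T hT) := by
    refine StarSubalgebra.topologicalClosure_minimal ?_
      ((isClosed_weylSubalgebra K).preimage hc)
    refine StarAlgebra.adjoin_le ?_
    rintro _ ⟨ξ, rfl⟩
    change weylAmp T hT (weylOp ξ) ∈ weylSubalgebra K
    rw [weylAmp_weylOp]
    exact (weyl (T ξ)).2
  exact h1 ha

/-- The *-homomorphism `𝒲(H) → 𝒲(K)` with `W(ξ) ↦ W(T ξ)` of a symplectic map `T`. -/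
def weylMap : WeylAlgebra H →⋆ₐ[ℂ] WeylAlgebra K where
  toFun a := ⟨weylAmp T hT a.1, weylAmp_mem T hT a.2⟩
  map_one' := Subtype.ext (map_one (weylAmp T hT))
  map_mul' a b := Subtype.ext (map_mul (weylAmp T hT) a.1 b.1)
  map_zero' := Subtype.ext (map_zero (weylAmp T hT))
  map_add' a b := Subtype.ext (map_add (weylAmp T hT) a.1 b.1)
  commutes' c := Subtype.ext ((weylAmp T hT).commutes c)
  map_star' a := Subtype.ext (map_star (weylAmp T hT) a.1)

theorem weylMap_weyl (ξ : H) : weylMap T hT (weyl ξ) = weyl (T ξ) :=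
  Subtype.ext (weylAmp_weylOp T hT ξ)

theorem weylMap_injective : Function.Injective (weylMap T hT) := fun a b h => by
  have : Nonempty (K ⧸ T.range) := ⟨0⟩
  exact Subtype.ext (amp_injective _ _ _ (congrArg Subtype.val h))

theorem norm_weylMap (a : WeylAlgebra H) : ‖weylMap T hT a‖ = ‖a‖ :=
  NonUnitalStarAlgHom.norm_map (weylMap T hT) (weylMap_injective T hT) a

end WeylMap

/-! ## Growth of sum sets in abelian groups -/

section Growth

variable {G : Type} [AddCommGroup G] [DecidableEq G]

/-- The set `{∑_{s ∈ S} a(s) s | 0 ≤ a(s) ≤ n}`. -/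
def box (S : Finset G) (n : ℕ) : Finset G :=
  (Fintype.piFinset fun _ : ↥S => Finset.range (n + 1)).image fun a => ∑ s : ↥S, a s • (s : G)

/-- For fixed S the bound is polynomial in n; this is where commutativity of the group enters. -/
theorem card_box_le (S : Finset G) (n : ℕ) :
    (box S n).card ≤ (n + 1) ^ S.card := by
  refine Finset.card_image_le.trans ?_
  rw [Fintype.card_piFinset]
  simp

theorem add_mem_box {S : Finset G} {n : ℕ} {ξ s : G} (hξ : ξ ∈ box S n)
    (hs : s ∈ S) : ξ + s ∈ box S (n + 1) := by
  obtain ⟨a, ha, rfl⟩ := Finset.mem_image.mp hξ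
  refine Finset.mem_image.mpr ⟨a + Pi.single ⟨s, hs⟩ 1, ?_, ?_⟩
  · rw [Fintype.mem_piFinset] at ha ⊢
    intro t
    have h1 := Finset.mem_range.mp (ha t)
    have h2 : (Pi.single ⟨s, hs⟩ 1 : S → ℕ) t ≤ 1 := by
      by_cases h : t = ⟨s, hs⟩
      · subst h; simp
      · simp [Pi.single_eq_of_ne h]
    simp only [Pi.add_apply, Finset.mem_range]
    omega
  · simp only [Pi.add_apply, add_smul, Finset.sum_add_distrib]
    congr 1
    rw [Finset.sum_eq_single ⟨s, hs⟩ (fun t _ h => by simp [Pi.single_eq_of_ne h])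
      (fun h => absurd (Finset.mem_univ _) h)]
    simp

theorem zero_mem_box (S : Finset G) (n : ℕ) : (0 : G) ∈ box S n :=
  Finset.mem_image.mpr ⟨0, Fintype.mem_piFinset.mpr fun _ => by simp, by simp⟩

/-- A polynomial factor disappears on taking 2^k-th roots: if t > y, then (t / y)^{2^k} would
outgrow it. -/
theorem le_of_pow_le_mul_pow {t y : ℝ} (hy : 0 ≤ y) {p : ℕ}
    (h : ∀ k : ℕ, t ^ 2 ^ k ≤ (((2 ^ k : ℕ) : ℝ) + 1) ^ p * y ^ 2 ^ k) : t ≤ y := by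
  by_contra! hlt
  have htpos : 0 < t := hy.trans_lt hlt
  rcases hy.eq_or_lt with rfl | hy
  · have h0 := h 0
    simp only [pow_zero, pow_one, mul_zero] at h0
    exact absurd h0 htpos.not_ge
  have hr : 1 < t / y := (one_lt_div hy).mpr hlt
  -- The sequence n^p / ρ^n is evaluated at n = 2^k + 1, so one extra factor ρ = t / y appears; the
  -- threshold ρ⁻¹ below removes it.
  have h1 : Tendsto (fun k : ℕ => ((2 ^ k + 1 : ℕ) : ℝ) ^ p / (t / y) ^ (2 ^ k + 1)) atTop (𝓝 0) :=
    (tendsto_pow_const_div_const_pow_of_one_lt p hr).comp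
      ((tendsto_add_atTop_nat 1).comp (tendsto_pow_atTop_atTop_of_one_lt one_lt_two))
  obtain ⟨k, hk⟩ := (h1.eventually_lt_const (u := (t / y)⁻¹) (by positivity)).exists
  have h2 : ((2 ^ k + 1 : ℕ) : ℝ) ^ p < (t / y) ^ 2 ^ k := by
    rw [div_lt_iff₀ (by positivity), pow_succ' (t / y), ← mul_assoc,
      inv_mul_cancel₀ (by positivity), one_mul] at hk
    exact hk
  rw [div_pow, lt_div_iff₀ (by positivity)] at h2
  refine absurd (h k) (not_le.mpr ?_)
  exact_mod_cast h2

end Growth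

/-! ## The linear span of the Weyl operators -/

section WeylSpan

variable {H : Type} [NormedAddCommGroup H] [InnerProductSpace ℂ H]

theorem star_weyl (ξ : H) : star (weyl ξ) = weyl (-ξ) := by
  refine Subtype.ext (Eq.symm ?_)
  change weylOp (-ξ) = ContinuousLinearMap.adjoint (weylOp ξ)
  refine (ContinuousLinearMap.eq_adjoint_iff _ _).mpr fun f g => ?_
  have h1 := lp.hasSum_inner (𝕜 := ℂ) (weylOp (-ξ) f) g
  have h2 := lp.hasSum_inner (𝕜 := ℂ) f (weylOp ξ g)
  rw [← (Equiv.subRight ξ).hasSum_iff] at h1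
  refine h1.unique (h2.congr_fun fun η => ?_)
  have hp : conj (phase (-ξ) (η - ξ)) = phase ξ η := by
    have hs : symp (η + -ξ) (-ξ) = symp ξ η := by
      rw [symp_add_left, symp_self, symp_swap ξ η]
      simp [symp]
    rw [conj_phase, sub_eq_add_neg, phase, phase, hs]
  simp only [Function.comp, Equiv.subRight_apply, weylOp_apply, RCLike.inner_apply, map_mul, hp,
    sub_neg_eq_add, sub_add_cancel]
  ring

/-- The linear map `∑ c(ξ) ξ ↦ ∑ c(ξ) W(ξ)`. -/
def weylSum : (H →₀ ℂ) →ₗ[ℂ] WeylAlgebra H := Finsupp.linearCombination ℂ weyl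

theorem weylSum_single (ξ : H) (c : ℂ) : weylSum (Finsupp.single ξ c) = c • weyl ξ :=
  Finsupp.linearCombination_single ..

/-- Products and adjoints of Weyl operators are scalar multiples of Weyl operators, so the generated
*-algebra is already their linear span. -/
theorem denseRange_weylSum : DenseRange (weylSum (H := H)) := by
  have h1 : ∀ a ∈ StarAlgebra.adjoin ℂ (Set.range (weylOp (H := H))),
      ∃ c : H →₀ ℂ, (weylSum c).1 = a := by
    intro a ha
    have h2 : a ∈ Submodule.span ℂ (Submonoid.closure
        (Set.range (weylOp (H := H)) ∪ star (Set.range weylOp)) :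
          Set (EllTwo H →L[ℂ] EllTwo H)) := by
      rw [← StarAlgebra.adjoin_eq_span]; exact ha
    have h3 : ∀ b ∈ Submonoid.closure (Set.range (weylOp (H := H)) ∪ star (Set.range weylOp)),
        ∃ (z : ℂ) (ξ : H), b = (z • weyl ξ).1 := by
      intro b hb
      induction hb using Submonoid.closure_induction with
      | mem b hb =>
        rcases hb with ⟨ξ, rfl⟩ | ⟨ξ, hξ⟩
        · exact ⟨1, ξ, by rw [one_smul]; rfl⟩
        · refine ⟨1, -ξ, ?_⟩
          rw [one_smul, ← star_weyl]
          exact (star_star b).symm.trans (congrArg star hξ.symm)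
      | one => exact ⟨1, 0, by rw [one_smul, weyl_zero]; rfl⟩
      | mul x y _ _ hx hy =>
        obtain ⟨z, ξ, rfl⟩ := hx
        obtain ⟨w, η, rfl⟩ := hy
        refine ⟨z * w * Complex.exp (-(Complex.I / 2) * (symp ξ η : ℂ)), ξ + η, ?_⟩
        change ((z • weyl ξ) * (w • weyl η) : WeylAlgebra H).1 = _
        rw [smul_mul_smul_comm, weyl_mul, smul_smul]
    have h4 : a ∈ LinearMap.range
        ((weylSubalgebra H).subtype.toAlgHom.toLinearMap.comp (weylSum (H := H))) := by
      refine Submodule.span_le.mpr ?_ h2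
      intro b hb
      obtain ⟨z, ξ, rfl⟩ := h3 b hb
      exact ⟨Finsupp.single ξ z, congrArg Subtype.val (weylSum_single ξ z)⟩
    obtain ⟨c, hc⟩ := h4
    exact ⟨c, hc⟩
  intro a
  have ha : a.1 ∈ closure (Subtype.val '' Set.range (weylSum (H := H))) := by
    refine closure_mono ?_ a.2
    intro b hb
    obtain ⟨c, hc⟩ := h1 b hb
    exact ⟨weylSum c, ⟨c, rfl⟩, hc⟩
  have hind : Topology.IsInducing (Subtype.val : WeylAlgebra H → EllTwo H →L[ℂ] EllTwo H) :=
    Topology.IsInducing.subtypeVal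
  exact (hind.closure_eq_preimage_closure_image _).symm.subset ha

/-- W(ξ) maps δ_0 to δ_ξ, the phase being 1 because σ(ξ, ξ) = 0. The coefficients can thus be read
off, which gives both linear independence and the bound `norm_apply_le_norm_weylSum`. -/
theorem weylSum_apply_single (c : H →₀ ℂ) (η : H) [DecidableEq H] :
    (weylSum c).1 (lp.single 2 0 1) η = c η := by
  induction c using Finsupp.induction_linear with
  | zero => rw [map_zero]; rfl
  | add f g hf hg =>
    rw [map_add, Finsupp.add_apply, ← hf, ← hg]
    rfl
  | single ξ z =>
    rw [weylSum_single]
    change z * (phase ξ η * (lp.single 2 0 1 : EllTwo H) (η - ξ)) = _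
    by_cases h : η = ξ
    · subst h
      simp [phase_self]
    · rw [Finsupp.single_apply, if_neg (Ne.symm h),
        lp.single_apply_ne _ _ _ (sub_ne_zero.mpr h)]
      simp

theorem weylSum_injective : Function.Injective (weylSum (H := H)) := by
  classical
  intro c d h
  ext η
  rw [← weylSum_apply_single, ← weylSum_apply_single, h]

theorem norm_apply_le_norm_weylSum (c : H →₀ ℂ) (η : H) : ‖c η‖ ≤ ‖weylSum c‖ := by
  classical
  rw [← weylSum_apply_single]
  refine (lp.norm_apply_le_norm (by norm_num) _ η).trans ?_
  refine ((weylSum c).1.le_opNorm _).trans ?_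
  rw [lp.norm_single (by norm_num), norm_one, mul_one]
  rfl

/-- From W(ξ)^* W(η) = e^{iσ(ξ,η)/2} W(η - ξ). It turns positivity of a functional into positivity
of the kernel K. -/
theorem exists_weylSum_eq_star_mul (K : H → H → ℂ) (F : (H →₀ ℂ) →ₗ[ℂ] ℂ)
    (hK : ∀ ξ η, K ξ η =
      Complex.exp (Complex.I / 2 * (symp ξ η : ℂ)) * F (Finsupp.single (η - ξ) 1))
    (c d : H →₀ ℂ) :
    ∃ e, weylSum e = star (weylSum c) * weylSum d ∧
      F e = c.sum fun i ci => d.sum fun j dj => star ci * K i j * dj := by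
  refine ⟨c.sum fun i ci => d.sum fun j dj =>
    (star ci * Complex.exp (Complex.I / 2 * (symp i j : ℂ)) * dj) • Finsupp.single (j - i) 1,
    ?_, ?_⟩
  · have h1 : ∀ e : H →₀ ℂ, weylSum e = e.sum fun i ei => ei • weyl i := fun e => rfl
    rw [h1 c, h1 d, Finsupp.sum, Finsupp.sum, Finsupp.sum, star_sum, Finset.sum_mul_sum, map_sum]
    refine Finset.sum_congr rfl fun i _ => ?_
    rw [Finsupp.sum, map_sum]
    refine Finset.sum_congr rfl fun j _ => ?_
    rw [map_smul, weylSum_single, one_smul, star_smul, star_weyl, smul_mul_smul_comm, weyl_mul,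
      smul_smul, neg_add_eq_sub]
    congr 1
    have : symp (-i) j = -symp i j := by simp [symp]
    rw [this]
    push_cast
    ring_nf
  · simp only [Finsupp.sum, map_sum, map_smul, hK, smul_eq_mul]
    refine Finset.sum_congr rfl fun i _ => Finset.sum_congr rfl fun j _ => ?_
    ring

theorem weylSum_mem_span (S : Finset H) {c : H →₀ ℂ} (hc : (c.support : Set H) ⊆ S) :
    weylSum c ∈ Submodule.span ℂ (weyl '' (S : Set H)) :=
  (Finsupp.mem_span_image_iff_linearCombination ℂ).mpr ⟨c, hc, rfl⟩

theorem pow_mem_span_box [DecidableEq H] {S : Finset H} {b : WeylAlgebra H}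
    (hb : b ∈ Submodule.span ℂ (weyl '' (S : Set H))) (n : ℕ) :
    b ^ n ∈ Submodule.span ℂ (weyl '' (box S n : Set H)) := by
  induction n with
  | zero =>
    rw [pow_zero, ← weyl_zero]
    exact Submodule.subset_span ⟨0, zero_mem_box S 0, rfl⟩
  | succ n ih =>
    rw [pow_succ]
    have h := Submodule.mul_mem_mul ih hb
    rw [Submodule.span_mul_span] at h
    refine Submodule.span_le.mpr ?_ h
    rintro _ ⟨_, ⟨ξ, hξ, rfl⟩, _, ⟨s, hs, rfl⟩, rfl⟩
    change weyl ξ * weyl s ∈ _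
    rw [weyl_mul]
    exact Submodule.smul_mem _ _ (Submodule.subset_span ⟨ξ + s, add_mem_box hξ hs, rfl⟩)

/-- A positive functional on the span of the Weyl operators with values of modulus at most one on
the Weyl operators is contractive: the powers of `a^* a` have polynomially growing support. -/
theorem norm_le_norm_weylSum {F : (H →₀ ℂ) →ₗ[ℂ] ℂ} (hF : ∀ ξ, ‖F (Finsupp.single ξ 1)‖ ≤ 1)
    (hsq : ∀ c e, weylSum e = star (weylSum c) * weylSum c → ‖F c‖ ^ 2 ≤ ‖F e‖)
    (c : H →₀ ℂ) : ‖F c‖ ≤ ‖weylSum c‖ := by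
  classical
  -- Crude bound: at most |S| terms, each with coefficient at most the norm and with a value of F of
  -- modulus at most one.
  have bound : ∀ (S : Finset H) (e : H →₀ ℂ),
      weylSum e ∈ Submodule.span ℂ (weyl '' (S : Set H)) → ‖F e‖ ≤ S.card * ‖weylSum e‖ := by
    intro S e he
    obtain ⟨e', he', h⟩ := (Finsupp.mem_span_image_iff_linearCombination ℂ).mp he
    obtain rfl : e' = e := weylSum_injective h
    have hsum : F e' = ∑ ξ ∈ e'.support, e' ξ * F (Finsupp.single ξ 1) := by
      conv_lhs => rw [← Finsupp.sum_single e']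
      rw [Finsupp.sum, map_sum]
      refine Finset.sum_congr rfl fun ξ _ => ?_
      rw [← smul_eq_mul, ← map_smul, Finsupp.smul_single, smul_eq_mul, mul_one]
    rw [hsum]
    refine (norm_sum_le_of_le (n := fun _ => ‖weylSum e'‖) e'.support fun ξ _ => ?_).trans ?_
    · rw [norm_mul]
      exact (mul_le_of_le_one_right (norm_nonneg _) (hF ξ)).trans
        (norm_apply_le_norm_weylSum e' ξ)
    · rw [Finset.sum_const, nsmul_eq_mul]
      gcongr
      exact Finset.coe_subset.mp he'
  have hex : ∃ e, weylSum e = star (weylSum c) * weylSum c :=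
    (exists_weylSum_eq_star_mul (fun ξ η =>
      Complex.exp (Complex.I / 2 * (symp ξ η : ℂ)) * F (Finsupp.single (η - ξ) 1)) F
      (fun _ _ => rfl) c c).imp fun e he => he.1
  obtain ⟨e, he⟩ := hex
  set b := weylSum e with hb
  have hbs : IsSelfAdjoint b := by rw [he]; exact IsSelfAdjoint.star_mul_self _
  have hbmem := weylSum_mem_span e.support (c := e) subset_rfl
  -- Iterated Cauchy–Schwarz: as b is selfadjoint, `hsq` applied to b^{2^k} passes to b^{2^{k+1}}.
  have hpow : ∀ k : ℕ, ∀ e', weylSum e' = b ^ 2 ^ k → ‖F e‖ ^ 2 ^ k ≤ ‖F e'‖ := by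
    intro k
    induction k with
    | zero =>
      intro e' he'
      rw [pow_zero, pow_one] at he'
      obtain rfl : e' = e := weylSum_injective he'
      rw [pow_zero, pow_one]
    | succ k ih =>
      intro e' he'
      obtain ⟨f, -, hf⟩ := (Finsupp.mem_span_image_iff_linearCombination ℂ).mp
        (pow_mem_span_box hbmem (2 ^ k))
      have hf' : weylSum f = b ^ 2 ^ k := hf
      refine le_trans ?_ (hsq f e' ?_)
      · rw [pow_succ 2 k, pow_mul]
        exact pow_le_pow_left₀ (by positivity) (ih f hf') 2
      · rw [he', hf', (hbs.pow _).star_eq, pow_succ 2 k, pow_mul, sq]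
  -- The two previous bounds give |F(b)|^{2^k} ≤ |box| · ‖b‖^{2^k}, with a box polynomial in 2^k.
  have key : ‖F e‖ ≤ ‖b‖ := by
    refine le_of_pow_le_mul_pow (p := e.support.card) (norm_nonneg _) fun k => ?_
    have hm := pow_mem_span_box hbmem (2 ^ k)
    obtain ⟨f, -, hf⟩ := (Finsupp.mem_span_image_iff_linearCombination ℂ).mp hm
    have hf' : weylSum f = b ^ 2 ^ k := hf
    have h2 := bound _ f (hf'.symm ▸ hm)
    rw [hf'] at h2
    refine (hpow k f hf').trans (h2.trans ?_)
    refine mul_le_mul ?_ (norm_pow_le' _ (by positivity)) (norm_nonneg _) (by positivity)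
    exact_mod_cast card_box_le e.support (2 ^ k)
  refine le_of_sq_le_sq ?_ (norm_nonneg _)
  refine (hsq c e he).trans (key.trans ?_)
  rw [he, CStarRing.norm_star_mul_self, sq]

end WeylSpan

/-! ## The Fock state -/

section Fock

variable {H : Type} [NormedAddCommGroup H] [InnerProductSpace ℂ H]

/-- A Gram matrix is positive semidefinite, and the Schur product theorem passes this to its
entrywise powers. -/
theorem posSemidef_inner_pow (n : ℕ) :
    (Matrix.of fun ξ η : H => (inner ℂ ξ η / 2 : ℂ) ^ n).PosSemidef := by
  have h1 : (Matrix.of fun ξ η : H => (inner ℂ ξ η / 2 : ℂ)).PosSemidef := by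
    refine ⟨?_, fun c => ?_⟩
    · ext ξ η
      simp [Matrix.conjTranspose_apply]
    · have h2 : (c.sum fun i ci => c.sum fun j cj =>
          star ci * (Matrix.of fun ξ η : H => (inner ℂ ξ η / 2 : ℂ)) i j * cj)
          = ((‖c.sum fun i ci => ci • i‖ ^ 2 / 2 : ℝ) : ℂ) := by
        have h3 : inner ℂ (c.sum fun i ci => ci • i) (c.sum fun i ci => ci • i)
            = ((‖c.sum fun i ci => ci • i‖ : ℝ) : ℂ) ^ 2 := inner_self_eq_norm_sq_to_K _
        push_cast
        rw [← h3]
        simp only [Finsupp.sum, sum_inner]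
        simp only [inner_sum, inner_smul_left, inner_smul_right, Finset.sum_div,
          Matrix.of_apply]
        refine Finset.sum_congr rfl fun i _ => Finset.sum_congr rfl fun j _ => ?_
        simp only [RCLike.star_def]
        ring
      rw [h2]
      exact_mod_cast (by positivity : 0 ≤ ‖c.sum fun i ci => ci • i‖ ^ 2 / 2)
  induction n with
  | zero =>
    refine ⟨?_, fun c => ?_⟩
    · ext ξ η
      simp [Matrix.conjTranspose_apply]
    · have h2 : (c.sum fun i ci => c.sum fun j cj =>
          star ci * (Matrix.of fun ξ η : H => (inner ℂ ξ η / 2 : ℂ) ^ 0) i j * cj)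
          = star (c.sum fun _ ci => ci) * c.sum fun _ ci => ci := by
        simp only [Finsupp.sum, star_sum, Finset.sum_mul_sum, Matrix.of_apply, pow_zero, mul_one]
      rw [h2]
      exact star_mul_self_nonneg _
  | succ n ih =>
    have h := Matrix.PosSemidef.hadamard (𝕜 := ℂ) ih h1
    have h2 : (Matrix.of fun ξ η : H => (inner ℂ ξ η / 2 : ℂ) ^ (n + 1)) = Matrix.hadamard
        (Matrix.of fun ξ η : H => (inner ℂ ξ η / 2 : ℂ) ^ n)
        (Matrix.of fun ξ η : H => (inner ℂ ξ η / 2 : ℂ)) := by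
      ext ξ η
      simp [pow_succ]
    rw [h2]
    exact h

/-- The kernel of the Fock vacuum. -/
def fockKernel (ξ η : H) : ℂ :=
  Complex.exp (inner ℂ ξ η / 2) * (Real.exp (-(1 / 4) * ‖ξ‖ ^ 2) * Real.exp (-(1 / 4) * ‖η‖ ^ 2))

/-- Expand the exponential into the kernels of `posSemidef_inner_pow`, with positive weights 1/n!.
The Gaussian factors are absorbed into the coefficients. -/
theorem fockKernel_nonneg (c : H →₀ ℂ) :
    0 ≤ c.sum fun i ci => c.sum fun j cj => star ci * fockKernel i j * cj := by
  set g : H → ℂ := fun ξ => Real.exp (-(1 / 4) * ‖ξ‖ ^ 2)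
  have h1 : ∀ n : ℕ, 0 ≤ (n.factorial : ℂ)⁻¹ * ∑ i ∈ c.support, ∑ j ∈ c.support,
      star (g i * c i) * (inner ℂ i j / 2 : ℂ) ^ n * (g j * c j) := by
    intro n
    have h2 := (posSemidef_inner_pow (H := H) n).2
      (Finsupp.indicator c.support fun i _ => g i * c i)
    rw [Finsupp.sum_indicator_index _ (by simp)] at h2
    have h3 : ∀ i : H, ((Finsupp.indicator c.support fun i _ => g i * c i).sum fun j xj =>
        star (g i * c i) * (Matrix.of fun ξ η : H => (inner ℂ ξ η / 2 : ℂ) ^ n) i j * xj)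
        = ∑ j ∈ c.support, star (g i * c i) * (inner ℂ i j / 2 : ℂ) ^ n * (g j * c j) :=
      fun i => Finsupp.sum_indicator_index _ (by simp)
    simp only [h3] at h2
    refine mul_nonneg ?_ h2
    rw [← Complex.ofReal_natCast, ← Complex.ofReal_inv, Complex.zero_le_real]
    positivity
  have h3 : HasSum (fun n : ℕ => (n.factorial : ℂ)⁻¹ * ∑ i ∈ c.support, ∑ j ∈ c.support,
      star (g i * c i) * (inner ℂ i j / 2 : ℂ) ^ n * (g j * c j))
      (∑ i ∈ c.support, ∑ j ∈ c.support, star (c i) * fockKernel i j * c j) := by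
    simp only [Finset.mul_sum]
    refine hasSum_sum fun i _ => hasSum_sum fun j _ => ?_
    have h4 := (NormedSpace.expSeries_div_hasSum_exp (inner ℂ i j / 2 : ℂ)).mul_left
      (star (g i * c i) * (g j * c j))
    rw [← Complex.exp_eq_exp_ℂ] at h4
    have hg : star (g i) = g i := Complex.conj_ofReal _
    have hk : fockKernel i j = Complex.exp (inner ℂ i j / 2) * (g i * g j) := rfl
    have h5 : star (c i) * fockKernel i j * c j
        = star (g i * c i) * (g j * c j) * Complex.exp (inner ℂ i j / 2) := by
      rw [hk, star_mul, hg]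
      ring
    rw [h5]
    refine h4.congr_fun fun n => ?_
    ring
  exact h3.nonneg h1

variable (H) in
/-- The Fock vacuum functional `W(ξ) ↦ e^{-‖ξ‖²/4}` on the span of the Weyl operators. -/
def fockFun : (H →₀ ℂ) →ₗ[ℂ] ℂ :=
  Finsupp.linearCombination ℂ fun ξ => ((Real.exp (-(1 / 4) * ‖ξ‖ ^ 2) : ℝ) : ℂ)

theorem fockFun_single (ξ : H) :
    fockFun H (Finsupp.single ξ 1) = ((Real.exp (-(1 / 4) * ‖ξ‖ ^ 2) : ℝ) : ℂ) := by
  rw [fockFun, Finsupp.linearCombination_single, one_smul]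

/-- Polarization: -‖η - ξ‖²/4 + iσ(ξ,η)/2 = ⟨ξ,η⟩/2 - ‖ξ‖²/4 - ‖η‖²/4. -/
theorem fockKernel_eq (ξ η : H) : fockKernel ξ η =
    Complex.exp (Complex.I / 2 * (symp ξ η : ℂ)) * fockFun H (Finsupp.single (η - ξ) 1) := by
  rw [fockFun_single, fockKernel, Complex.ofReal_exp, Complex.ofReal_exp, Complex.ofReal_exp,
    ← Complex.exp_add, ← Complex.exp_add, ← Complex.exp_add]
  congr 1
  have h1 : ‖η - ξ‖ ^ 2 = ‖η‖ ^ 2 - 2 * (inner ℂ ξ η).re + ‖ξ‖ ^ 2 := by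
    rw [@norm_sub_sq ℂ, inner_re_symm]; rfl
  rw [h1]
  have h2 : (inner ℂ ξ η : ℂ) = (inner ℂ ξ η).re + (symp ξ η : ℂ) * Complex.I :=
    (Complex.re_add_im _).symm
  rw [h2]
  push_cast
  simp only [Complex.add_re, Complex.ofReal_re, Complex.mul_re, Complex.ofReal_im, Complex.I_re,
    Complex.I_im]
  push_cast
  ring

theorem exists_weylSum_star_mul (c d : H →₀ ℂ) :
    ∃ e, weylSum e = star (weylSum c) * weylSum d ∧
      fockFun H e = c.sum fun i ci => d.sum fun j dj => star ci * fockKernel i j * dj :=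
  exists_weylSum_eq_star_mul _ _ fockKernel_eq c d

theorem fockFun_nonneg {c e : H →₀ ℂ} (he : weylSum e = star (weylSum c) * weylSum c) :
    0 ≤ fockFun H e := by
  obtain ⟨e', he', h⟩ := exists_weylSum_star_mul c c
  obtain rfl : e = e' := weylSum_injective (he.trans he'.symm)
  rw [h]
  exact fockKernel_nonneg c

theorem fockFun_star {c e : H →₀ ℂ} (he : weylSum e = star (weylSum c)) :
    fockFun H e = conj (fockFun H c) := by
  obtain ⟨e', he', h⟩ := exists_weylSum_star_mul c (Finsupp.single 0 1)
  rw [weylSum_single, one_smul, weyl_zero, mul_one] at he'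
  obtain rfl : e = e' := weylSum_injective (he.trans he'.symm)
  rw [h, fockFun, Finsupp.linearCombination_apply, Finsupp.sum, Finsupp.sum, map_sum]
  refine Finset.sum_congr rfl fun i _ => ?_
  rw [Finsupp.sum_single_index (by simp)]
  have h1 : conj (((Real.exp (-(1 / 4) * ‖i‖ ^ 2) : ℝ) : ℂ))
      = ((Real.exp (-(1 / 4) * ‖i‖ ^ 2) : ℝ) : ℂ) := Complex.conj_ofReal _
  rw [smul_eq_mul, map_mul, h1, fockKernel]
  simp

/-- The variance is nonnegative: evaluate the positive functional on (a - z)^* (a - z), where a is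
the Weyl sum of c and z its expectation. -/
theorem norm_fockFun_sq_le {c e : H →₀ ℂ} (he : weylSum e = star (weylSum c) * weylSum c) :
    ‖fockFun H c‖ ^ 2 ≤ ‖fockFun H e‖ := by
  set z := fockFun H c with hz
  set u : H →₀ ℂ := Finsupp.single 0 1 with hu
  have hWu : weylSum u = 1 := by rw [hu, weylSum_single, one_smul, weyl_zero]
  have hFu : fockFun H u = 1 := by rw [hu, fockFun_single]; simp
  obtain ⟨s, hs, -⟩ := exists_weylSum_star_mul c u
  rw [hWu, mul_one] at hs
  have h1 : 0 ≤ fockFun H (e - z • s - conj z • c + (conj z * z) • u) := by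
    refine fockFun_nonneg (c := c - z • u) ?_
    simp only [map_add, map_sub, map_smul, he, hs, hWu, star_sub, star_smul, star_one, sub_mul,
      mul_sub, smul_mul_assoc, mul_smul_comm, mul_one, one_mul, RCLike.star_def, smul_sub]
    rw [mul_comm (conj z) z, mul_smul]
    abel
  have h0 := fockFun_nonneg he
  rw [map_add, map_sub, map_sub, map_smul, map_smul, map_smul, fockFun_star hs, hFu, ← hz] at h1
  have h2 : conj z * z = ((‖z‖ ^ 2 : ℝ) : ℂ) := by
    rw [mul_comm, Complex.mul_conj, Complex.normSq_eq_norm_sq]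
  simp only [smul_eq_mul, mul_comm z (conj z), h2, mul_one, sub_add_cancel] at h1
  have h3 : fockFun H e = ((‖fockFun H e‖ : ℝ) : ℂ) := (RCLike.norm_of_nonneg' h0).symm
  rw [h3, ← Complex.ofReal_sub, Complex.zero_le_real] at h1
  linarith

theorem norm_fockFun_le (c : H →₀ ℂ) : ‖fockFun H c‖ ≤ 1 * ‖weylSum c‖ := by
  rw [one_mul]
  refine norm_le_norm_weylSum (fun ξ => ?_) (fun c e he => norm_fockFun_sq_le he) c
  rw [fockFun_single, Complex.norm_real, Real.norm_of_nonneg (Real.exp_nonneg _)]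
  exact Real.exp_le_one_iff.mpr (by nlinarith [sq_nonneg ‖ξ‖])

variable (H) in
/-- The extension of `fockFun` to the Weyl algebra. -/
def fockCLM : WeylAlgebra H →L[ℂ] ℂ := (fockFun H).extendOfNorm weylSum

theorem fockCLM_weylSum (c : H →₀ ℂ) : fockCLM H (weylSum c) = fockFun H c :=
  LinearMap.extendOfNorm_eq denseRange_weylSum ⟨1, norm_fockFun_le⟩ c

theorem norm_fockCLM_le (a : WeylAlgebra H) : ‖fockCLM H a‖ ≤ ‖a‖ := by
  rw [← one_mul ‖a‖]
  exact LinearMap.norm_extendOfNorm_apply_le denseRange_weylSum 1 norm_fockFun_le a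

theorem fockCLM_star_mul_self_nonneg (a : WeylAlgebra H) : 0 ≤ fockCLM H (star a * a) := by
  refine denseRange_weylSum.induction_on (p := fun a => 0 ≤ fockCLM H (star a * a)) a ?_ ?_
  · exact isClosed_le continuous_const (by fun_prop)
  · intro c
    obtain ⟨e, he, -⟩ := exists_weylSum_star_mul c c
    rw [← he, fockCLM_weylSum]
    exact fockFun_nonneg he

variable (H) in
/-- The Fock vacuum, `ω(W(ξ)) = e^{-‖ξ‖²/4}`. -/
def fockState : State (WeylAlgebra H) where
  toPos := PositiveLinearMap.mk₀ (fockCLM H).toLinearMap fun a ha => by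
    obtain ⟨b, rfl⟩ := CStarAlgebra.nonneg_iff_eq_star_mul_self.mp ha
    exact fockCLM_star_mul_self_nonneg b
  map_one := by
    change fockCLM H 1 = 1
    rw [← weyl_zero, ← one_smul ℂ (weyl 0), ← weylSum_single, fockCLM_weylSum, fockFun_single]
    simp

theorem fockState_apply (a : WeylAlgebra H) : fockState H a = fockCLM H a := rfl

theorem fockState_weyl (ξ : H) :
    fockState H (weyl ξ) = ((Real.exp (-(1 / 4) * ‖ξ‖ ^ 2) : ℝ) : ℂ) := by
  rw [fockState_apply, ← one_smul ℂ (weyl ξ), ← weylSum_single, fockCLM_weylSum, fockFun_single]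

/-- The pullback of a state by a *-homomorphism. -/
def State.comap {A B : Type} [CStarAlgebra A] [PartialOrder A] [StarOrderedRing A]
    [CStarAlgebra B] [PartialOrder B] [StarOrderedRing B] (ω : State B) (φ : A →⋆ₐ[ℂ] B) :
    State A where
  toPos := PositiveLinearMap.mk₀ (ω.toPos.toLinearMap.comp φ.toAlgHom.toLinearMap) fun a ha => by
    obtain ⟨b, rfl⟩ := CStarAlgebra.nonneg_iff_eq_star_mul_self.mp ha
    change 0 ≤ ω.toPos (φ (star b * b))
    rw [map_mul, map_star]
    exact ω.toPos.map_nonneg (star_mul_self_nonneg _)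
  map_one := by
    change ω.toPos (φ 1) = 1
    rw [_root_.map_one φ, ω.map_one]

theorem State.comap_apply {A B : Type} [CStarAlgebra A] [PartialOrder A] [StarOrderedRing A]
    [CStarAlgebra B] [PartialOrder B] [StarOrderedRing B] (ω : State B) (φ : A →⋆ₐ[ℂ] B) (a : A) :
    ω.comap φ a = ω (φ a) := rfl

end Fock

/-! ## Maps out of the inductive limit -/

section Lift

variable {A : ℕ → Type} [∀ n, CStarAlgebra (A n)] {α : ∀ n, A n →⋆ₐ[ℂ] A (n + 1)}
  {B : Type} [CStarAlgebra B] {φ : ∀ n, A n →⋆ₐ[ℂ] B}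

theorem map_transition (hφ : ∀ n a, φ (n + 1) (α n a) = φ n a) {N N' : ℕ} (h : N ≤ N') (a : A N) :
    φ N' (transition α h a) = φ N a := by
  induction N', h using Nat.le_induction with
  | base => rw [transition, Nat.leRecOn_self]; rfl
  | succ n hn ih => rw [transition_succ α hn, hφ, ih]

/-- Compatibility makes φ_n(a_n) constant from the index on at which the sequence is coherent. -/
theorem exists_eventually_map_entry_eq (hφ : ∀ n a, φ (n + 1) (α n a) = φ n a) (a : Coherent α) :
    ∃ b : B, ∀ᶠ n in atTop, φ n (a.entry n) = b := by
  obtain ⟨n₀, hn₀⟩ := eventually_atTop.mp a.2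
  refine ⟨φ n₀ (a.entry n₀), eventually_atTop.mpr ⟨n₀, fun n hn => ?_⟩⟩
  induction n, hn using Nat.le_induction with
  | base => rfl
  | succ n hn ih =>
    have : a.entry (n + 1) = α n (a.entry n) := hn₀ n hn
    rw [this, hφ, ih]

variable (hφ : ∀ n a, φ (n + 1) (α n a) = φ n a)

/-- The eventual value of `φ_n(a_n)` for a coherent sequence `a`. -/
def coherentLift (a : Coherent α) : B := (exists_eventually_map_entry_eq hφ a).choose

theorem coherentLift_spec (a : Coherent α) :
    ∀ᶠ n in atTop, φ n (a.entry n) = coherentLift hφ a :=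
  (exists_eventually_map_entry_eq hφ a).choose_spec

theorem coherentLift_eq {a : Coherent α} {b : B} (h : ∀ᶠ n in atTop, φ n (a.entry n) = b) :
    coherentLift hφ a = b := by
  obtain ⟨n, h1, h2⟩ := ((coherentLift_spec hφ a).and h).exists
  exact h1.symm.trans h2

theorem coherentLift_mul (a b : Coherent α) :
    coherentLift hφ (a * b) = coherentLift hφ a * coherentLift hφ b := by
  refine coherentLift_eq hφ ?_
  filter_upwards [coherentLift_spec hφ a, coherentLift_spec hφ b] with n h1 h2
  rw [← h1, ← h2, ← map_mul]; rfl

theorem coherentLift_add (a b : Coherent α) :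
    coherentLift hφ (a + b) = coherentLift hφ a + coherentLift hφ b := by
  refine coherentLift_eq hφ ?_
  filter_upwards [coherentLift_spec hφ a, coherentLift_spec hφ b] with n h1 h2
  rw [← h1, ← h2, ← map_add]; rfl

theorem coherentLift_smul (c : ℂ) (a : Coherent α) :
    coherentLift hφ (c • a) = c • coherentLift hφ a := by
  refine coherentLift_eq hφ ?_
  filter_upwards [coherentLift_spec hφ a] with n h1
  rw [← h1, ← map_smul]; rfl

theorem coherentLift_star (a : Coherent α) :
    coherentLift hφ (star a) = star (coherentLift hφ a) := by
  refine coherentLift_eq hφ ?_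
  filter_upwards [coherentLift_spec hφ a] with n h1
  rw [← h1, ← map_star]; rfl

theorem coherentLift_one : coherentLift hφ 1 = 1 :=
  coherentLift_eq hφ (Eventually.of_forall fun n => map_one (φ n))

theorem norm_coherentLift (hn : ∀ n a, ‖φ n a‖ = ‖a‖) (a : Coherent α) :
    ‖coherentLift hφ a‖ = ‖a‖ := by
  refine tendsto_nhds_unique (tendsto_const_nhds.congr' ?_) (limNorm_tendsto α a)
  filter_upwards [coherentLift_spec hφ a] with n h1
  rw [← h1, hn]

theorem uniformContinuous_coherentLift (hn : ∀ n a, ‖φ n a‖ = ‖a‖) :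
    UniformContinuous (coherentLift hφ) := by
  let L : Coherent α →+ B :=
    { toFun := coherentLift hφ
      map_zero' := coherentLift_eq hφ (Eventually.of_forall fun n => map_zero (φ n))
      map_add' := coherentLift_add hφ }
  exact (AddMonoidHomClass.isometry_of_norm L (norm_coherentLift hφ hn)).uniformContinuous

/-- The map of the inductive limit underlying `IndLim.lift`. -/
def IndLim.liftFun (x : IndLim α) : B :=
  UniformSpace.Completion.extension (coherentLift hφ) x

theorem IndLim.continuous_liftFun : Continuous (IndLim.liftFun hφ) :=
  UniformSpace.Completion.continuous_extension

theorem IndLim.liftFun_mk (hn : ∀ n a, ‖φ n a‖ = ‖a‖) (a : Coherent α) :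
    IndLim.liftFun hφ (IndLim.mk α a) = coherentLift hφ a :=
  UniformSpace.Completion.extension_coe (uniformContinuous_coherentLift hφ hn) a

variable (hn : ∀ n a, ‖φ n a‖ = ‖a‖)

/-- The *-homomorphism of the inductive limit defined by compatible isometric *-homomorphisms. -/
def IndLim.lift : IndLim α →⋆ₐ[ℂ] B where
  toFun := IndLim.liftFun hφ
  map_one' := by rw [← IndLim.mk_one, IndLim.liftFun_mk hφ hn, coherentLift_one]
  map_mul' x y := by
    have hc := IndLim.continuous_liftFun hφ
    refine IndLim.ind₂ (p := fun x y => IndLim.liftFun hφ (x * y)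
      = IndLim.liftFun hφ x * IndLim.liftFun hφ y) x y
      (isClosed_eq (by fun_prop) (by fun_prop)) fun a b => ?_
    rw [← IndLim.mk_mul, IndLim.liftFun_mk hφ hn, IndLim.liftFun_mk hφ hn,
      IndLim.liftFun_mk hφ hn, coherentLift_mul]
  map_zero' := by
    rw [← IndLim.mk_zero, IndLim.liftFun_mk hφ hn]
    exact coherentLift_eq hφ (Eventually.of_forall fun n => map_zero (φ n))
  map_add' x y := by
    have hc := IndLim.continuous_liftFun hφ
    refine IndLim.ind₂ (p := fun x y => IndLim.liftFun hφ (x + y)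
      = IndLim.liftFun hφ x + IndLim.liftFun hφ y) x y
      (isClosed_eq (by fun_prop) (by fun_prop)) fun a b => ?_
    rw [← IndLim.mk_add, IndLim.liftFun_mk hφ hn, IndLim.liftFun_mk hφ hn,
      IndLim.liftFun_mk hφ hn, coherentLift_add]
  commutes' c := by
    rw [Algebra.algebraMap_eq_smul_one, Algebra.algebraMap_eq_smul_one, ← IndLim.mk_one,
      ← IndLim.mk_smul, IndLim.liftFun_mk hφ hn, coherentLift_smul, coherentLift_one]
  map_star' x := by
    have hc := IndLim.continuous_liftFun hφ
    refine IndLim.ind (p := fun x => IndLim.liftFun hφ (star x) = star (IndLim.liftFun hφ x)) x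
      (isClosed_eq (by fun_prop) (by fun_prop)) fun a => ?_
    rw [IndLim.mk_star, IndLim.liftFun_mk hφ hn, IndLim.liftFun_mk hφ hn, coherentLift_star]

theorem IndLim.lift_mk (a : Coherent α) :
    IndLim.lift hφ hn (IndLim.mk α a) = coherentLift hφ a :=
  IndLim.liftFun_mk hφ hn a

theorem IndLim.lift_of (N : ℕ) (a : A N) : IndLim.lift hφ hn (IndLim.of α N a) = φ N a := by
  refine (IndLim.lift_mk hφ hn _).trans (coherentLift_eq hφ ?_)
  refine eventually_atTop.mpr ⟨N, fun n h => ?_⟩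
  rw [IndLim.entry_seqOf h, map_transition hφ]

theorem IndLim.norm_lift (x : IndLim α) : ‖IndLim.lift hφ hn x‖ = ‖x‖ := by
  have hc : Continuous (IndLim.lift hφ hn) := IndLim.continuous_liftFun hφ
  refine IndLim.ind (p := fun x => ‖IndLim.lift hφ hn x‖ = ‖x‖) x
    (isClosed_eq (by fun_prop) (by fun_prop)) fun a => ?_
  rw [IndLim.lift_mk, norm_coherentLift hφ hn]
  exact (IndLim.norm_mk a).symm

theorem IndLim.lift_injective : Function.Injective (IndLim.lift hφ hn) :=
  (AddMonoidHomClass.isometry_of_norm _ (IndLim.norm_lift hφ hn)).injective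

theorem IndLim.lift_mem {S : Set B} (hS : IsClosed S) (h : ∀ n a, φ n a ∈ S) (x : IndLim α) :
    IndLim.lift hφ hn x ∈ S := by
  have hc : Continuous (IndLim.lift hφ hn) := IndLim.continuous_liftFun hφ
  refine IndLim.ind (p := fun x => IndLim.lift hφ hn x ∈ S) x (hS.preimage hc) fun a => ?_
  obtain ⟨n, h1⟩ := (coherentLift_spec hφ a).exists
  rw [IndLim.lift_mk, ← h1]
  exact h n _

/-- An isometric image of a complete space is closed, so the range contains a generated C*-algebra
as soon as it contains the generators. -/
theorem IndLim.isClosed_range_lift : IsClosed (Set.range (IndLim.lift hφ hn)) :=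
  (AddMonoidHomClass.isometry_of_norm (IndLim.lift hφ hn)
    (IndLim.norm_lift hφ hn)).isClosedEmbedding.isClosed_range

end Lift

/-! ## Restricting a GNS representation to a subalgebra with dense orbit -/

section GNS

variable {A B : Type} [CStarAlgebra A] [PartialOrder A] [StarOrderedRing A]
  [CStarAlgebra B] [PartialOrder B] [StarOrderedRing B]

/-- The vector `π(a) Ω` of the GNS space. -/
def State.vec (ω : State A) : A →ₗ[ℂ] ω.Space :=
  (UniformSpace.Completion.toComplL (𝕜 := ℂ) (E := ω.toPos.PreGNS)).toLinearMap.comp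
    ω.toPos.toPreGNS.toLinearMap

theorem State.denseRange_vec (ω : State A) : DenseRange ω.vec :=
  (UniformSpace.Completion.denseRange_coe (α := ω.toPos.PreGNS)).comp
    ω.toPos.toPreGNS.surjective.denseRange (UniformSpace.Completion.continuous_coe _)

theorem State.rep_vec (ω : State A) (a b : A) : ω.rep a (ω.vec b) = ω.vec (a * b) :=
  ω.toPos.gnsNonUnitalStarAlgHom_apply_coe (a := a) (b := ω.toPos.toPreGNS b)

theorem State.norm_vec_sq (ω : State A) (a : A) : ((‖ω.vec a‖ ^ 2 : ℝ) : ℂ) = ω (star a * a) := by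
  have h : ‖ω.vec a‖ = ‖ω.toPos.toPreGNS a‖ := UniformSpace.Completion.norm_coe _
  rw [h]
  push_cast
  exact ω.toPos.preGNS_norm_sq _

theorem State.norm_vec_comap (ω : State B) (Φ : A →⋆ₐ[ℂ] B) (a : A) :
    ‖ω.vec (Φ a)‖ = ‖(ω.comap Φ).vec a‖ := by
  have h : ‖ω.vec (Φ a)‖ ^ 2 = ‖(ω.comap Φ).vec a‖ ^ 2 := by
    have h1 := ω.norm_vec_sq (Φ a)
    have h2 := (ω.comap Φ).norm_vec_sq a
    rw [State.comap_apply, map_mul, map_star, ← h1] at h2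
    exact_mod_cast h2.symm
  exact (pow_left_inj₀ (norm_nonneg _) (norm_nonneg _) two_ne_zero).mp h

/-- The assignment π(a)Ω ↦ π(Φ(a))Ω is isometric, both squared norms being ω(Φ(a^* a)). Its
extension has closed range, which is everything once the orbit is dense. -/
theorem State.exists_unitary_comap (ω : State B) (Φ : A →⋆ₐ[ℂ] B)
    (hd : Dense (Set.range fun a => ω.vec (Φ a))) :
    ∃ U : (ω.comap Φ).Space ≃ₗᵢ[ℂ] ω.Space,
      (∀ a v, U ((ω.comap Φ).rep a v) = ω.rep (Φ a) (U v)) ∧ U (ω.comap Φ).vac = ω.vac := by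
  let f : A →ₗ[ℂ] ω.Space := ω.vec.comp Φ.toAlgHom.toLinearMap
  have hd' : DenseRange (ω.comap Φ).vec := (ω.comap Φ).denseRange_vec
  have hb : ∀ a, ‖f a‖ ≤ 1 * ‖(ω.comap Φ).vec a‖ := fun a => by
    rw [one_mul]; exact (ω.norm_vec_comap Φ a).le
  let V : (ω.comap Φ).Space →L[ℂ] ω.Space := f.extendOfNorm (ω.comap Φ).vec
  have hV : ∀ a, V ((ω.comap Φ).vec a) = ω.vec (Φ a) := LinearMap.extendOfNorm_eq hd' ⟨1, hb⟩
  have hVn : ∀ v, ‖V v‖ = ‖v‖ := fun v => by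
    refine hd'.induction_on (p := fun v => ‖V v‖ = ‖v‖) v
      (isClosed_eq (by fun_prop) (by fun_prop)) fun a => ?_
    rw [hV, ω.norm_vec_comap Φ]
  let Vi : (ω.comap Φ).Space →ₗᵢ[ℂ] ω.Space := ⟨V.toLinearMap, hVn⟩
  have hVs : Function.Surjective Vi := by
    have hc : IsClosed (Set.range Vi) := Vi.isometry.isClosedEmbedding.isClosed_range
    have hsub : (Set.range fun a => ω.vec (Φ a)) ⊆ Set.range Vi := by
      rintro _ ⟨a, rfl⟩
      exact ⟨_, hV a⟩
    refine Set.range_eq_univ.mp ?_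
    rw [← hc.closure_eq]
    exact (hd.mono hsub).closure_eq
  refine ⟨LinearIsometryEquiv.ofSurjective Vi hVs, fun a v => ?_, ?_⟩
  · refine hd'.induction_on (p := fun v => V ((ω.comap Φ).rep a v) = ω.rep (Φ a) (V v)) v
      (isClosed_eq (by fun_prop) (by fun_prop)) fun b => ?_
    rw [State.rep_vec, hV, hV, State.rep_vec, map_mul]
  · have h := hV 1
    rw [_root_.map_one Φ] at h
    exact h

end GNS

/-! ## Continuity properties of the Fock state -/

section FockContinuity

variable {H : Type} [NormedAddCommGroup H] [InnerProductSpace ℂ H]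

theorem norm_fockState_vec_le (a : WeylAlgebra H) : ‖(fockState H).vec a‖ ≤ ‖a‖ := by
  refine le_of_sq_le_sq ?_ (norm_nonneg _)
  have h := congrArg norm ((fockState H).norm_vec_sq a)
  rw [Complex.norm_real, Real.norm_of_nonneg (by positivity)] at h
  rw [h, sq, ← CStarRing.norm_star_mul_self]
  exact norm_fockCLM_le _

theorem continuous_fockState_vec : Continuous (fockState H).vec :=
  AddMonoidHomClass.continuous_of_bound (fockState H).vec 1 fun a => by
    rw [one_mul]; exact norm_fockState_vec_le a

theorem fockState_star_weyl_mul_weyl (ξ η : H) :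
    fockState H (star (weyl ξ) * weyl η) = fockKernel ξ η := by
  obtain ⟨e, he, h⟩ := exists_weylSum_star_mul (Finsupp.single ξ 1) (Finsupp.single η 1)
  rw [weylSum_single, weylSum_single, one_smul, one_smul] at he
  rw [fockState_apply, ← he, fockCLM_weylSum, h, Finsupp.sum_single_index (by simp),
    Finsupp.sum_single_index (by simp)]
  simp

theorem fockKernel_self (ξ : H) : fockKernel ξ ξ = 1 := by
  rw [fockKernel_eq, symp_self, sub_self, fockFun_single]
  simp

theorem continuous_fockKernel : Continuous fun p : H × H => fockKernel p.1 p.2 := by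
  unfold fockKernel
  fun_prop

theorem norm_vec_weyl_sub_sq (ξ η : H) :
    ((‖(fockState H).vec (weyl ξ) - (fockState H).vec (weyl η)‖ ^ 2 : ℝ) : ℂ)
      = 2 - fockKernel ξ η - fockKernel η ξ := by
  have h1 : ∀ a b : WeylAlgebra H, fockState H (a - b) = fockState H a - fockState H b :=
    fun a b => map_sub (fockCLM H) a b
  rw [← map_sub, State.norm_vec_sq, star_sub, sub_mul, mul_sub, mul_sub, h1, h1, h1,
    fockState_star_weyl_mul_weyl, fockState_star_weyl_mul_weyl, fockState_star_weyl_mul_weyl,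
    fockState_star_weyl_mul_weyl, fockKernel_self, fockKernel_self]
  ring

/-- Distinct Weyl operators have norm distance at least 1, by `norm_apply_le_norm_weylSum`. Only
after application to the vacuum is there continuity, because ‖W(η)Ω - W(ξ)Ω‖² is expressed through
the continuous kernel. -/
theorem continuous_vec_weyl : Continuous fun ξ : H => (fockState H).vec (weyl ξ) := by
  refine continuous_iff_continuousAt.mpr fun ξ => ?_
  refine tendsto_iff_norm_sub_tendsto_zero.mpr ?_
  have hk := continuous_fockKernel (H := H)
  have h1 : Continuous fun η : H => (2 - fockKernel η ξ - fockKernel ξ η).re := by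
    have h2 : Continuous fun η : H => fockKernel η ξ :=
      hk.comp (continuous_id.prodMk continuous_const)
    have h3 : Continuous fun η : H => fockKernel ξ η :=
      hk.comp (continuous_const.prodMk continuous_id)
    exact Complex.continuous_re.comp ((continuous_const.sub h2).sub h3)
  have h4 : Tendsto (fun η : H => √(2 - fockKernel η ξ - fockKernel ξ η).re) (𝓝 ξ)
      (𝓝 (√(2 - fockKernel ξ ξ - fockKernel ξ ξ).re)) :=
    (Real.continuous_sqrt.comp h1).tendsto ξ
  have h0 : √(2 - fockKernel ξ ξ - fockKernel ξ ξ).re = 0 := by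
    rw [fockKernel_self]; norm_num
  rw [h0] at h4
  have h5 : ∀ η : H, ‖(fockState H).vec (weyl η) - (fockState H).vec (weyl ξ)‖
      = √(2 - fockKernel η ξ - fockKernel ξ η).re := by
    intro η
    rw [← norm_vec_weyl_sub_sq, Complex.ofReal_re, Real.sqrt_sq (norm_nonneg _)]
  simp only [h5]
  exact h4

theorem map_mem_closure_image {E : Type} [NormedAddCommGroup E] [NormedSpace ℂ E]
    {V : WeylAlgebra H →ₗ[ℂ] E} (hV : Continuous V) (hw : Continuous fun ξ : H => V (weyl ξ))
    {D : Set H} (hD : Dense D) {S : Submodule ℂ (WeylAlgebra H)} (hS : ∀ ξ ∈ D, weyl ξ ∈ S)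
    (a : WeylAlgebra H) : V a ∈ closure (V '' S) := by
  have hT : ∀ ξ : H, V (weyl ξ) ∈ (S.map V).topologicalClosure := fun ξ =>
    map_mem_closure (f := fun ξ : H => V (weyl ξ)) (t := V '' S) hw (hD ξ)
      fun η hη => ⟨weyl η, hS η hη, rfl⟩
  have hc : ∀ c : H →₀ ℂ, V (weylSum c) ∈ (S.map V).topologicalClosure := by
    intro c
    induction c using Finsupp.induction_linear with
    | zero => rw [map_zero, map_zero]; exact Submodule.zero_mem _
    | add f g hf hg => rw [map_add, map_add]; exact Submodule.add_mem _ hf hg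
    | single ξ z => rw [weylSum_single, map_smul]; exact Submodule.smul_mem _ _ (hT ξ)
  exact denseRange_weylSum.induction_on (p := fun a => V a ∈ closure (V '' S)) a
    (isClosed_closure.preimage hV) hc

theorem dense_vec_image {D : Set H} (hD : Dense D) {S : Submodule ℂ (WeylAlgebra H)}
    (hS : ∀ ξ ∈ D, weyl ξ ∈ S) : Dense ((fockState H).vec '' S) := by
  refine dense_closure.mp ((fockState H).denseRange_vec.mono ?_)
  rintro _ ⟨a, rfl⟩
  exact map_mem_closure_image continuous_fockState_vec continuous_vec_weyl hD hS a

/-- A δ/3 argument: uniform contractivity and density of the span of the Weyl operators. -/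
theorem tendsto_of_tendsto_weyl {F : ℕ → WeylAlgebra H →ₗ[ℂ] ℂ} {G : WeylAlgebra H →ₗ[ℂ] ℂ}
    (hF : ∀ n a, ‖F n a‖ ≤ ‖a‖) (hG : ∀ a, ‖G a‖ ≤ ‖a‖)
    (h : ∀ ξ, Tendsto (fun n => F n (weyl ξ)) atTop (𝓝 (G (weyl ξ)))) (a : WeylAlgebra H) :
    Tendsto (fun n => F n a) atTop (𝓝 (G a)) := by
  have hc : ∀ c : H →₀ ℂ, Tendsto (fun n => F n (weylSum c)) atTop (𝓝 (G (weylSum c))) := by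
    intro c
    induction c using Finsupp.induction_linear with
    | zero => simp
    | add f g hf hg => simpa only [map_add] using hf.add hg
    | single ξ z => simpa only [weylSum_single, map_smul] using (h ξ).const_smul z
  rw [Metric.tendsto_atTop]
  intro δ hδ
  obtain ⟨_, ⟨c, rfl⟩, hac⟩ := Metric.mem_closure_iff.mp (denseRange_weylSum a) (δ / 3)
    (by positivity)
  obtain ⟨N, hN⟩ := Metric.tendsto_atTop.mp (hc c) (δ / 3) (by positivity)
  refine ⟨N, fun n hn => ?_⟩
  rw [dist_eq_norm] at hac ⊢
  have h1 := (hF n (a - weylSum c)).trans_lt hac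
  have h2 := (hG (a - weylSum c)).trans_lt hac
  have h3 := hN n hn
  rw [dist_eq_norm] at h3
  rw [map_sub] at h1 h2
  have h4 : F n a - G a = (F n a - F n (weylSum c)) + (F n (weylSum c) - G (weylSum c))
      - (G a - G (weylSum c)) := by ring
  rw [h4]
  refine (norm_sub_le _ _).trans_lt ?_
  have := norm_add_le (F n a - F n (weylSum c)) (F n (weylSum c) - G (weylSum c))
  linarith

theorem norm_fockState_comap_le {A : Type} [CStarAlgebra A] [PartialOrder A] [StarOrderedRing A]
    (φ : A →⋆ₐ[ℂ] WeylAlgebra H) (a : A) : ‖(fockState H).comap φ a‖ ≤ ‖a‖ :=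
  (norm_fockCLM_le _).trans (NonUnitalStarAlgHom.norm_apply_le φ a)

end FockContinuity

/-! ## Lattice Fourier analysis -/

section LatticeFourier

theorem halfSide_pos {ε : ℝ} {r : ℕ} (hε : 0 < ε) (hr : 0 < r) : 0 < halfSide ε r := by
  unfold halfSide; positivity

theorem spacing_pos {ε : ℝ} (hε : 0 < ε) (N : ℕ) : 0 < spacing ε N := by
  unfold spacing; positivity

theorem radius_pos {r : ℕ} (hr : 0 < r) (N : ℕ) : 0 < radius r N := by
  unfold radius; positivity

theorem radius_succ (r N : ℕ) : radius r (N + 1) = 2 * radius r N := by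
  unfold radius; ring

theorem radius_mono (r : ℕ) {N N' : ℕ} (h : N ≤ N') : radius r N ≤ radius r N' :=
  Nat.mul_le_mul_right r (Nat.pow_le_pow_right two_pos h)

theorem radius_lt {r : ℕ} (hr : 0 < r) {N N' : ℕ} (h : N < N') : radius r N < radius r N' :=
  Nat.mul_lt_mul_of_pos_right (Nat.pow_lt_pow_right one_lt_two h) hr

theorem pi_div_halfSide_mul_spacing {ε : ℝ} {r : ℕ} (hε : 0 < ε) (hr : 0 < r) (N : ℕ) :
    Real.pi / halfSide ε r * spacing ε N = Real.pi / radius r N := by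
  unfold halfSide spacing radius
  push_cast
  field_simp

theorem halfSide_eq (ε : ℝ) (r N : ℕ) : halfSide ε r = spacing ε N * radius r N := by
  unfold halfSide spacing radius
  push_cast
  field_simp

/-- A geometric sum over a full period, whose ratio is a 2R-th root of unity different from 1. -/
theorem sum_Ico_exp_eq_zero {R : ℕ} (hR : 0 < R) {a : ℤ} (ha : ¬ (2 * R : ℤ) ∣ a) :
    ∑ t ∈ Finset.Ico (-(R : ℤ)) R,
      Complex.exp (Complex.I * ((Real.pi / R * a * t : ℝ) : ℂ)) = 0 := by
  set z : ℂ := Complex.exp (Complex.I * ((Real.pi / R * a : ℝ) : ℂ)) with hz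
  have hpi : (Real.pi : ℂ) ≠ 0 := by exact_mod_cast Real.pi_ne_zero
  have hR' : (R : ℂ) ≠ 0 := by exact_mod_cast hR.ne'
  have hz1 : z ≠ 1 := by
    rw [hz, Ne, Complex.exp_eq_one_iff]
    rintro ⟨n, hn⟩
    refine ha ⟨n, ?_⟩
    have h1 : (a : ℂ) = 2 * R * n := by
      push_cast at hn
      field_simp at hn
      linear_combination hn
    exact_mod_cast h1
  have hz2 : z ^ (2 * R) = 1 := by
    rw [hz, ← Complex.exp_nat_mul, Complex.exp_eq_one_iff]
    refine ⟨a, ?_⟩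
    push_cast
    field_simp
  have hsum : ∑ t ∈ Finset.Ico (-(R : ℤ)) R,
      Complex.exp (Complex.I * ((Real.pi / R * a * t : ℝ) : ℂ))
      = ∑ n ∈ Finset.range (2 * R), Complex.exp (Complex.I * ((Real.pi / R * a * (-R) : ℝ) : ℂ))
        * z ^ n := by
    refine Finset.sum_bij' (fun t _ => (t + R).toNat) (fun n _ => (n : ℤ) - R) ?_ ?_ ?_ ?_ ?_
    · intro t ht; simp only [Finset.mem_Ico, Finset.mem_range] at *; omega
    · intro t ht; simp only [Finset.mem_Ico, Finset.mem_range] at *; omega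
    · intro t ht; simp only [Finset.mem_Ico] at *; omega
    · intro t ht; simp
    · intro t ht
      rw [hz, ← Complex.exp_nat_mul, ← Complex.exp_add]
      congr 1
      have h1 : (((t + R).toNat : ℤ) : ℂ) = t + R := by
        simp only [Finset.mem_Ico] at ht
        rw [Int.toNat_of_nonneg (by omega)]
        push_cast; ring
      rw [← Int.cast_natCast (R := ℂ) (t + R).toNat, h1]
      push_cast
      ring
  rw [hsum, ← Finset.mul_sum, geom_sum_eq hz1, hz2]
  simp

theorem wave_add {d : ℕ} (k l x : Fin d → ℝ) : wave (k + l) x = wave k x * wave l x := by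
  rw [wave, wave, wave, ← Complex.exp_add, ← mul_add, ← Complex.ofReal_add,
    ← Finset.sum_add_distrib]
  simp only [Pi.add_apply, add_mul]

theorem conj_wave {d : ℕ} (k x : Fin d → ℝ) : conj (wave k x) = wave (-k) x := by
  rw [wave, wave, ← Complex.exp_conj, map_mul, Complex.conj_I, Complex.conj_ofReal]
  simp

theorem momentum_sub {d : ℕ} (L : ℝ) (m n : Fin d → ℤ) :
    momentum L (m - n) = momentum L m - momentum L n := by
  ext j
  simp only [momentum, Pi.sub_apply]
  push_cast
  ring

theorem momentum_neg {d : ℕ} (L : ℝ) (n : Fin d → ℤ) : momentum L (-n) = -momentum L n := by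
  ext j
  simp [momentum]

theorem wave_momentum_mul_wave_neg {d : ℕ} (L : ℝ) (m n : Fin d → ℤ) (x : Fin d → ℝ) :
    wave (momentum L m) x * wave (-momentum L n) x = wave (momentum L (m - n)) x := by
  rw [momentum_sub, sub_eq_add_neg, wave_add]

variable {d r N : ℕ} {ε : ℝ}

theorem Idx.toInt_injective : Function.Injective (Idx.toInt (d := d) (r := r) (N := N)) := by
  intro k l h
  funext j
  exact Subtype.ext (congrFun h j)

theorem Idx.mem_range_toInt {n : Fin d → ℤ} : n ∈ Set.range (Idx.toInt (d := d) (r := r) (N := N))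
    ↔ ∀ j, -(radius r N : ℤ) ≤ n j ∧ n j < radius r N := by
  constructor
  · rintro ⟨k, rfl⟩ j
    exact Finset.mem_Ico.mp (k j).2
  · intro h
    exact ⟨fun j => ⟨n j, Finset.mem_Ico.mpr (h j)⟩, rfl⟩

theorem wave_site (hε : 0 < ε) (hr : 0 < r) (n : Fin d → ℤ) (x : Idx d r N) :
    wave (momentum (halfSide ε r) n) (site ε x)
      = ∏ j, Complex.exp (Complex.I * ((Real.pi / radius r N * n j * (x j : ℤ) : ℝ) : ℂ)) := by
  rw [wave, ← Complex.exp_sum, ← Finset.mul_sum, ← Complex.ofReal_sum]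
  congr 3
  refine Finset.sum_congr rfl fun j _ => ?_
  rw [← pi_div_halfSide_mul_spacing hε hr N]
  simp only [momentum, site, Idx.toInt]
  ring

/-- The exponent is (π / r_N) k · x in terms of the indices, hence symmetric. It reduces
orthogonality over Γ_N to orthogonality over Λ_N. -/
theorem wave_site_comm (hε : 0 < ε) (hr : 0 < r) (k x : Idx d r N) :
    wave (momentum (halfSide ε r) k.toInt) (site ε x)
      = wave (momentum (halfSide ε r) x.toInt) (site ε k) := by
  rw [wave_site hε hr, wave_site hε hr]
  refine Finset.prod_congr rfl fun j _ => ?_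
  simp only [Idx.toInt]
  rw [mul_right_comm]

theorem sum_wave_site (hε : 0 < ε) (hr : 0 < r) (k l : Idx d r N) :
    ∑ x : Idx d r N, wave (momentum (halfSide ε r) k.toInt) (site ε x)
        * wave (-momentum (halfSide ε r) l.toInt) (site ε x)
      = if k = l then (2 * (radius r N : ℂ)) ^ d else 0 := by
  have hR := radius_pos hr N
  simp only [wave_momentum_mul_wave_neg]
  simp only [wave_site hε hr]
  have h1 := Finset.prod_univ_sum (fun _ : Fin d =>
    (Finset.univ : Finset ↥(Finset.Ico (-(radius r N : ℤ)) (radius r N : ℤ))))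
    (fun j t => Complex.exp (Complex.I *
      ((Real.pi / radius r N * ((k.toInt - l.toInt) j : ℤ) * (t : ℤ) : ℝ) : ℂ)))
  rw [Fintype.piFinset_univ] at h1
  rw [← h1]
  have h2 : ∀ j, ∑ t : ↥(Finset.Ico (-(radius r N : ℤ)) (radius r N : ℤ)),
      Complex.exp (Complex.I *
        ((Real.pi / radius r N * ((k.toInt - l.toInt) j : ℤ) * (t : ℤ) : ℝ) : ℂ))
      = if k j = l j then 2 * (radius r N : ℂ) else 0 := by
    intro j
    rw [Finset.sum_coe_sort (Finset.Ico (-(radius r N : ℤ)) (radius r N : ℤ)) fun t =>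
      Complex.exp (Complex.I *
        ((Real.pi / radius r N * ((k.toInt - l.toInt) j : ℤ) * (t : ℤ) : ℝ) : ℂ))]
    split_ifs with h
    · have h3 : ((radius r N : ℤ) + radius r N).toNat = radius r N + radius r N := by omega
      simp [Idx.toInt, h, two_mul, h3]
    · refine sum_Ico_exp_eq_zero hR fun ⟨c, hc⟩ => h (Subtype.ext ?_)
      have hk := Finset.mem_Ico.mp (k j).2
      have hl := Finset.mem_Ico.mp (l j).2
      simp only [Pi.sub_apply, Idx.toInt] at hc
      -- Both indices lie in an interval of 2 r_N integers, so their difference is a multiple of 2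
      -- r_N only if it vanishes.
      have hc0 : c = 0 := by
        by_contra hc0
        rcases lt_or_gt_of_ne hc0 with h0 | h0 <;> nlinarith
      rw [hc0] at hc
      linarith
  simp only [h2]
  split_ifs with h
  · simp [h]
  · obtain ⟨j, hj⟩ := Function.ne_iff.mp h
    exact Finset.prod_eq_zero (Finset.mem_univ j) (if_neg hj)

theorem sum_wave_momentum (hε : 0 < ε) (hr : 0 < r) (x y : Idx d r N) :
    ∑ k : Idx d r N, wave (momentum (halfSide ε r) k.toInt) (site ε x)
        * wave (-momentum (halfSide ε r) k.toInt) (site ε y)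
      = if x = y then (2 * (radius r N : ℂ)) ^ d else 0 := by
  rw [← sum_wave_site hε hr x y]
  refine Finset.sum_congr rfl fun k _ => ?_
  rw [← conj_wave, ← conj_wave, wave_site_comm hε hr k x, wave_site_comm hε hr k y]

theorem spacing_rpow_mul_rpow_neg (hε : 0 < ε) (a : ℝ) :
    ((spacing ε N ^ a : ℝ) : ℂ) * ((spacing ε N ^ (-a) : ℝ) : ℂ) = 1 := by
  rw [← Complex.ofReal_mul, ← Real.rpow_add (spacing_pos hε N)]
  simp

theorem volume_ne_zero (hr : 0 < r) : (2 * (radius r N : ℂ)) ^ d ≠ 0 := by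
  have := (radius_pos hr N).ne'
  positivity

theorem latFourier_latFourierInv (hε : 0 < ε) (hr : 0 < r) (g : Idx d r N → ℂ) :
    latFourier ε (latFourierInv ε g) = g := by
  funext k
  have h1 : ∑ x : Idx d r N, (∑ l, g l * wave (momentum (halfSide ε r) l.toInt) (site ε x))
      * wave (-momentum (halfSide ε r) k.toInt) (site ε x) = g k * (2 * (radius r N : ℂ)) ^ d := by
    simp only [Finset.sum_mul]
    rw [Finset.sum_comm]
    simp only [mul_assoc, ← Finset.mul_sum, sum_wave_site hε hr]
    simp
  have h2 := spacing_rpow_mul_rpow_neg (N := N) hε ((d : ℝ) / 2)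
  have h3 := mul_inv_cancel₀ (volume_ne_zero (d := d) (N := N) hr)
  unfold latFourier latFourierInv
  simp only [mul_assoc] at h1 ⊢
  simp only [← Finset.mul_sum]
  rw [h1]
  linear_combination (g k * (2 * (radius r N : ℂ)) ^ d * ((2 * (radius r N : ℂ)) ^ d)⁻¹) * h2
    + g k * h3

theorem latFourierInv_latFourier (hε : 0 < ε) (hr : 0 < r) (f : Idx d r N → ℂ) :
    latFourierInv ε (latFourier ε f) = f := by
  funext x
  have h1 : ∑ k : Idx d r N, (∑ y, f y * wave (-momentum (halfSide ε r) k.toInt) (site ε y))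
      * wave (momentum (halfSide ε r) k.toInt) (site ε x) = f x * (2 * (radius r N : ℂ)) ^ d := by
    simp only [Finset.sum_mul]
    rw [Finset.sum_comm]
    simp only [mul_assoc, ← Finset.mul_sum, mul_comm (wave (-_) _), sum_wave_momentum hε hr]
    simp
  have h2 := spacing_rpow_mul_rpow_neg (N := N) hε ((d : ℝ) / 2)
  have h3 := mul_inv_cancel₀ (volume_ne_zero (d := d) (N := N) hr)
  unfold latFourier latFourierInv
  simp only [mul_assoc] at h1 ⊢
  simp only [← Finset.mul_sum]
  rw [h1]
  linear_combination (f x * (2 * (radius r N : ℂ)) ^ d * ((2 * (radius r N : ℂ)) ^ d)⁻¹) * h2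
    + f x * h3

theorem latFourier_parseval (hε : 0 < ε) (hr : 0 < r) (f g : Idx d r N → ℂ) :
    ((2 * (radius r N : ℂ)) ^ d)⁻¹ * ∑ k, conj (latFourier ε f k) * latFourier ε g k
      = ((spacing ε N ^ (d : ℝ) : ℝ) : ℂ) * ∑ x, conj (f x) * g x := by
  have h1 : ∑ x, conj (f x) * g x = ((spacing ε N ^ (-((d : ℝ) / 2)) : ℝ) : ℂ)
      * ((2 * (radius r N : ℂ)) ^ d)⁻¹ * ∑ k, conj (latFourier ε f k) *
        ∑ x, g x * wave (-momentum (halfSide ε r) k.toInt) (site ε x) := by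
    -- Only the first factor is expanded by the inversion formula; the sum over x then assembles the
    -- transform of g.
    conv_lhs => rw [← latFourierInv_latFourier hε hr f]
    unfold latFourierInv
    simp only [map_mul, map_sum, Complex.conj_ofReal, map_inv₀, map_pow, map_ofNat, map_natCast,
      conj_wave, Finset.mul_sum, Finset.sum_mul]
    rw [Finset.sum_comm]
    refine Finset.sum_congr rfl fun k _ => Finset.sum_congr rfl fun x _ => ?_
    ring
  have h2 : ∀ k, latFourier ε g k = ((spacing ε N ^ ((d : ℝ) / 2) : ℝ) : ℂ)
      * ∑ x, g x * wave (-momentum (halfSide ε r) k.toInt) (site ε x) := fun k => rfl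
  have h3 : ((spacing ε N ^ (d : ℝ) : ℝ) : ℂ) * ((spacing ε N ^ (-((d : ℝ) / 2)) : ℝ) : ℂ)
      = ((spacing ε N ^ ((d : ℝ) / 2) : ℝ) : ℂ) := by
    rw [← Complex.ofReal_mul, ← Real.rpow_add (spacing_pos hε N)]
    ring_nf
  rw [h1, ← mul_assoc, ← mul_assoc, h3]
  simp only [h2, Finset.mul_sum]
  refine Finset.sum_congr rfl fun k _ => Finset.sum_congr rfl fun x _ => ?_
  ring

theorem latFourier_add (f g : Idx d r N → ℂ) :
    latFourier ε (f + g) = latFourier ε f + latFourier ε g := by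
  funext k
  simp only [latFourier, Pi.add_apply, add_mul, Finset.sum_add_distrib, mul_add]

theorem qField_ofField (hε : 0 < ε) (f : Idx d r N → ℂ) (x : Idx d r N) :
    qField ε (ofField ε f) x = (f x).re := by
  have h := Real.rpow_add (spacing_pos hε N) (-(((d : ℝ) + 1) / 2)) (((d : ℝ) + 1) / 2)
  rw [neg_add_cancel, Real.rpow_zero] at h
  simp only [qField, ofField, Complex.add_re, Complex.ofReal_re, Complex.mul_re, Complex.I_re,
    Complex.I_im, Complex.ofReal_im]
  linear_combination -(f x).re * h

theorem pField_ofField (hε : 0 < ε) (f : Idx d r N → ℂ) (x : Idx d r N) :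
    pField ε (ofField ε f) x = (f x).im := by
  have h := Real.rpow_add (spacing_pos hε N) (-(((d : ℝ) - 1) / 2)) (((d : ℝ) - 1) / 2)
  rw [neg_add_cancel, Real.rpow_zero] at h
  simp only [pField, ofField, Complex.add_im, Complex.ofReal_re, Complex.mul_im, Complex.I_re,
    Complex.I_im, Complex.ofReal_im]
  linear_combination -(f x).im * h

theorem hatField_ofField_latFourierInv (hε : 0 < ε) (hr : 0 < r) (g : Idx d r N → ℂ) :
    hatField ε (ofField ε (latFourierInv ε g)) = g := by
  unfold hatField
  simp only [qField_ofField hε, pField_ofField hε, mul_comm Complex.I, Complex.re_add_im]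
  exact latFourier_latFourierInv hε hr g

theorem hatField_add (ξ η : LatSpace d r N) :
    hatField ε (ξ + η) = hatField ε ξ + hatField ε η := by
  unfold hatField
  rw [← latFourier_add]
  congr 1
  funext x
  simp only [qField, pField, PiLp.add_apply, Complex.add_re, Complex.add_im, Pi.add_apply]
  push_cast
  ring

theorem symp_eq_sum_hatField (hε : 0 < ε) (hr : 0 < r) (ξ η : LatSpace d r N) :
    symp ξ η = ((2 * (radius r N : ℝ)) ^ d)⁻¹
      * ∑ k, (conj (hatField ε ξ k) * hatField ε η k).im := by
  have h1 := congrArg Complex.im (latFourier_parseval hε hr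
    (fun x => (qField ε ξ x : ℂ) + Complex.I * (pField ε ξ x : ℂ))
    (fun x => (qField ε η x : ℂ) + Complex.I * (pField ε η x : ℂ)))
  have h2 : ((2 * (radius r N : ℂ)) ^ d)⁻¹ = ((((2 * (radius r N : ℝ)) ^ d)⁻¹ : ℝ) : ℂ) := by
    push_cast; rfl
  rw [h2, Complex.im_ofReal_mul, Complex.im_ofReal_mul, Complex.im_sum, Complex.im_sum] at h1
  refine Eq.trans ?_ h1.symm
  rw [symp, PiLp.inner_apply, Complex.im_sum, Finset.mul_sum]
  refine Finset.sum_congr rfl fun x _ => ?_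
  -- The exponents (d+1)/2 and (d-1)/2 add up to d, so the weight ε_N^d of Parseval cancels in the
  -- mixed terms q p, the only ones in the imaginary part.
  have hs : spacing ε N ^ (d : ℝ) * (spacing ε N ^ (-(((d : ℝ) + 1) / 2))
      * spacing ε N ^ (-(((d : ℝ) - 1) / 2))) = 1 := by
    rw [← Real.rpow_add (spacing_pos hε N), ← Real.rpow_add (spacing_pos hε N)]
    ring_nf
    exact Real.rpow_zero _
  simp only [qField, pField, RCLike.inner_apply, map_add, map_mul, Complex.conj_ofReal,
    Complex.conj_I, Complex.mul_im, Complex.mul_re, Complex.add_im, Complex.add_re,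
    Complex.ofReal_re, Complex.ofReal_im, Complex.I_re, Complex.I_im, Complex.conj_re,
    Complex.conj_im, Complex.neg_re, Complex.neg_im]
  linear_combination -((ξ x).re * (η x).im - (ξ x).im * (η x).re) * hs

end LatticeFourier

/-! ## Bogoliubov transformations -/

section Bogoliubov

variable {ι : Type} (τ : ι → ι) (γ : ι → ℝ)

/-- The Hermitian part `q` of `F = q + i p` with respect to the involution `τ`. -/
def hermPart (F : ι → ℂ) (k : ι) : ℂ := (F k + conj (F (τ k))) / 2

/-- The Hermitian function `p` in `F = q + i p`. -/
def antiPart (F : ι → ℂ) (k : ι) : ℂ := (F k - conj (F (τ k))) / (2 * Complex.I)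

/-- The function `γ^{-1/2} q + i γ^{1/2} p`, where `F = q + i p` with `q`, `p` Hermitian. -/
def bog (F : ι → ℂ) (k : ι) : ℂ :=
  ((γ k ^ (-(1 / 2) : ℝ) : ℝ) : ℂ) * hermPart τ F k
    + Complex.I * ((γ k ^ (1 / 2 : ℝ) : ℝ) : ℂ) * antiPart τ F k

theorem hermPart_add_antiPart (F : ι → ℂ) (k : ι) :
    hermPart τ F k + Complex.I * antiPart τ F k = F k := by
  unfold hermPart antiPart
  field_simp
  ring

theorem bog_add (F G : ι → ℂ) : bog τ γ (F + G) = bog τ γ F + bog τ γ G := by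
  funext k
  simp only [bog, hermPart, antiPart, Pi.add_apply, map_add]
  ring

theorem conj_hermPart {τ : ι → ι} (hτ : Function.Involutive τ) (F : ι → ℂ) (k : ι) :
    conj (hermPart τ F k) = hermPart τ F (τ k) := by
  simp only [hermPart, hτ k, map_div₀, map_add, Complex.conj_conj, map_ofNat]
  ring

theorem conj_antiPart {τ : ι → ι} (hτ : Function.Involutive τ) (F : ι → ℂ) (k : ι) :
    conj (antiPart τ F k) = antiPart τ F (τ k) := by
  simp only [antiPart, hτ k, map_div₀, map_sub, map_mul, Complex.conj_conj, map_ofNat,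
    Complex.conj_I]
  field_simp
  ring

variable {τ γ} {s : Finset ι}

/-- Reindexing the sum by τ changes its sign. -/
theorem sum_im_eq_zero (hτ : Function.Involutive τ) (hs : ∀ k ∈ s, τ k ∈ s) {h : ι → ℂ}
    (hh : ∀ k, h (τ k) = conj (h k)) : ∑ k ∈ s, (h k).im = 0 := by
  have h1 : ∑ k ∈ s, (h k).im = ∑ k ∈ s, (h (τ k)).im :=
    Finset.sum_nbij' τ τ hs hs (fun k _ => hτ k) (fun k _ => hτ k) fun k _ => by rw [hτ k]
  simp only [hh, Complex.conj_im, Finset.sum_neg_distrib] at h1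
  linarith

theorem rpow_half_mul_rpow_neg_half {x : ℝ} (hx : 0 < x) :
    x ^ (-(1 / 2) : ℝ) * x ^ (1 / 2 : ℝ) = 1 := by
  rw [← Real.rpow_add hx]
  simp

/-- The mixed terms in q and p carry the weight γ^{-1/2} γ^{1/2} = 1. The terms in q alone or p
alone change their weight, but they are Hermitian under τ, so the imaginary parts sum to zero before
and after. -/
theorem sum_im_conj_bog (hτ : Function.Involutive τ) (hs : ∀ k ∈ s, τ k ∈ s)
    (hγ : ∀ k, 0 < γ k) (hγτ : ∀ k, γ (τ k) = γ k) (F G : ι → ℂ) :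
    ∑ k ∈ s, (conj (bog τ γ F k) * bog τ γ G k).im = ∑ k ∈ s, (conj (F k) * G k).im := by
  set a : ι → ℝ := fun k => γ k ^ (-(1 / 2) : ℝ)
  set b : ι → ℝ := fun k => γ k ^ (1 / 2 : ℝ)
  have h0 := sum_im_eq_zero hτ hs (h := fun k =>
    ((a k ^ 2 - 1 : ℝ) : ℂ) * (conj (hermPart τ F k) * hermPart τ G k)
      + ((b k ^ 2 - 1 : ℝ) : ℂ) * (conj (antiPart τ F k) * antiPart τ G k)) fun k => by
    simp only [map_add, map_mul, Complex.conj_ofReal, conj_hermPart hτ, conj_antiPart hτ, hτ k,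
      a, b, hγτ k]
  rw [← sub_eq_zero, ← Finset.sum_sub_distrib, ← h0]
  refine Finset.sum_congr rfl fun k _ => ?_
  have hab : ((a k : ℝ) : ℂ) * ((b k : ℝ) : ℂ) = 1 := by
    rw [← Complex.ofReal_mul]
    exact congrArg Complex.ofReal (rpow_half_mul_rpow_neg_half (hγ k))
  have hb : ∀ F : ι → ℂ, bog τ γ F k
      = (a k : ℂ) * hermPart τ F k + Complex.I * (b k : ℂ) * antiPart τ F k := fun F => rfl
  rw [← Complex.sub_im, hb, hb]
  conv_lhs => rw [← hermPart_add_antiPart τ F k, ← hermPart_add_antiPart τ G k]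
  congr 1
  simp only [map_add, map_mul, Complex.conj_ofReal, Complex.conj_I]
  push_cast
  linear_combination (Complex.I * (conj (hermPart τ F k) * antiPart τ G k
    - conj (antiPart τ F k) * hermPart τ G k)) * hab
    - ((b k : ℂ) ^ 2 - 1) * conj (antiPart τ F k) * antiPart τ G k * Complex.I_sq

/-- The cross term is -2 Im(conj q · p), again with weight 1, and sums to zero by `sum_im_eq_zero`.
-/
theorem sum_norm_bog_sq (hτ : Function.Involutive τ) (hs : ∀ k ∈ s, τ k ∈ s)
    (hγ : ∀ k, 0 < γ k) (F : ι → ℂ) :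
    ∑ k ∈ s, ‖bog τ γ F k‖ ^ 2
      = ∑ k ∈ s, ‖((γ k ^ (-(1 / 2) : ℝ) : ℝ) : ℂ) * hermPart τ F k‖ ^ 2
        + ∑ k ∈ s, ‖((γ k ^ (1 / 2 : ℝ) : ℝ) : ℂ) * antiPart τ F k‖ ^ 2 := by
  have h0 := sum_im_eq_zero hτ hs (h := fun k => conj (hermPart τ F k) * antiPart τ F k)
    fun k => by simp only [map_mul, conj_hermPart hτ, conj_antiPart hτ, hτ k]
  rw [← Finset.sum_add_distrib, ← sub_eq_zero, ← Finset.sum_sub_distrib,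
    ← mul_eq_zero_of_right (-2) h0, Finset.mul_sum]
  refine Finset.sum_congr rfl fun k _ => ?_
  have hab := rpow_half_mul_rpow_neg_half (hγ k)
  simp only [bog, ← Complex.normSq_eq_norm_sq, Complex.normSq_apply, Complex.mul_re,
    Complex.mul_im, Complex.add_re, Complex.add_im, Complex.ofReal_re, Complex.ofReal_im,
    Complex.I_re, Complex.I_im, Complex.conj_re, Complex.conj_im]
  linear_combination (-2 * ((hermPart τ F k).re * (antiPart τ F k).im
    - (hermPart τ F k).im * (antiPart τ F k).re)) * hab

theorem bog_eq_zero {F : ι → ℂ} {k : ι} (h : F k = 0) (h' : F (τ k) = 0) : bog τ γ F k = 0 := by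
  simp [bog, hermPart, antiPart, h, h']

end Bogoliubov

/-! ## Mode coefficients and the lattice vacua -/

section Modes

variable {d r N : ℕ} {ε : ℝ}

/-- The factor `(2 r_N)^{-d/2}`. -/
def modeFactor (d r N : ℕ) : ℝ := (2 * (radius r N : ℝ)) ^ (-((d : ℝ) / 2))

theorem modeFactor_sq (hr : 0 < r) : modeFactor d r N ^ 2 = ((2 * (radius r N : ℝ)) ^ d)⁻¹ := by
  have := radius_pos hr N
  rw [modeFactor, ← Real.rpow_natCast, ← Real.rpow_mul (by positivity), ← Real.rpow_natCast _ d,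
    ← Real.rpow_neg (by positivity)]
  congr 1
  push_cast
  ring

theorem modeFactor_pos (hr : 0 < r) : 0 < modeFactor d r N := by
  have := radius_pos hr N
  unfold modeFactor
  positivity

theorem modeFactor_succ_mul :
    modeFactor d r (N + 1) * (2 : ℝ) ^ ((d : ℝ) / 2) = modeFactor d r N := by
  rw [modeFactor, modeFactor, radius_succ]
  push_cast
  rw [Real.mul_rpow (by positivity) (by positivity), mul_right_comm, ← Real.rpow_add two_pos]
  simp

/-- The coefficients `(2 r_N)^{-d/2} (q̂ + i p̂)`, extended by zero to the continuum momenta. -/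
def modeCoeff (ε : ℝ) (ξ : LatSpace d r N) (n : Fin d → ℤ) : ℂ :=
  (modeFactor d r N : ℂ) * Function.extend (Idx.toInt (d := d) (r := r) (N := N)) (hatField ε ξ) 0 n

theorem modeCoeff_toInt (ξ : LatSpace d r N) (k : Idx d r N) :
    modeCoeff ε ξ k.toInt = (modeFactor d r N : ℂ) * hatField ε ξ k := by
  rw [modeCoeff, Idx.toInt_injective.extend_apply]

theorem modeCoeff_eq_zero (ξ : LatSpace d r N) {n : Fin d → ℤ}
    (hn : n ∉ Set.range (Idx.toInt (d := d) (r := r) (N := N))) : modeCoeff ε ξ n = 0 := by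
  rw [modeCoeff, Function.extend_apply' _ _ _ hn, Pi.zero_apply, mul_zero]

theorem modeCoeff_add (ξ η : LatSpace d r N) :
    modeCoeff ε (ξ + η) = modeCoeff ε ξ + modeCoeff ε η := by
  funext n
  by_cases hn : n ∈ Set.range (Idx.toInt (d := d) (r := r) (N := N))
  · obtain ⟨k, rfl⟩ := hn
    rw [Pi.add_apply, modeCoeff_toInt, modeCoeff_toInt, modeCoeff_toInt, hatField_add,
      Pi.add_apply, mul_add]
  · rw [Pi.add_apply, modeCoeff_eq_zero _ hn, modeCoeff_eq_zero _ hn, modeCoeff_eq_zero _ hn,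
      add_zero]

theorem symp_eq_sum_modeCoeff (hε : 0 < ε) (hr : 0 < r) (ξ η : LatSpace d r N) :
    symp ξ η = ∑ k : Idx d r N, (conj (modeCoeff ε ξ k.toInt) * modeCoeff ε η k.toInt).im := by
  rw [symp_eq_sum_hatField hε hr, ← modeFactor_sq hr, Finset.mul_sum]
  refine Finset.sum_congr rfl fun k _ => ?_
  rw [modeCoeff_toInt, modeCoeff_toInt, map_mul, Complex.conj_ofReal, ← Complex.im_ofReal_mul]
  congr 1
  push_cast
  ring

/-- In these coordinates scaling is the identity, so all levels can be compared inside one space of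
functions on ℤ^d. -/
theorem modeCoeff_momScale (hε : 0 < ε) (hr : 0 < r) (ξ : LatSpace d r N) :
    modeCoeff ε (momScale ε ξ) = modeCoeff ε ξ := by
  funext n
  by_cases hn : n ∈ Set.range (Idx.toInt (d := d) (r := r) (N := N + 1))
  · obtain ⟨k, rfl⟩ := hn
    rw [modeCoeff_toInt, momScale, hatField_ofField_latFourierInv hε hr, modeCoeff, ← mul_assoc,
      ← Complex.ofReal_mul, modeFactor_succ_mul]
  · rw [modeCoeff_eq_zero _ hn, modeCoeff_eq_zero]
    rw [Idx.mem_range_toInt] at hn ⊢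
    have := radius_mono r (show N ≤ N + 1 from N.le_succ)
    exact fun h => hn fun j => by have := h j; omega

theorem modeCoeff_injective (hε : 0 < ε) (hr : 0 < r) :
    Function.Injective (modeCoeff (d := d) (r := r) (N := N) ε) := by
  intro ξ η h
  rw [← sub_eq_zero]
  refine eq_zero_of_symp_eq_zero fun ζ => ?_
  have h0 : modeCoeff ε (ξ - η) = 0 := by
    have h1 := modeCoeff_add (ε := ε) (ξ - η) η
    rw [sub_add_cancel, h] at h1
    exact left_eq_add.mp (h1.trans (add_comm _ _))
  rw [symp_eq_sum_modeCoeff hε hr, h0]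
  simp

theorem exists_modeCoeff_eq (hε : 0 < ε) (hr : 0 < r) {F : (Fin d → ℤ) → ℂ}
    (hF : ∀ n, F n ≠ 0 → n ∈ Set.range (Idx.toInt (d := d) (r := r) (N := N))) :
    ∃ ξ : LatSpace d r N, modeCoeff ε ξ = F := by
  refine ⟨ofField ε (latFourierInv ε fun k => (modeFactor d r N : ℂ)⁻¹ * F k.toInt), ?_⟩
  funext n
  by_cases hn : n ∈ Set.range (Idx.toInt (d := d) (r := r) (N := N))
  · obtain ⟨k, rfl⟩ := hn
    have h : (modeFactor d r N : ℂ) ≠ 0 := by exact_mod_cast (modeFactor_pos hr).ne'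
    rw [modeCoeff_toInt, hatField_ofField_latFourierInv hε hr, mul_inv_cancel_left₀ h]
  · rw [modeCoeff_eq_zero _ hn]
    by_contra h
    exact hn (hF n (Ne.symm h))

variable (d r N ε) in
/-- The indices of `Γ_N`. -/
def modeSet : Finset (Fin d → ℤ) :=
  Finset.univ.image (Idx.toInt (d := d) (r := r) (N := N))

theorem mem_modeSet {n : Fin d → ℤ} :
    n ∈ modeSet d r N ↔ ∀ j, -(radius r N : ℤ) ≤ n j ∧ n j < radius r N := by
  rw [← Idx.mem_range_toInt, modeSet, Finset.mem_image]
  simp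

theorem sum_toInt {M : Type} [AddCommMonoid M] (f : (Fin d → ℤ) → M) :
    ∑ k : Idx d r N, f k.toInt = ∑ n ∈ modeSet d r N, f n := by
  rw [modeSet, Finset.sum_image fun _ _ _ _ h => Idx.toInt_injective h]

/-- A finite symmetric set of momenta that contains `Γ_N`. -/
def symModeSet (d r N : ℕ) : Finset (Fin d → ℤ) :=
  Fintype.piFinset fun _ => Finset.Icc (-(radius r N : ℤ)) (radius r N)

theorem mem_symModeSet {n : Fin d → ℤ} :
    n ∈ symModeSet d r N ↔ ∀ j, -(radius r N : ℤ) ≤ n j ∧ n j ≤ radius r N := by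
  simp [symModeSet]

theorem neg_mem_symModeSet {n : Fin d → ℤ} (hn : n ∈ symModeSet d r N) :
    -n ∈ symModeSet d r N := by
  rw [mem_symModeSet] at hn ⊢
  intro j
  have := hn j
  simp only [Pi.neg_apply]
  omega

theorem modeSet_subset_symModeSet : modeSet d r N ⊆ symModeSet d r N := fun n hn => by
  rw [mem_modeSet] at hn
  rw [mem_symModeSet]
  exact fun j => ⟨(hn j).1, (hn j).2.le⟩

/-- Strict inequality matters when d > 0: the index r_N is missing from Γ_N but present in Γ_K. -/
theorem symModeSet_subset_modeSet (hr : 0 < r) {K : ℕ} (h : N < K) :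
    symModeSet d r N ⊆ modeSet d r K := fun n hn => by
  rw [mem_symModeSet] at hn
  rw [mem_modeSet]
  have := radius_lt hr h
  exact fun j => by have := hn j; omega

theorem modeCoeff_eq_zero_of_notMem (ξ : LatSpace d r N) {n : Fin d → ℤ}
    (hn : n ∉ symModeSet d r N) : modeCoeff ε ξ n = 0 := by
  refine modeCoeff_eq_zero ξ fun h => hn (modeSet_subset_symModeSet ?_)
  rwa [mem_modeSet, ← Idx.mem_range_toInt]

theorem bog_modeCoeff_eq_zero (γ : (Fin d → ℤ) → ℝ) (ξ : LatSpace d r N) {n : Fin d → ℤ}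
    (hn : n ∉ symModeSet d r N) : bog (fun n => -n) γ (modeCoeff ε ξ) n = 0 := by
  refine bog_eq_zero (modeCoeff_eq_zero_of_notMem ξ hn) (modeCoeff_eq_zero_of_notMem ξ ?_)
  exact fun h => hn (by simpa using neg_mem_symModeSet h)

theorem symp_eq_sum_symModeSet (hε : 0 < ε) (hr : 0 < r) (ξ η : LatSpace d r N) :
    symp ξ η = ∑ n ∈ symModeSet d r N, (conj (modeCoeff ε ξ n) * modeCoeff ε η n).im := by
  rw [symp_eq_sum_modeCoeff hε hr, sum_toInt fun n => (conj (modeCoeff ε ξ n) * modeCoeff ε η n).im]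
  refine Finset.sum_subset modeSet_subset_symModeSet fun n _ hn => ?_
  rw [mem_modeSet, ← Idx.mem_range_toInt] at hn
  rw [modeCoeff_eq_zero ξ hn]
  simp

/-- The momentum scaling map as an additive map. -/
def momScaleHom (hε : 0 < ε) (hr : 0 < r) : LatSpace d r N →+ LatSpace d r (N + 1) :=
  -- Additivity is checked on the mode coefficients, which scaling does not change.
  AddMonoidHom.mk' (momScale ε) fun ξ η => modeCoeff_injective hε hr (by
    rw [modeCoeff_add, modeCoeff_momScale hε hr, modeCoeff_momScale hε hr,
      modeCoeff_momScale hε hr, modeCoeff_add])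

theorem symp_momScaleHom (hε : 0 < ε) (hr : 0 < r) (ξ η : LatSpace d r N) :
    symp (momScaleHom hε hr ξ) (momScaleHom hε hr η) = symp ξ η := by
  have h : ∀ ξ : LatSpace d r N, modeCoeff ε (momScaleHom hε hr ξ) = modeCoeff ε ξ :=
    modeCoeff_momScale hε hr
  rw [symp_eq_sum_symModeSet hε hr ξ η, symp_eq_sum_modeCoeff hε hr,
    sum_toInt fun n => (conj (modeCoeff ε _ n) * modeCoeff ε _ n).im, h, h]
  refine (Finset.sum_subset (symModeSet_subset_modeSet hr N.lt_succ_self) fun n _ hn => ?_).symm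
  rw [modeCoeff_eq_zero_of_notMem ξ hn]
  simp

/-- The negative of a lattice momentum modulo `2 r_N`. -/
def Idx.negMod (k : Idx d r N) : Idx d r N := fun j =>
  if h : (k j : ℤ) = -(radius r N : ℤ) then k j
  else ⟨-(k j : ℤ), by have := Finset.mem_Ico.mp (k j).2; exact Finset.mem_Ico.mpr (by omega)⟩

theorem Idx.negMod_apply (k : Idx d r N) (j : Fin d) :
    (k.negMod j : ℤ) = if (k j : ℤ) = -(radius r N : ℤ) then (k j : ℤ) else -(k j : ℤ) := by
  unfold Idx.negMod
  split_ifs <;> rfl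

theorem Idx.negMod_involutive : Function.Involutive (Idx.negMod (d := d) (r := r) (N := N)) := by
  intro k
  funext j
  refine Subtype.ext ?_
  have := Finset.mem_Ico.mp (k j).2
  rw [Idx.negMod_apply, Idx.negMod_apply]
  split_ifs <;> omega

/-- Γ_N contains -r_N but not r_N, yet both give the same wave on the lattice since e^{iπx} =
e^{-iπx} for integers x. -/
theorem wave_negMod (hε : 0 < ε) (hr : 0 < r) (k x : Idx d r N) :
    wave (momentum (halfSide ε r) k.negMod.toInt) (site ε x)
      = wave (-momentum (halfSide ε r) k.toInt) (site ε x) := by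
  rw [← momentum_neg, wave_site hε hr, wave_site hε hr]
  refine Finset.prod_congr rfl fun j _ => ?_
  have hR : (radius r N : ℂ) ≠ 0 := by exact_mod_cast (radius_pos hr N).ne'
  simp only [Idx.toInt, Idx.negMod_apply, Pi.neg_apply]
  split_ifs with h
  · rw [h, Complex.exp_eq_exp_iff_exists_int]
    -- The exponents are -iπx and iπx, which differ by -x full turns.
    refine ⟨-(x j : ℤ), ?_⟩
    push_cast
    field_simp
    ring
  · rfl

theorem latFourier_conj (hε : 0 < ε) (hr : 0 < r) (f : Idx d r N → ℂ) (k : Idx d r N) :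
    conj (latFourier ε f k.negMod) = latFourier ε (fun x => conj (f x)) k := by
  unfold latFourier
  rw [map_mul, Complex.conj_ofReal, map_sum]
  congr 1
  refine Finset.sum_congr rfl fun x _ => ?_
  rw [map_mul, conj_wave, neg_neg, wave_negMod hε hr]

/-- Real fields have transforms that are Hermitian for `Idx.negMod`, so q̂ and p̂ are recovered from
the single function q̂ + i p̂. -/
theorem hermPart_hatField (hε : 0 < ε) (hr : 0 < r) (c : ℝ) (ξ : LatSpace d r N) (k : Idx d r N) :
    hermPart Idx.negMod (fun k => (c : ℂ) * hatField ε ξ k) k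
      = c * latFourier ε (fun x => (qField ε ξ x : ℂ)) k := by
  rw [hermPart, map_mul, Complex.conj_ofReal, hatField, latFourier_conj hε hr]
  simp only [latFourier, map_add, map_mul, Complex.conj_ofReal, Complex.conj_I]
  simp only [add_mul, Finset.sum_add_distrib, neg_mul, Finset.sum_neg_distrib]
  ring

theorem antiPart_hatField (hε : 0 < ε) (hr : 0 < r) (c : ℝ) (ξ : LatSpace d r N) (k : Idx d r N) :
    antiPart Idx.negMod (fun k => (c : ℂ) * hatField ε ξ k) k
      = c * latFourier ε (fun x => (pField ε ξ x : ℂ)) k := by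
  rw [antiPart, map_mul, Complex.conj_ofReal, hatField, latFourier_conj hε hr]
  simp only [latFourier, map_add, map_mul, Complex.conj_ofReal, Complex.conj_I]
  simp only [add_mul, Finset.sum_add_distrib, neg_mul, Finset.sum_neg_distrib, mul_assoc,
    ← Finset.mul_sum]
  field_simp
  ring

/-- The lattice dispersion relation at the momentum of index `n ∈ ℤ^d`. -/
def latDispersionAt (ε : ℝ) (r N : ℕ) (μ : ℝ) (n : Fin d → ℤ) : ℝ :=
  Real.sqrt ((spacing ε N ^ 2)⁻¹ * (μ ^ 2 - 2 * d)
    + 2 * (spacing ε N ^ 2)⁻¹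
      * ∑ j, (1 - Real.cos (spacing ε N * momentum (halfSide ε r) n j)))

theorem latDispersion_eq (μ : ℝ) (k : Idx d r N) :
    latDispersion ε μ k = latDispersionAt ε r N μ k.toInt := rfl

theorem latDispersionAt_pos (hε : 0 < ε) {μ : ℝ} (hμ : Real.sqrt (2 * d) < μ) (n : Fin d → ℤ) :
    0 < latDispersionAt ε r N μ n := by
  refine Real.sqrt_pos.mpr (add_pos_of_pos_of_nonneg (mul_pos ?_ ?_) (mul_nonneg ?_ ?_))
  · have := spacing_pos hε N; positivity
  · have := (Real.sqrt_lt' ((Real.sqrt_nonneg _).trans_lt hμ)).mp hμ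
    linarith
  · positivity
  · exact Finset.sum_nonneg fun j _ => sub_nonneg.mpr (Real.cos_le_one _)

theorem latDispersion_pos (hε : 0 < ε) {μ : ℝ} (hμ : Real.sqrt (2 * d) < μ) (k : Idx d r N) :
    0 < latDispersion ε μ k :=
  latDispersionAt_pos hε hμ k.toInt

theorem latDispersion_negMod (μ : ℝ) (k : Idx d r N) :
    latDispersion ε μ k.negMod = latDispersion ε μ k := by
  unfold latDispersion
  congr 3
  refine Finset.sum_congr rfl fun j _ => ?_
  simp only [momentum, Idx.toInt, Idx.negMod_apply]
  split_ifs
  · rfl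
  · push_cast
    rw [mul_neg, mul_neg, Real.cos_neg]

variable (d r N ε) in
/-- The symplectic map `(q, p) ↦ γ_μ^{-1/2} q̂ + i γ_μ^{1/2} p̂`. -/
def latBog (μ : ℝ) : LatSpace d r N →+ LatSpace d r N :=
  AddMonoidHom.mk' (fun ξ => WithLp.toLp 2
    (bog Idx.negMod (latDispersion ε μ) fun k : Idx d r N => modeCoeff ε ξ k.toInt)) fun ξ η => by
    have h : (fun k : Idx d r N => modeCoeff ε (ξ + η) k.toInt)
        = (fun k => modeCoeff ε ξ k.toInt) + fun k => modeCoeff ε η k.toInt := by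
      rw [modeCoeff_add]; rfl
    rw [h, bog_add, WithLp.toLp_add]

theorem latBog_apply (μ : ℝ) (ξ : LatSpace d r N) (k : Idx d r N) : latBog d r N ε μ ξ k
    = bog Idx.negMod (latDispersion ε μ) (fun k : Idx d r N => modeCoeff ε ξ k.toInt) k := rfl

theorem symp_latBog (hε : 0 < ε) (hr : 0 < r) {μ : ℝ} (hμ : Real.sqrt (2 * d) < μ)
    (ξ η : LatSpace d r N) : symp (latBog d r N ε μ ξ) (latBog d r N ε μ η) = symp ξ η := by
  rw [symp_eq_sum_modeCoeff hε hr ξ η, symp, PiLp.inner_apply, Complex.im_sum,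
    ← sum_im_conj_bog Idx.negMod_involutive (fun _ _ => Finset.mem_univ _)
      (latDispersion_pos hε hμ) (latDispersion_negMod μ)]
  refine Finset.sum_congr rfl fun k _ => ?_
  rw [RCLike.inner_apply, mul_comm]
  rfl

theorem exp_norm_latBog (hε : 0 < ε) (hr : 0 < r) {μ : ℝ} (hμ : Real.sqrt (2 * d) < μ)
    (ξ : LatSpace d r N) :
    Real.exp (-(1 / 4) * ‖latBog d r N ε μ ξ‖ ^ 2) = latVacuumValue ε μ ξ := by
  unfold latVacuumValue
  congr 2
  rw [EuclideanSpace.norm_sq_eq]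
  simp only [latBog_apply]
  rw [sum_norm_bog_sq Idx.negMod_involutive (fun _ _ => Finset.mem_univ _)
    (latDispersion_pos hε hμ)]
  simp only [modeCoeff_toInt, hermPart_hatField hε hr, antiPart_hatField hε hr]
  unfold dualNormSq
  rw [← modeFactor_sq hr, Finset.mul_sum, Finset.mul_sum]
  congr 1 <;> refine Finset.sum_congr rfl fun k _ => ?_ <;>
    rw [mul_left_comm, norm_mul, mul_pow, Complex.norm_real, Real.norm_eq_abs, sq_abs]

/-- A field from a coarser level has no modes on the boundary of Γ_K. Negation modulo 2 r_K may then
be replaced by negation in ℤ^d, and the sum runs over a set independent of K. -/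
theorem norm_latBog_sq (hr : 0 < r) {K : ℕ} (hK : N < K) (μ : ℝ)
    (ξ : LatSpace d r N) (η : LatSpace d r K) (h : modeCoeff ε η = modeCoeff ε ξ) :
    ‖latBog d r K ε μ η‖ ^ 2 = ∑ n ∈ symModeSet d r N,
      ‖bog (fun n => -n) (latDispersionAt ε r K μ) (modeCoeff ε ξ) n‖ ^ 2 := by
  have h1 : ∀ k : Idx d r K, latBog d r K ε μ η k
      = bog (fun n => -n) (latDispersionAt ε r K μ) (modeCoeff ε ξ) k.toInt := by
    intro k
    have h2 : modeCoeff ε ξ k.negMod.toInt = modeCoeff ε ξ (-k.toInt) := by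
      -- On this boundary the two negations differ, but both results have an entry of modulus r_K >
      -- r_N, where the mode coefficients vanish.
      by_cases hk : ∃ j, (k j : ℤ) = -(radius r K : ℤ)
      · obtain ⟨j, hj⟩ := hk
        have hlt := radius_lt hr hK
        rw [modeCoeff_eq_zero_of_notMem, modeCoeff_eq_zero_of_notMem] <;>
          rw [mem_symModeSet] <;> intro hm <;> have := hm j
        · simp only [Pi.neg_apply, Idx.toInt] at this
          omega
        · simp only [Idx.toInt, Idx.negMod_apply, if_pos hj] at this
          omega
      · congr 1
        funext j
        simp only [Pi.neg_apply, Idx.toInt, Idx.negMod_apply]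
        exact if_neg fun hj => hk ⟨j, hj⟩
    rw [latBog_apply, h]
    simp only [bog, hermPart, antiPart, h2, latDispersion_eq]
  rw [EuclideanSpace.norm_sq_eq]
  simp only [h1]
  rw [sum_toInt fun n => ‖bog (fun n => -n) (latDispersionAt ε r K μ) (modeCoeff ε ξ) n‖ ^ 2]
  refine (Finset.sum_subset (symModeSet_subset_modeSet hr hK) fun n _ hn => ?_).symm
  rw [bog_modeCoeff_eq_zero _ _ hn]
  simp

end Modes

/-! ## The continuum limit of the dispersion relation -/

section DispersionLimit

/-- The half-angle formula makes the expression the square of sin((s/2) p) / (s/2), a difference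
quotient at 0 with limit p. -/
theorem tendsto_two_mul_one_sub_cos {s : ℕ → ℝ} (hs : ∀ n, 0 < s n) (h0 : Tendsto s atTop (𝓝 0))
    (p : ℝ) :
    Tendsto (fun n => 2 * (s n ^ 2)⁻¹ * (1 - Real.cos (s n * p))) atTop (𝓝 (p ^ 2)) := by
  have h1 : HasDerivAt (fun t : ℝ => Real.sin (t * p)) p 0 := by
    simpa using (hasDerivAt_mul_const p (x := (0 : ℝ))).sin
  have h2 := h1.tendsto_slope_zero
  have h3 : Tendsto (fun n => s n / 2) atTop (𝓝[≠] 0) := by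
    refine tendsto_nhdsWithin_iff.mpr ⟨by simpa using h0.div_const 2, Eventually.of_forall fun n => ?_⟩
    exact (half_pos (hs n)).ne'
  refine ((h2.comp h3).pow 2).congr fun n => ?_
  have h4 : s n * p = 2 * (s n / 2 * p) := by ring
  have h5 := (hs n).ne'
  rw [h4, Real.cos_two_mul, Real.cos_sq']
  simp only [Function.comp, zero_add, zero_mul, Real.sin_zero, sub_zero, smul_eq_mul]
  field_simp
  ring

theorem tendsto_spacing (ε : ℝ) : Tendsto (spacing ε) atTop (𝓝 0) :=
  tendsto_const_nhds.div_atTop (tendsto_pow_atTop_atTop_of_one_lt one_lt_two)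

variable {d r : ℕ} {ε m : ℝ}

theorem dispersion_pos (hm : 0 < m) (k : Fin d → ℝ) : 0 < dispersion m k :=
  Real.sqrt_pos.mpr (by positivity)

theorem dispersion_neg (k : Fin d → ℝ) : dispersion m (-k) = dispersion m k := by
  simp [dispersion]

theorem tendsto_latDispersionAt (hε : 0 < ε) {μ : ℕ → ℝ}
    (hren : Tendsto (fun N => (spacing ε N ^ 2)⁻¹ * (μ N ^ 2 - 2 * d)) atTop (𝓝 (m ^ 2)))
    (n : Fin d → ℤ) : Tendsto (fun K => latDispersionAt ε r K (μ K) n) atTop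
      (𝓝 (dispersion m (momentum (halfSide ε r) n))) := by
  refine (Real.continuous_sqrt.tendsto _).comp ?_
  rw [add_comm]
  refine hren.add ?_
  simp only [Finset.mul_sum]
  exact tendsto_finsetSum _ fun j _ =>
    tendsto_two_mul_one_sub_cos (spacing_pos hε) (tendsto_spacing ε) _

theorem tendsto_bog {ι : Type} {τ : ι → ι} {γ : ℕ → ι → ℝ} {γ' : ι → ℝ} {k : ι} (F : ι → ℂ)
    (h : Tendsto (fun n => γ n k) atTop (𝓝 (γ' k))) (h0 : 0 < γ' k) :
    Tendsto (fun n => bog τ (γ n) F k) atTop (𝓝 (bog τ γ' F k)) := by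
  have h1 : ∀ a : ℝ, Tendsto (fun n => ((γ n k ^ a : ℝ) : ℂ)) atTop (𝓝 ((γ' k ^ a : ℝ) : ℂ)) :=
    fun a => (Complex.continuous_ofReal.tendsto _).comp (h.rpow_const (Or.inl h0.ne'))
  exact ((h1 _).mul_const _).add (((h1 _).const_mul _).mul_const _)

end DispersionLimit

/-! ### Inversion of the Bogoliubov transformation -/

section BogInverse

variable {ι : Type} {τ : ι → ι} {γ : ι → ℝ}

theorem bog_ofReal_mul (c : ℝ) (F : ι → ℂ) (k : ι) :
    bog τ γ (fun k => (c : ℂ) * F k) k = c * bog τ γ F k := by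
  simp only [bog, hermPart, antiPart, map_mul, Complex.conj_ofReal]
  ring

/-- On Hermitian and anti-Hermitian parts the transformation is multiplication by γ^{-1/2} and
γ^{1/2}; replacing γ by γ⁻¹ exchanges the two weights. -/
theorem bog_bog_inv (hτ : Function.Involutive τ) (hγ : ∀ k, 0 < γ k)
    (hγτ : ∀ k, γ (τ k) = γ k) (F : ι → ℂ) (k : ι) :
    bog τ γ (bog τ (fun k => (γ k)⁻¹) F) k = F k := by
  have h1 := rpow_half_mul_rpow_neg_half (hγ k)
  have h2 : ((γ k)⁻¹) ^ (-(1 / 2) : ℝ) = γ k ^ (1 / 2 : ℝ) := by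
    rw [Real.inv_rpow (hγ k).le, Real.rpow_neg (hγ k).le, inv_inv]
  have h3 : ((γ k)⁻¹) ^ (1 / 2 : ℝ) = γ k ^ (-(1 / 2) : ℝ) := by
    rw [Real.inv_rpow (hγ k).le, Real.rpow_neg (hγ k).le]
  have h4 : (((γ k ^ (-(1 / 2) : ℝ) : ℝ) : ℂ)) * ((γ k ^ (1 / 2 : ℝ) : ℝ) : ℂ) = 1 := by
    rw [← Complex.ofReal_mul, h1, Complex.ofReal_one]
  have h5 : hermPart τ (bog τ (fun k => (γ k)⁻¹) F) k
      = ((γ k ^ (1 / 2 : ℝ) : ℝ) : ℂ) * hermPart τ F k := by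
    rw [hermPart, bog, bog]
    simp only [map_add, map_mul, Complex.conj_ofReal, Complex.conj_I, conj_hermPart hτ,
      conj_antiPart hτ, hτ k, hγτ k, h2, h3]
    ring
  have h6 : antiPart τ (bog τ (fun k => (γ k)⁻¹) F) k
      = ((γ k ^ (-(1 / 2) : ℝ) : ℝ) : ℂ) * antiPart τ F k := by
    rw [antiPart, bog, bog]
    simp only [map_add, map_mul, Complex.conj_ofReal, Complex.conj_I, conj_hermPart hτ,
      conj_antiPart hτ, hτ k, hγτ k, h2, h3]
    field_simp
    ring
  rw [bog, h5, h6]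
  conv_rhs => rw [← hermPart_add_antiPart τ F k]
  linear_combination (hermPart τ F k + Complex.I * antiPart τ F k) * h4

end BogInverse

/-! ## Trigonometric polynomials on the torus -/

section Torus

variable {d : ℕ} {L : ℝ}

theorem contDiff_wave (k : Fin d → ℝ) : ContDiff ℝ (⊤ : ℕ∞) (wave k) := by
  have h1 : ContDiff ℝ (⊤ : ℕ∞) fun x : Fin d → ℝ => ∑ j, k j * x j :=
    ContDiff.sum fun j _ => contDiff_const.mul (contDiff_apply ℝ ℝ j)
  exact (contDiff_const.mul (Complex.ofRealCLM.contDiff.comp h1)).cexp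

theorem wave_periodic (hL : 0 < L) (m n : Fin d → ℤ) (x : Fin d → ℝ) :
    wave (momentum L m) (fun j => x j + 2 * L * (n j : ℝ)) = wave (momentum L m) x := by
  have hL' : (L : ℂ) ≠ 0 := by exact_mod_cast hL.ne'
  rw [wave, wave, Complex.exp_eq_exp_iff_exists_int]
  refine ⟨∑ j, m j * n j, ?_⟩
  push_cast
  rw [Finset.sum_mul, Finset.mul_sum, Finset.mul_sum, ← Finset.sum_add_distrib]
  refine Finset.sum_congr rfl fun j _ => ?_
  simp only [momentum]
  push_cast
  field_simp

theorem setIntegral_exp (hL : 0 < L) (a : ℤ) :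
    ∫ x in Set.Ico (-L) L, Complex.exp (Complex.I * ((Real.pi / L * a * x : ℝ) : ℂ))
      = if a = 0 then 2 * (L : ℂ) else 0 := by
  have hL' : (L : ℂ) ≠ 0 := by exact_mod_cast hL.ne'
  have hpi : (Real.pi : ℂ) ≠ 0 := by exact_mod_cast Real.pi_ne_zero
  rw [integral_Ico_eq_integral_Ioc, ← intervalIntegral.integral_of_le (by linarith)]
  split_ifs with h
  · subst h
    simp only [Int.cast_zero, mul_zero, zero_mul, Complex.ofReal_zero, Complex.exp_zero]
    rw [intervalIntegral.integral_const]
    simp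
    ring
  · have ha : (a : ℂ) ≠ 0 := by exact_mod_cast h
    have hc : Complex.I * (Real.pi / L * a) ≠ 0 := by
      simp [hL', hpi, ha]
    have h1 : ∀ x : ℝ, Complex.exp (Complex.I * ((Real.pi / L * a * x : ℝ) : ℂ))
        = Complex.exp (Complex.I * (Real.pi / L * a) * x) := fun x => by
      push_cast; ring_nf
    simp only [h1]
    rw [integral_exp_mul_complex hc]
    have h2 : Complex.exp (Complex.I * (Real.pi / L * a) * L)
        = Complex.exp (Complex.I * (Real.pi / L * a) * ((-L : ℝ) : ℂ)) := by
      rw [Complex.exp_eq_exp_iff_exists_int]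
      refine ⟨a, ?_⟩
      push_cast
      field_simp
      ring
    rw [h2, sub_self, zero_div]

theorem setIntegral_wave (hL : 0 < L) (n : Fin d → ℤ) :
    ∫ x in Set.pi Set.univ (fun _ : Fin d => Set.Ico (-L) L), wave (momentum L n) x
      = if n = 0 then (((2 * L) ^ d : ℝ) : ℂ) else 0 := by
  have h1 : ∀ x : Fin d → ℝ, wave (momentum L n) x
      = ∏ j, Complex.exp (Complex.I * ((Real.pi / L * n j * x j : ℝ) : ℂ)) := fun x => by
    rw [wave, ← Complex.exp_sum, ← Finset.mul_sum, ← Complex.ofReal_sum]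
    rfl
  simp only [h1]
  rw [volume_pi, Measure.restrict_pi_pi, integral_fintype_prod_eq_prod
    (f := fun j (x : ℝ) => Complex.exp (Complex.I * ((Real.pi / L * n j * x : ℝ) : ℂ)))]
  simp only [setIntegral_exp hL]
  split_ifs with h
  · simp [h]
  · obtain ⟨j, hj⟩ := Function.ne_iff.mp h
    exact Finset.prod_eq_zero (Finset.mem_univ j) (if_neg hj)

/-- The trigonometric polynomial `∑_{n ∈ s} a(n) e^{i (π/L) n·y}`. -/
def trigPoly (L : ℝ) (s : Finset (Fin d → ℤ)) (a : (Fin d → ℤ) → ℂ) (y : Fin d → ℝ) : ℂ :=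
  ∑ n ∈ s, a n * wave (momentum L n) y

theorem isSmoothOnTorus_trigPoly (hL : 0 < L) (s : Finset (Fin d → ℤ)) (a : (Fin d → ℤ) → ℂ) :
    IsSmoothOnTorus L (trigPoly L s a) where
  smooth := ContDiff.sum fun n _ => contDiff_const.mul (contDiff_wave _)
  periodic x n := by simp only [trigPoly, wave_periodic hL]

theorem torusFourier_trigPoly (hL : 0 < L) (s : Finset (Fin d → ℤ)) (a : (Fin d → ℤ) → ℂ)
    (m : Fin d → ℤ) :
    torusFourier L (trigPoly L s a) (momentum L m)
      = if m ∈ s then (((2 * L) ^ d : ℝ) : ℂ) * a m else 0 := by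
  unfold torusFourier trigPoly
  simp only [Finset.sum_mul, mul_assoc, wave_momentum_mul_wave_neg]
  rw [integral_finsetSum]
  · simp only [integral_const_mul, setIntegral_wave hL, sub_eq_zero]
    simp [mul_comm]
  · intro n _
    have h1 : IntegrableOn (wave (momentum L (n - m))) (Set.Icc (fun _ : Fin d => -L) fun _ => L) :=
      (contDiff_wave _).continuous.integrableOn_Icc
    refine (h1.mono_set fun x hx => ?_).const_mul (a n)
    rw [Set.mem_univ_pi] at hx
    exact ⟨fun j => (hx j).1, fun j => (hx j).2.le⟩

/-- Conjugation reflects the frequencies, hence the demand that s be symmetric. -/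
theorem conj_trigPoly {s : Finset (Fin d → ℤ)} (hs : ∀ n ∈ s, -n ∈ s) (a : (Fin d → ℤ) → ℂ)
    (y : Fin d → ℝ) : conj (trigPoly L s a y) = trigPoly L s (fun n => conj (a (-n))) y := by
  unfold trigPoly
  rw [map_sum]
  refine Finset.sum_nbij' (fun n => -n) (fun n => -n) hs hs (fun n _ => neg_neg n)
    (fun n _ => neg_neg n) fun n _ => ?_
  simp only [map_mul, conj_wave, neg_neg, momentum_neg]

theorem re_trigPoly {s : Finset (Fin d → ℤ)} (hs : ∀ n ∈ s, -n ∈ s) (a : (Fin d → ℤ) → ℂ) :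
    (fun y => ((trigPoly L s a y).re : ℂ)) = trigPoly L s (hermPart (fun n => -n) a) := by
  funext y
  rw [Complex.re_eq_add_conj, conj_trigPoly hs]
  unfold trigPoly hermPart
  rw [← Finset.sum_add_distrib, Finset.sum_div]
  refine Finset.sum_congr rfl fun n _ => ?_
  ring

theorem im_trigPoly {s : Finset (Fin d → ℤ)} (hs : ∀ n ∈ s, -n ∈ s) (a : (Fin d → ℤ) → ℂ) :
    (fun y => ((trigPoly L s a y).im : ℂ)) = trigPoly L s (antiPart (fun n => -n) a) := by
  funext y
  rw [Complex.im_eq_sub_conj, conj_trigPoly hs]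
  unfold trigPoly antiPart
  rw [← Finset.sum_sub_distrib, Finset.sum_div]
  refine Finset.sum_congr rfl fun n _ => ?_
  ring

/-- Real and imaginary parts of the polynomial have as coefficients the two Hermitian components of
a. The power of 2L is the volume (2L)^d times the normalization (2L)^{-d/2}. -/
theorem oneParticleCoeff_trigPoly (hL : 0 < L) (m : ℝ) {s : Finset (Fin d → ℤ)}
    (hs : ∀ n ∈ s, -n ∈ s) {a : (Fin d → ℤ) → ℂ} (ha : ∀ n ∉ s, a n = 0) (n : Fin d → ℤ) :
    oneParticleCoeff L m (trigPoly L s a) n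
      = (((2 * L) ^ ((d : ℝ) / 2) : ℝ) : ℂ)
        * bog (fun n => -n) (fun n => dispersion m (momentum L n)) a n := by
  have h0 : n ∉ s → hermPart (fun n => -n) a n = 0 ∧ antiPart (fun n => -n) a n = 0 := fun hn => by
    have h1 := ha n hn
    have h2 := ha (-n) fun h => hn (by simpa using hs _ h)
    simp [hermPart, antiPart, h1, h2]
  have h1 : (((2 * L) ^ (-((d : ℝ) / 2)) : ℝ) : ℂ) * (((2 * L) ^ d : ℝ) : ℂ)
      = (((2 * L) ^ ((d : ℝ) / 2) : ℝ) : ℂ) := by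
    rw [← Complex.ofReal_mul, ← Real.rpow_natCast, ← Real.rpow_add (by positivity)]
    ring_nf
  rw [oneParticleCoeff, re_trigPoly hs, im_trigPoly hs, torusFourier_trigPoly hL,
    torusFourier_trigPoly hL, ← h1]
  split_ifs with hn
  · rw [bog]; ring
  · rw [bog, (h0 hn).1, (h0 hn).2]; ring

end Torus

/-! ## The embedding of the lattice fields in the continuum -/

section Embedding

variable {d r N : ℕ} {ε m : ℝ}

/-- Since 2L = ε_N · 2 r_N, this converts the lattice normalization of `toTorus` into that of
`modeCoeff`. -/
theorem two_mul_halfSide_rpow (hε : 0 < ε) (hr : 0 < r) :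
    ((2 * halfSide ε r) ^ d)⁻¹ * spacing ε N ^ ((d : ℝ) / 2)
      = (2 * halfSide ε r) ^ (-((d : ℝ) / 2)) * modeFactor d r N := by
  have h1 := spacing_pos hε N
  have h2 := radius_pos hr N
  have h3 : 2 * halfSide ε r = spacing ε N * (2 * radius r N) := by rw [halfSide_eq ε r N]; ring
  have h4 : ((2 * halfSide ε r) ^ d)⁻¹
      = (2 * halfSide ε r) ^ (-((d : ℝ) / 2)) * (2 * halfSide ε r) ^ (-((d : ℝ) / 2)) := by
    have := halfSide_pos hε hr
    rw [← Real.rpow_add (by positivity), ← Real.rpow_natCast, ← Real.rpow_neg (by positivity)]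
    ring_nf
  have h5 : spacing ε N ^ (-((d : ℝ) / 2)) * spacing ε N ^ ((d : ℝ) / 2) = 1 := by
    rw [← Real.rpow_add h1]; simp
  rw [h4, mul_assoc]
  congr 1
  rw [h3, Real.mul_rpow h1.le (by positivity), mul_right_comm, h5, one_mul, modeFactor]

/-- Γ_N is enlarged to a symmetric set, at the cost of zero coefficients, so that real and imaginary
parts can be taken. -/
theorem toTorus_eq_trigPoly (hε : 0 < ε) (hr : 0 < r) (ξ : LatSpace d r N) :
    toTorus ε ξ = trigPoly (halfSide ε r) (symModeSet d r N) fun n =>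
      (((2 * halfSide ε r) ^ (-((d : ℝ) / 2)) : ℝ) : ℂ) * modeCoeff ε ξ n := by
  funext y
  unfold toTorus trigPoly
  rw [← Finset.sum_subset modeSet_subset_symModeSet fun n _ hn => by
    rw [mem_modeSet, ← Idx.mem_range_toInt] at hn
    simp only [modeCoeff_eq_zero ξ hn, mul_zero, zero_mul],
    ← sum_toInt fun n => _ * modeCoeff ε ξ n * wave (momentum (halfSide ε r) n) y, Finset.mul_sum]
  refine Finset.sum_congr rfl fun k _ => ?_
  rw [modeCoeff_toInt, ← mul_assoc, ← mul_assoc, ← mul_assoc, ← Complex.ofReal_inv,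
    ← Complex.ofReal_mul, ← Complex.ofReal_mul, two_mul_halfSide_rpow hε hr]

/-- The momentum space dispersion relation of the continuum. -/
def contDispersion (ε : ℝ) (r : ℕ) (m : ℝ) (n : Fin d → ℤ) : ℝ :=
  dispersion m (momentum (halfSide ε r) n)

theorem contDispersion_neg (n : Fin d → ℤ) :
    contDispersion ε r m (-n) = contDispersion ε r m n := by
  rw [contDispersion, momentum_neg, dispersion_neg]; rfl

theorem oneParticleCoeff_toTorus (hε : 0 < ε) (hr : 0 < r) (ξ : LatSpace d r N) (n : Fin d → ℤ) :
    oneParticleCoeff (halfSide ε r) m (toTorus ε ξ) n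
      = bog (fun n => -n) (contDispersion ε r m) (modeCoeff ε ξ) n := by
  have hL := halfSide_pos hε hr
  rw [toTorus_eq_trigPoly hε hr, oneParticleCoeff_trigPoly hL m fun n hn => neg_mem_symModeSet hn]
  · rw [bog_ofReal_mul, ← mul_assoc, ← Complex.ofReal_mul, ← Real.rpow_add (by positivity),
      add_neg_cancel, Real.rpow_zero, Complex.ofReal_one, one_mul]
    rfl
  · intro n hn
    rw [modeCoeff_eq_zero_of_notMem ξ hn, mul_zero]

theorem memℓp_of_eq_zero {X : Type} {f : X → ℂ} (s : Finset X) (h : ∀ x ∉ s, f x = 0) :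
    Memℓp f 2 :=
  EllTwo.memℓp_of_summable (summable_of_ne_finset_zero (s := s) fun x hx => by simp [h x hx])

/-- The family of coefficients of `ι_L^{(N)}(ξ)`. -/
def embCoeff (ε m : ℝ) (ξ : LatSpace d r N) : EllTwo (Fin d → ℤ) :=
  ⟨bog (fun n => -n) (contDispersion ε r m) (modeCoeff ε ξ),
    memℓp_of_eq_zero (symModeSet d r N) fun _ hn => bog_modeCoeff_eq_zero _ ξ hn⟩

theorem embCoeff_apply (ξ : LatSpace d r N) (n : Fin d → ℤ) :
    embCoeff ε m ξ n = bog (fun n => -n) (contDispersion ε r m) (modeCoeff ε ξ) n := rfl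

theorem embCoeff_mem (hε : 0 < ε) (hr : 0 < r) (ξ : LatSpace d r N) :
    embCoeff ε m ξ ∈ contSubmodule d (halfSide ε r) m := by
  refine Submodule.le_topologicalClosure _ (Submodule.subset_span ⟨toTorus ε ξ, ?_, fun n => ?_⟩)
  · rw [toTorus_eq_trigPoly hε hr]
    exact isSmoothOnTorus_trigPoly (halfSide_pos hε hr) _ _
  · rw [oneParticleCoeff_toTorus hε hr]; rfl

/-- The embedding `ι_L^{(N)}` of the lattice one-particle space. -/
def contEmb (m : ℝ) (hε : 0 < ε) (hr : 0 < r) :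
    LatSpace d r N →+ ContSpace d (halfSide ε r) m :=
  AddMonoidHom.mk' (fun ξ => ⟨embCoeff ε m ξ, embCoeff_mem hε hr ξ⟩) fun ξ η => by
    refine Subtype.ext ?_
    ext n
    change embCoeff ε m (ξ + η) n = embCoeff ε m ξ n + embCoeff ε m η n
    rw [embCoeff_apply, modeCoeff_add, bog_add]
    rfl

theorem coeff_contEmb (hε : 0 < ε) (hr : 0 < r) (ξ : LatSpace d r N) (n : Fin d → ℤ) :
    (contEmb m hε hr ξ).coeff n
      = bog (fun n => -n) (contDispersion ε r m) (modeCoeff ε ξ) n := rfl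

theorem isClassOf_contEmb (hε : 0 < ε) (hr : 0 < r) (ξ : LatSpace d r N) :
    IsClassOf (contEmb m hε hr ξ) (toTorus ε ξ) := fun n => by
  rw [coeff_contEmb, oneParticleCoeff_toTorus hε hr]

theorem contEmb_momScaleHom (hε : 0 < ε) (hr : 0 < r) (ξ : LatSpace d r N) :
    contEmb m hε hr (momScaleHom hε hr ξ) = contEmb m hε hr ξ := by
  refine Subtype.ext ?_
  ext n
  change bog _ _ (modeCoeff ε (momScale ε ξ)) n = bog _ _ (modeCoeff ε ξ) n
  rw [modeCoeff_momScale hε hr]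

theorem symp_contEmb (hε : 0 < ε) (hr : 0 < r) (hm : 0 < m) (ξ η : LatSpace d r N) :
    symp (contEmb m hε hr ξ) (contEmb m hε hr η) = symp ξ η := by
  have h1 : symp (contEmb m hε hr ξ) (contEmb m hε hr η)
      = (inner ℂ (embCoeff ε m ξ) (embCoeff ε m η)).im := rfl
  rw [symp_eq_sum_symModeSet hε hr, h1, lp.inner_eq_tsum, tsum_eq_sum (s := symModeSet d r N)
    fun n hn => by rw [embCoeff_apply, bog_modeCoeff_eq_zero _ ξ hn, inner_zero_left],
    Complex.im_sum, ← sum_im_conj_bog (γ := contDispersion ε r m) neg_involutive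
      (fun n hn => neg_mem_symModeSet hn) (fun n => dispersion_pos hm _) contDispersion_neg]
  refine Finset.sum_congr rfl fun n _ => ?_
  rw [RCLike.inner_apply, mul_comm]
  rfl

theorem norm_contEmb_sq (hε : 0 < ε) (hr : 0 < r) (ξ : LatSpace d r N) :
    ‖contEmb m hε hr ξ‖ ^ 2 = ∑ n ∈ symModeSet d r N,
      ‖bog (fun n => -n) (contDispersion ε r m) (modeCoeff ε ξ) n‖ ^ 2 := by
  have h1 : ‖contEmb m hε hr ξ‖ = ‖embCoeff ε m ξ‖ := rfl
  rw [h1]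
  refine (EllTwo.hasSum_norm_sq (embCoeff ε m ξ)).unique ?_
  refine hasSum_sum_of_ne_finset_zero fun n hn => ?_
  rw [embCoeff_apply, bog_modeCoeff_eq_zero _ ξ hn]
  simp

theorem exists_subset_modeSet (hr : 0 < r) (s : Finset (Fin d → ℤ)) :
    ∃ N, s ⊆ modeSet d r N := by
  obtain ⟨B, hB⟩ : ∃ B : ℕ, ∀ n ∈ s, ∀ j, (n j).natAbs ≤ B := by
    refine ⟨s.sup fun n => Finset.univ.sup fun j => (n j).natAbs, fun n hn j => ?_⟩
    exact (Finset.le_sup (f := fun j => (n j).natAbs) (Finset.mem_univ j)).trans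
      (Finset.le_sup (f := fun n : Fin d → ℤ => Finset.univ.sup fun j => (n j).natAbs) hn)
  refine ⟨B, fun n hn => mem_modeSet.mpr fun j => ?_⟩
  -- The bound itself serves as the level, as B < 2^B ≤ r_B.
  have h1 : B < radius r B := B.lt_two_pow_self.trans_le (Nat.le_mul_of_pos_right _ hr)
  have h2 := hB n hn j
  omega

theorem exists_contEmb_coeff_eq (hε : 0 < ε) (hr : 0 < r) (hm : 0 < m) {ψ : (Fin d → ℤ) → ℂ}
    (hψ : (Function.support ψ).Finite) :
    ∃ (N : ℕ) (ξ : LatSpace d r N), ∀ n, (contEmb m hε hr ξ).coeff n = ψ n := by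
  set F : (Fin d → ℤ) → ℂ := bog (fun n => -n) (fun n => (contDispersion ε r m n)⁻¹) ψ with hF
  -- The inverse transformation couples n and -n, so Γ_N has to contain the reflected support as
  -- well.
  obtain ⟨N, hN⟩ := exists_subset_modeSet hr (hψ.toFinset ∪ hψ.toFinset.image fun n => -n)
  obtain ⟨ξ, hξ⟩ := exists_modeCoeff_eq (N := N) hε hr (F := F) fun n hn => by
    rw [Idx.mem_range_toInt, ← mem_modeSet]
    refine hN ?_
    by_contra h
    rw [Finset.mem_union, Finset.mem_image, not_or] at h
    refine hn (bog_eq_zero ?_ ?_)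
    · simpa using h.1
    · by_contra h2
      exact h.2 ⟨-n, by simpa using h2, neg_neg n⟩
  refine ⟨N, ξ, fun n => ?_⟩
  rw [coeff_contEmb, hξ, hF]
  exact bog_bog_inv neg_involutive (fun n => dispersion_pos hm _) contDispersion_neg ψ n

/-- Every basis vector comes from a trigonometric polynomial, so 𝔥_L is the whole of ℓ²(ℤ^d) and
contains the finite truncations of its elements. -/
theorem contSubmodule_eq_top (hε : 0 < ε) (hr : 0 < r) (hm : 0 < m) :
    contSubmodule d (halfSide ε r) m = ⊤ := by
  classical
  refine eq_top_iff.mpr fun ψ _ => ?_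
  have hs := lp.hasSum_single (p := 2) (by norm_num) ψ
  refine (Submodule.isClosed_topologicalClosure _).mem_of_tendsto hs
    (Eventually.of_forall fun s => Submodule.sum_mem _ fun n _ => ?_)
  obtain ⟨N, ξ, hξ⟩ := exists_contEmb_coeff_eq (m := m) hε hr hm
    (ψ := (lp.single 2 n (ψ n) : EllTwo (Fin d → ℤ)))
    ((Set.finite_singleton n).subset fun k hk => by
      by_contra h
      exact hk (lp.single_apply_ne _ _ _ h))
  have h1 : lp.single 2 n (ψ n) = embCoeff ε m ξ := by
    ext k
    exact (hξ k).symm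
  rw [h1]
  exact embCoeff_mem hε hr ξ

theorem dense_finite_support (hε : 0 < ε) (hr : 0 < r) (hm : 0 < m) :
    Dense {ζ : ContSpace d (halfSide ε r) m | (Function.support ζ.coeff).Finite} := by
  classical
  intro ζ
  have hs := lp.hasSum_single (p := 2) (by norm_num) ζ.1
  have hmem : ∀ ψ : EllTwo (Fin d → ℤ), ψ ∈ contSubmodule d (halfSide ε r) m := fun ψ => by
    rw [contSubmodule_eq_top hε hr hm]; trivial
  refine mem_closure_of_tendsto (f := fun s : Finset (Fin d → ℤ) =>
    (⟨∑ n ∈ s, lp.single 2 n (ζ.1 n), hmem _⟩ : ContSpace d (halfSide ε r) m))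
    (b := atTop) (tendsto_subtype_rng.mpr hs) (Eventually.of_forall fun s => ?_)
  refine s.finite_toSet.subset fun k hk => ?_
  by_contra h
  refine hk ?_
  change (∑ n ∈ s, lp.single 2 n (ζ.1 n) : EllTwo (Fin d → ℤ)) k = 0
  rw [lp.coeFn_sum, Finset.sum_apply]
  refine Finset.sum_eq_zero fun n hn => lp.single_apply_ne _ _ _ fun hkn => h ?_
  rw [hkn]
  exact hn

end Embedding

/-! ## Weyl generators -/

section Generators

variable {H : Type} [NormedAddCommGroup H] [InnerProductSpace ℂ H]

theorem weylAlgebra_induction {S : Submodule ℂ (WeylAlgebra H)}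
    (hS : IsClosed (S : Set (WeylAlgebra H))) (h : ∀ ξ, weyl ξ ∈ S) (a : WeylAlgebra H) :
    a ∈ S := by
  refine denseRange_weylSum.induction_on (p := fun a => a ∈ S) a hS fun c => ?_
  induction c using Finsupp.induction_linear with
  | zero => rw [map_zero]; exact S.zero_mem
  | add f g hf hg => rw [map_add]; exact S.add_mem hf hg
  | single ξ z => rw [weylSum_single]; exact S.smul_mem z (h ξ)

theorem starAlgHom_eq_of_weyl {B : Type} [CStarAlgebra B] {φ ψ : WeylAlgebra H →⋆ₐ[ℂ] B}
    (h : ∀ ξ, φ (weyl ξ) = ψ (weyl ξ)) (a : WeylAlgebra H) : φ a = ψ a := by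
  have hφ : Continuous φ := AddMonoidHomClass.continuous_of_bound φ 1 fun a => by
    rw [one_mul]; exact NonUnitalStarAlgHom.norm_apply_le φ a
  have hψ : Continuous ψ := AddMonoidHomClass.continuous_of_bound ψ 1 fun a => by
    rw [one_mul]; exact NonUnitalStarAlgHom.norm_apply_le ψ a
  exact weylAlgebra_induction
    (S := LinearMap.eqLocus φ.toAlgHom.toLinearMap ψ.toAlgHom.toLinearMap)
    (isClosed_eq hφ hψ) h a

end Generators

/-! ## The scaling limit -/

section ScalingLimit

variable {d r : ℕ} {ε m : ℝ} (hε : 0 < ε) (hr : 0 < r)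

/-- The scaling map `α^N_{N+1}`. -/
def scalingMap (N : ℕ) : LatAlg d r N →⋆ₐ[ℂ] LatAlg d r (N + 1) :=
  weylMap (momScaleHom hε hr) (symp_momScaleHom hε hr)

theorem scalingMap_weyl (N : ℕ) (ξ : LatSpace d r N) :
    scalingMap hε hr N (weyl ξ) = weyl (momScale ε ξ) :=
  weylMap_weyl _ _ ξ

/-- The composed scaling map need not be written out: the mode coefficients determine the image
vector. -/
theorem exists_transition_weyl {N N' : ℕ} (h : N ≤ N') (ξ : LatSpace d r N) :
    ∃ η : LatSpace d r N', transition (scalingMap hε hr) h (weyl ξ) = weyl η ∧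
      modeCoeff ε η = modeCoeff ε ξ := by
  induction N', h using Nat.le_induction with
  | base => exact ⟨ξ, by rw [transition, Nat.leRecOn_self]; rfl, rfl⟩
  | succ n hn ih =>
    obtain ⟨η, h1, h2⟩ := ih
    exact ⟨momScale ε η, by rw [transition_succ _ hn, h1, scalingMap_weyl],
      by rw [modeCoeff_momScale hε hr, h2]⟩

/-- The free lattice vacuum `ω_{μ}` on `𝒲_{N,L}`. -/
def latVacuum (N : ℕ) {μ : ℝ} (hμ : Real.sqrt (2 * d) < μ) : State (LatAlg d r N) :=
  (fockState (LatSpace d r N)).comap (weylMap (latBog d r N ε μ) (symp_latBog hε hr hμ))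

theorem latVacuum_weyl {N : ℕ} {μ : ℝ} (hμ : Real.sqrt (2 * d) < μ) (ξ : LatSpace d r N) :
    latVacuum hε hr N hμ (weyl ξ) = ((Real.exp (-(1 / 4) * ‖latBog d r N ε μ ξ‖ ^ 2) : ℝ) : ℂ) := by
  rw [latVacuum, State.comap_apply, weylMap_weyl, fockState_weyl]

variable (hm : 0 < m)

/-- The embedding of `𝒲_{N,L}` in `𝒲_L`. -/
def contMap (N : ℕ) : LatAlg d r N →⋆ₐ[ℂ] ContAlg d (halfSide ε r) m :=
  weylMap (contEmb m hε hr) (symp_contEmb hε hr hm)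

theorem contMap_weyl (N : ℕ) (ξ : LatSpace d r N) :
    contMap hε hr hm N (weyl ξ) = weyl (contEmb m hε hr ξ) :=
  weylMap_weyl _ _ ξ

theorem norm_contMap (N : ℕ) (a : LatAlg d r N) : ‖contMap hε hr hm N a‖ = ‖a‖ :=
  norm_weylMap _ _ a

theorem contMap_scalingMap (N : ℕ) (a : LatAlg d r N) :
    contMap hε hr hm (N + 1) (scalingMap hε hr N a) = contMap hε hr hm N a :=
  starAlgHom_eq_of_weyl (φ := (contMap hε hr hm (N + 1)).comp (scalingMap hε hr N))
    (fun ξ => by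
      rw [StarAlgHom.comp_apply, scalingMap_weyl, contMap_weyl, contMap_weyl]
      exact congrArg weyl (contEmb_momScaleHom hε hr ξ)) a

/-- The identification of the inductive limit with a subalgebra of `𝒲_L`. -/
def limMap : IndLim (scalingMap (d := d) hε hr) →⋆ₐ[ℂ] ContAlg d (halfSide ε r) m :=
  IndLim.lift (contMap_scalingMap hε hr hm) (norm_contMap hε hr hm)

theorem limMap_of (N : ℕ) (a : LatAlg d r N) :
    limMap hε hr hm (IndLim.of (scalingMap hε hr) N a) = contMap hε hr hm N a :=
  IndLim.lift_of _ _ N a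

theorem finite_support_contEmb {N : ℕ} (ξ : LatSpace d r N) :
    (Function.support (contEmb m hε hr ξ).coeff).Finite :=
  (symModeSet d r N).finite_toSet.subset fun n hn => by
    by_contra h
    exact hn (bog_modeCoeff_eq_zero _ ξ h)

theorem weyl_mem_range_limMap {ζ : ContSpace d (halfSide ε r) m}
    (hζ : (Function.support ζ.coeff).Finite) : weyl ζ ∈ (limMap hε hr hm).range := by
  obtain ⟨N, ξ, h⟩ := exists_contEmb_coeff_eq hε hr hm hζ
  obtain rfl : contEmb m hε hr ξ = ζ := Subtype.ext (lp.ext (funext h))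
  exact ⟨IndLim.of (scalingMap hε hr) N (weyl ξ), by
    change limMap hε hr hm _ = _
    rw [limMap_of, contMap_weyl]⟩

theorem isClosed_finiteMomentumAlg (L : ℝ) :
    IsClosed (finiteMomentumAlg d L m : Set (ContAlg d L m)) :=
  StarSubalgebra.isClosed_topologicalClosure _

theorem contMap_mem_finiteMomentumAlg (N : ℕ) (a : LatAlg d r N) :
    contMap hε hr hm N a ∈ finiteMomentumAlg d (halfSide ε r) m := by
  let S : Submodule ℂ (LatAlg d r N) :=
    ((finiteMomentumAlg d (halfSide ε r) m).toSubalgebra.toSubmodule).comap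
      (contMap hε hr hm N).toAlgHom.toLinearMap
  refine weylAlgebra_induction (S := S)
    ((isClosed_finiteMomentumAlg _).preimage (map_continuous (contMap hε hr hm N)))
    (fun ξ => ?_) a
  change contMap hε hr hm N (weyl ξ) ∈ finiteMomentumAlg d (halfSide ε r) m
  rw [contMap_weyl]
  exact StarSubalgebra.le_topologicalClosure _
    (StarAlgebra.subset_adjoin ℂ _ ⟨_, finite_support_contEmb hε hr ξ, rfl⟩)

/-- Lattice fields embed with finite momentum support, which gives one inclusion. Conversely the
range is closed and contains all the generators. -/
theorem range_limMap :
    (limMap hε hr hm).range = finiteMomentumAlg d (halfSide ε r) m := by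
  refine le_antisymm ?_ (StarSubalgebra.topologicalClosure_minimal (StarAlgebra.adjoin_le ?_) ?_)
  · rintro _ ⟨x, rfl⟩
    exact IndLim.lift_mem _ _ (isClosed_finiteMomentumAlg _)
      (contMap_mem_finiteMomentumAlg hε hr hm) x
  · rintro _ ⟨ζ, hζ, rfl⟩
    exact weyl_mem_range_limMap hε hr hm hζ
  · exact IndLim.isClosed_range_lift (contMap_scalingMap hε hr hm) (norm_contMap hε hr hm)

theorem dense_vec_limMap :
    Dense (Set.range fun a =>
      (fockState (ContSpace d (halfSide ε r) m)).vec (limMap hε hr hm a)) := by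
  have h := dense_vec_image (dense_finite_support hε hr hm)
    (S := (limMap hε hr hm).range.toSubalgebra.toSubmodule)
    fun ζ hζ => weyl_mem_range_limMap (d := d) hε hr hm hζ
  refine h.mono ?_
  rintro _ ⟨_, ⟨a, rfl⟩, rfl⟩
  exact ⟨a, rfl⟩

theorem tendsto_latVacuum_transition {μ : ℕ → ℝ} (hμ : ∀ N, Real.sqrt (2 * d) < μ N)
    (hren : Tendsto (fun N => (spacing ε N ^ 2)⁻¹ * (μ N ^ 2 - 2 * d)) atTop (𝓝 (m ^ 2)))
    (N : ℕ) (a : LatAlg d r N) :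
    Tendsto (fun M => latVacuum hε hr (N + M) (hμ (N + M))
      (transition (scalingMap hε hr) (Nat.le_add_right N M) a)) atTop
      (𝓝 (fockState (ContSpace d (halfSide ε r) m) (contMap hε hr hm N a))) := by
  refine tendsto_of_tendsto_weyl
    (F := fun M => ((latVacuum hε hr (N + M) (hμ (N + M))).comap
      (transition (scalingMap hε hr) (Nat.le_add_right N M))).toPos.toLinearMap)
    (G := ((fockState (ContSpace d (halfSide ε r) m)).comap
      (contMap hε hr hm N)).toPos.toLinearMap)
    (fun M a => norm_fockState_comap_le ((weylMap (latBog d r (N + M) ε (μ (N + M)))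
      (symp_latBog hε hr (hμ (N + M)))).comp
        (transition (scalingMap hε hr) (Nat.le_add_right N M))) a)
    (fun a => norm_fockState_comap_le _ a) (fun ξ => ?_) a
  change Tendsto (fun M => latVacuum hε hr (N + M) (hμ (N + M))
      (transition (scalingMap hε hr) (Nat.le_add_right N M) (weyl ξ))) atTop
      (𝓝 (fockState (ContSpace d (halfSide ε r) m) (contMap hε hr hm N (weyl ξ))))
  rw [contMap_weyl, fockState_weyl, norm_contEmb_sq]
  have hlim : Tendsto (fun M => ∑ n ∈ symModeSet d r N,
      ‖bog (fun n => -n) (latDispersionAt ε r (N + M) (μ (N + M))) (modeCoeff ε ξ) n‖ ^ 2) atTop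
      (𝓝 (∑ n ∈ symModeSet d r N,
        ‖bog (fun n => -n) (contDispersion ε r m) (modeCoeff ε ξ) n‖ ^ 2)) := by
    refine tendsto_finsetSum _ fun n _ => ?_
    have hγ : Tendsto (fun M => latDispersionAt ε r (N + M) (μ (N + M)) n) atTop
        (𝓝 (contDispersion ε r m n)) :=
      (tendsto_latDispersionAt hε hren n).comp
        (tendsto_atTop_mono (fun M => Nat.le_add_left M N) tendsto_id)
    have hb := tendsto_bog (τ := fun n => -n)
      (γ := fun M => latDispersionAt ε r (N + M) (μ (N + M))) (γ' := contDispersion ε r m)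
      (modeCoeff ε ξ) hγ (dispersion_pos hm _)
    exact hb.norm.pow 2
  refine ((Complex.continuous_ofReal.comp (Real.continuous_exp.comp
    (continuous_const.mul continuous_id))).tendsto _ |>.comp hlim).congr' ?_
  -- M = 0 is left out because `norm_latBog_sq` needs a strictly finer level.
  filter_upwards [eventually_gt_atTop 0] with M hM
  obtain ⟨η, h1, h2⟩ := exists_transition_weyl hε hr (Nat.le_add_right N M) ξ
  rw [h1, latVacuum_weyl, norm_latBog_sq hr (Nat.lt_add_of_pos_right hM) _ ξ η h2]
  rfl

end ScalingLimit

end MomentumCutoff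

end

/-! ### The scaling limit theorem -/

theorem mainTheorem10 (d r : ℕ) (hr : 0 < r) (ε m : ℝ) (hε : 0 < ε) (hm : 0 < m)
    (μ : ℕ → ℝ) (hμ : ∀ N, Real.sqrt (2 * d) < μ N)
    (hren : Filter.Tendsto
      (fun N => (MomentumCutoff.spacing ε N ^ 2)⁻¹ * (μ N ^ 2 - 2 * d)) Filter.atTop
      (nhds (m ^ 2))) :
    -- the scaling maps `α^N_{N+1}`, the lattice vacua `ω_{μ_N}`, the continuum vacuum `ω_L`
    ∃ (α : ∀ N, MomentumCutoff.LatAlg d r N →⋆ₐ[ℂ] MomentumCutoff.LatAlg d r (N + 1))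
      (ω₀ : ∀ N, MomentumCutoff.State (MomentumCutoff.LatAlg d r N))
      (ωL : MomentumCutoff.State (MomentumCutoff.ContAlg d (MomentumCutoff.halfSide ε r) m)),
      (∀ N (ξ : MomentumCutoff.LatSpace d r N),
        α N (MomentumCutoff.weyl ξ) = MomentumCutoff.weyl (MomentumCutoff.momScale ε ξ)) ∧
      (∀ N (ξ : MomentumCutoff.LatSpace d r N),
        ω₀ N (MomentumCutoff.weyl ξ) = (MomentumCutoff.latVacuumValue ε (μ N) ξ : ℂ)) ∧
      (∀ ζ : MomentumCutoff.ContSpace d (MomentumCutoff.halfSide ε r) m,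
        ωL (MomentumCutoff.weyl ζ) = (Real.exp (-(1 / 4) * ‖ζ‖ ^ 2) : ℂ)) ∧
      -- the weak* limits of the renormalized vacua, and the scaling limit
      ∃ (ωlim : ∀ N, MomentumCutoff.State (MomentumCutoff.LatAlg d r N))
        (ωsc : MomentumCutoff.State (MomentumCutoff.IndLim α)),
        (∀ N (a : MomentumCutoff.LatAlg d r N), Filter.Tendsto
          (fun M => ω₀ (N + M) (MomentumCutoff.transition α (Nat.le_add_right N M) a))
          Filter.atTop (nhds (ωlim N a))) ∧
        (∀ N N' (h : N ≤ N') (a : MomentumCutoff.LatAlg d r N),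
          ωlim N' (MomentumCutoff.transition α h a) = ωlim N a) ∧
        (∀ N (a : MomentumCutoff.LatAlg d r N),
          ωsc (MomentumCutoff.IndLim.of α N a) = ωlim N a) ∧
        -- the identification of the inductive limit, and the unitary equivalence
        ∃ (Φ : MomentumCutoff.IndLim α →⋆ₐ[ℂ]
              MomentumCutoff.ContAlg d (MomentumCutoff.halfSide ε r) m)
          (U : ωsc.Space ≃ₗᵢ[ℂ] ωL.Space),
          Function.Injective Φ ∧
          Φ.range = MomentumCutoff.finiteMomentumAlg d (MomentumCutoff.halfSide ε r) m ∧
          (∀ N (ξ : MomentumCutoff.LatSpace d r N),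
            ∃ ζ : MomentumCutoff.ContSpace d (MomentumCutoff.halfSide ε r) m,
              MomentumCutoff.IsClassOf ζ (MomentumCutoff.toTorus ε ξ) ∧
              Φ (MomentumCutoff.IndLim.of α N (MomentumCutoff.weyl ξ)) =
                MomentumCutoff.weyl ζ) ∧
          (∀ a, ωsc a = ωL (Φ a)) ∧
          (∀ a (v : ωsc.Space), U (ωsc.rep a v) = ωL.rep (Φ a) (U v)) ∧
          U ωsc.vac = ωL.vac := by
  obtain ⟨U, hU, hU'⟩ := MomentumCutoff.State.exists_unitary_comap
    (MomentumCutoff.fockState (MomentumCutoff.ContSpace d (MomentumCutoff.halfSide ε r) m))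
    (MomentumCutoff.limMap (d := d) hε hr hm) (MomentumCutoff.dense_vec_limMap hε hr hm)
  refine ⟨MomentumCutoff.scalingMap hε hr, fun N => MomentumCutoff.latVacuum hε hr N (hμ N),
    MomentumCutoff.fockState _, MomentumCutoff.scalingMap_weyl hε hr, fun N ξ => ?_,
    MomentumCutoff.fockState_weyl,
    -- The limit states are taken from the outset as pullbacks of ω_L, so projective consistency is
    -- only the compatibility of the embeddings with the scaling maps.
    fun N => (MomentumCutoff.fockState _).comap (MomentumCutoff.contMap hε hr hm N),
    (MomentumCutoff.fockState _).comap (MomentumCutoff.limMap hε hr hm),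
    MomentumCutoff.tendsto_latVacuum_transition hε hr hm hμ hren, fun N N' h a => ?_,
    fun N a => ?_, MomentumCutoff.limMap hε hr hm, U, MomentumCutoff.IndLim.lift_injective _ _,
    MomentumCutoff.range_limMap hε hr hm,
    fun N ξ => ⟨_, MomentumCutoff.isClassOf_contEmb hε hr ξ, ?_⟩, fun a => rfl, hU, hU'⟩
  · rw [MomentumCutoff.latVacuum_weyl, MomentumCutoff.exp_norm_latBog hε hr (hμ N)]
  · rw [MomentumCutoff.State.comap_apply, MomentumCutoff.State.comap_apply,
      MomentumCutoff.map_transition (MomentumCutoff.contMap_scalingMap hε hr hm)]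
  · rw [MomentumCutoff.State.comap_apply, MomentumCutoff.State.comap_apply,
      MomentumCutoff.limMap_of]
  · rw [MomentumCutoff.limMap_of, MomentumCutoff.contMap_weyl]
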